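/- **Setting.** Let $\mathbb I=[-1,1]$ and let $(a_j)_{j\in\mathbb N}$, $(b_j)_{j\in\mathbb N}$ be bounded real sequences with $\inf_j a_j>-1$, $\inf_j b_j>-1$. Let $\mu_{a,b}$ be the Jacobi probability measure on $\mathbb I$ with density $\frac{\Gamma(a+b+2)}{2^{a+b+1}\Gamma(a+1)\Gamma(b+1)}(1-y)^a(1+y)^b$, let $(J^{a,b}_k)_{k\ge 0}$ be the corresponding orthonormal Jacobi polynomials ($\deg J_k^{a,b}=k$, positive leading coefficient), and let $\mu=\bigotimes_{j}\mu_{a_j,b_j}$ on $\mathbb I^\infty$. Let $\mathcal F_{\rm ev}$ be the set of finitely supported multi-indices $\nu=(\nu_j)_{j\in\mathbb N}$ with all $\nu_j\in 2\mathbb N_0$, ordered componentwise. For a finitely supported multi-index $\nu$ put $J_\nu(y)=\prod_{j}J^{a_j,b_j}_{\nu_j}(y_j)$ and $p_\nu(\theta,\lambda)=\prod_j(1+\lambda\nu_j)^\theta$. Let $\theta_0=\max\{\sup_j a_j,\sup_j b_j,-\tfrac12\}+\tfrac12$, let $\varepsilon>0$, let $C_\varepsilon>0$ be a number such that $$2\,\|J_k^{a_j,b_j}\|_{L_\infty(\mathbb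 I)}\log(2k+3)\le (C_\varepsilon k+1)^{\theta_0+\varepsilon}\qquad\text{for all } j\in\mathbb N,\ k\ge 1,$$ and put $\theta=\theta_0+1+\varepsilon$, $\lambda=C_\varepsilon+1$. Let $X^1,X^2$ be (real or complex) Hilbert spaces, $X^2$ a linear subspace of $X^1$ with $\|w\|_{X^1}\le C\|w\|_{X^2}$ for $w\in X^2$. Let $V_m\subset X^1$ ($m\in\mathbb N_0$) be subspaces with $\dim V_m\le m$, let $P_m:X^1\to V_m$ be linear, and let $\alpha,C_1,C_2>0$ be such that for all $w\in X^2$ $$\|P_m w\|_{X^1}\le C_1\|w\|_{X^1}\ (m\ge 0),\qquad \|w-P_m w\|_{X^1}\le C_2m^{-\alpha}\|w\|_{X^2}\ (m\ge 1).$$ Put $\delta_0=P_1$ and $\delta_k=P_{2^k}-P_{2^{k-1}}$ for $k\ge 1$. Let $v\in L_2(\mathbb I^\infty,X^2;\mu)$, $v_\nu=\int vJ_\nu\,d\mu$, have an even Jacobi expansion $v=\sum_{\nu\in\mathcal F_{\rm ev}}v_\nu J_\nu$ (convergence in $L_2(\mathbb I^\infty,X^2;\mu)$). Let $0<q_1\le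 q_2<2$ and, for $i=1,2$, let $(\sigma_{i;\nu})_{\nu\in\mathcal F_{\rm ev}}\subset(1,\infty)$ be increasing in $\nu$ with $$\sum_{\nu\in\mathcal F_{\rm ev}}\big(\sigma_{i;\nu}\|v_\nu\|_{X^i}\big)^2<\infty,\qquad \big(p_\nu(\theta,\lambda)^{2/q_i}\sigma_{i;\nu}^{-1}\big)_{\nu}\in\ell_{q_i}(\mathcal F_{\rm ev}).$$ For $\xi>1$, with $\tau=\frac{2\alpha}{2-q_2}$, $\vartheta=\frac{2}{2-q_2}\big(\frac1{q_1}-\frac12\big)$, $\eta=\big(\frac1{q_1}-\frac12\big)^{-1}$, let $G_{\rm ev}(\xi)$ be the set of $(k,\nu)\in\mathbb N_0\times\mathcal F_{\rm ev}$ with $$2^k\sigma_{2;\nu}^{q_2}\le\xi\quad\text{if }\alpha\le\tfrac1{q_2}-\tfrac12,\qquad\qquad \sigma_{1;\nu}^{q_1}\le\xi(\log\xi)^\eta\ \text{ and }\ 2^{\tau k}\sigma_{2;\nu}\le\xi^\vartheta\quad\text{if }\alpha>\tfrac1{q_2}-\tfrac12 .$$ For finite $G\subset\mathbb N_0\times\mathcal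 F_{\rm ev}$ let $\mathcal V(G)=\big\{\sum_{(k,\nu)\in G}w_{k,\nu}J_\nu:\ w_{k,\nu}\in V_{2^k}\big\}$ and, for continuous $f:\mathbb I^\infty\to X^2$, $$\mathcal I^*_G f=\sum_{(k,\nu)\in G}\big(\delta_k\otimes\Delta^*_\nu\big)f,\qquad \Delta^*_\nu=\bigotimes_{j}\big(I_{\nu_j}-I_{\nu_j-2}\big),\quad I_{-2}=0,$$ where $I_m$ is univariate Lagrange interpolation at the Chebyshev nodes $-\cos\frac{(2k+1)\pi}{2(m+1)}$, $k=0,\dots,m$. **Statement.** The function $v$ has a continuous representative $\mathbb I^\infty\to X^2$, again denoted by $v$, and for each $n\in\mathbb N$ there is a number $\xi_n>1$ such that $G_{\rm ev}(\xi_n)$ is finite and $\dim\mathcal V(G_{\rm ev}(\xi_n))\le n$; if $a_j=b_j$ for all $j$, then moreover $\mathcal I^*_{G_{\rm ev}(\xi_n)}v\in\mathcal V(G_{\rm ev}(\xi_n))$. Furthermore, there is a constant $C>0$ such that for all $0<p\le2$ and all $n\in\mathbb N$ (all $n\ge2$ in the second case) $$\big\|v-\mathcal I^*_{G_{\rm ev}(\xi_n)}v\big\|_{L_p(\mathbb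 I^\infty,X^1;\mu)}\le C\begin{cases}n^{-\alpha}&\text{if }\alpha\le\frac1{q_2}-\frac12,\\ n^{-\beta}(\log n)^\kappa&\text{if }\alpha>\frac1{q_2}-\frac12,\end{cases}$$ where $$\beta=\Big(\frac1{q_1}-\frac12\Big)\frac{\alpha}{\alpha+\delta},\qquad \delta=\frac1{q_1}-\frac1{q_2},\qquad \kappa=\frac{\alpha+\frac12-\frac1{q_2}}{\alpha+\frac1{q_1}-\frac1{q_2}},$$ and $0<\kappa<1$ in the second case. -/

import Mathlib

open MeasureTheory Filter Topology Polynomial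
open scoped ENNReal

noncomputable section

namespace JacobiSparse

/-! ### Jacobi measures and orthonormal Jacobi polynomials -/

/-- The interval `[-1, 1]`. -/
abbrev II : Type := Set.Icc (-1 : ℝ) 1

/-- The parameter domain `[-1, 1]^ℕ`. -/
abbrev Cube : Type := ℕ → II

/-- The Jacobi probability density
`Γ(a+b+2) / (2^(a+b+1) Γ(a+1) Γ(b+1)) * (1-y)^a (1+y)^b`. -/
def jacobiDensity (a b y : ℝ) : ℝ :=
  Real.Gamma (a + b + 2) / (2 ^ (a + b + 1) * Real.Gamma (a + 1) * Real.Gamma (b + 1)) *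
    (1 - y) ^ a * (1 + y) ^ b

/-- The Jacobi probability measure on `[-1, 1]`. -/
def jacobiMeasure (a b : ℝ) : Measure II :=
  (Measure.comap (Subtype.val : II → ℝ) volume).withDensity fun y =>
    ENNReal.ofReal (jacobiDensity a b y)

/-- The Jacobi measure is a probability measure; this is what makes the infinite product below
the actual product measure. -/
theorem isProbabilityMeasure_jacobiMeasure {a b : ℝ} (ha : -1 < a) (hb : -1 < b) :
    IsProbabilityMeasure (jacobiMeasure a b) := by
  constructor
  rw [jacobiMeasure, withDensity_apply _ MeasurableSet.univ, Measure.restrict_univ,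
    lintegral_subtype_comap measurableSet_Icc (fun y => ENNReal.ofReal (jacobiDensity a b y)),
    ← setLIntegral_congr (Ioo_ae_eq_Icc (μ := volume) (a := (-1 : ℝ)) (b := 1))]
  have himg : (fun x : ℝ => 2 * x - 1) '' Set.Ioo 0 1 = Set.Ioo (-1) 1 := by
    ext y
    constructor
    · rintro ⟨x, ⟨h0, h1⟩, rfl⟩
      constructor <;> dsimp only <;> linarith
    · rintro ⟨h0, h1⟩
      exact ⟨(y + 1) / 2, ⟨by linarith, by linarith⟩, by ring⟩
  rw [← himg, lintegral_image_eq_lintegral_abs_deriv_mul (f' := fun _ => 2) measurableSet_Ioo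
    (fun x _ => by
      simpa using (((hasDerivAt_id x).const_mul 2).sub_const 1).hasDerivWithinAt)
    (fun x _ y _ h => by simpa using h),
    ← ProbabilityTheory.lintegral_betaPDF_eq_one (α := b + 1) (β := a + 1) (by linarith)
      (by linarith), ProbabilityTheory.lintegral_betaPDF]
  refine setLIntegral_congr_fun measurableSet_Ioo fun x hx => ?_
  rw [← ENNReal.ofReal_mul (by positivity)]
  congr 1
  have h1 : 1 - (2 * x - 1) = 2 * (1 - x) := by ring
  have h2 : 1 + (2 * x - 1) = 2 * x := by ring
  have h3 : (2 : ℝ) ^ (a + b + 1) = 2 ^ a * 2 ^ b * 2 := by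
    rw [Real.rpow_add two_pos, Real.rpow_add two_pos, Real.rpow_one]
  have h4 : b + 1 + (a + 1) = a + b + 2 := by ring
  have hg1 := (Real.Gamma_pos_of_pos (show 0 < a + 1 by linarith)).ne'
  have hg2 := (Real.Gamma_pos_of_pos (show 0 < b + 1 by linarith)).ne'
  have hg3 := (Real.Gamma_pos_of_pos (show 0 < a + b + 2 by linarith)).ne'
  rw [jacobiDensity, ProbabilityTheory.beta, h1, h2, h3, h4,
    Real.mul_rpow two_pos.le (by linarith [hx.2]), Real.mul_rpow two_pos.le hx.1.le,
    add_sub_cancel_right, add_sub_cancel_right, abs_two]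
  field_simp

/-- The monic orthogonal polynomials of a measure on `[-1, 1]` (Gram-Schmidt on monomials). -/
def monicOrtho (μ : Measure II) (n : ℕ) : ℝ[X] :=
  X ^ n - ∑ i : Fin n,
    C ((∫ t : II, (t : ℝ) ^ n * (monicOrtho μ i).eval (t : ℝ) ∂μ) /
        ∫ t : II, ((monicOrtho μ i).eval (t : ℝ)) ^ 2 ∂μ) * monicOrtho μ i
termination_by n
decreasing_by all_goals exact i.isLt

/-- The `n`-th Jacobi polynomial, normalized in `L²` of the Jacobi probability measure: the
orthonormal polynomial of degree `n` with positive leading coefficient. -/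
def jacobi (a b : ℝ) (n : ℕ) : ℝ[X] :=
  C (Real.sqrt (∫ t : II, ((monicOrtho (jacobiMeasure a b) n).eval (t : ℝ)) ^ 2
      ∂(jacobiMeasure a b)))⁻¹ * monicOrtho (jacobiMeasure a b) n

/-- Two bounded parameter sequences, bounded away from `-1`. -/
structure JacobiParams where
  a : ℕ → ℝ
  b : ℕ → ℝ
  bdd_a : BddAbove (Set.range a)
  bdd_b : BddAbove (Set.range b)
  lower_a : ∃ c, -1 < c ∧ ∀ j, c ≤ a j
  lower_b : ∃ c, -1 < c ∧ ∀ j, c ≤ b j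

/-- The infinite product of the Jacobi probability measures. -/
def JacobiParams.measure (𝔧 : JacobiParams) : Measure Cube :=
  Measure.infinitePi fun j => jacobiMeasure (𝔧.a j) (𝔧.b j)

theorem JacobiParams.isProbabilityMeasure_measure (𝔧 : JacobiParams) :
    IsProbabilityMeasure 𝔧.measure := by
  obtain ⟨c, hc, hac⟩ := 𝔧.lower_a
  obtain ⟨d, hd, hbd⟩ := 𝔧.lower_b
  have : ∀ j, IsProbabilityMeasure (jacobiMeasure (𝔧.a j) (𝔧.b j)) := fun j =>
    isProbabilityMeasure_jacobiMeasure (hc.trans_le (hac j)) (hd.trans_le (hbd j))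
  rw [JacobiParams.measure]
  infer_instance

/-- The tensor product Jacobi polynomial `∏_{j ∈ supp ν} J_{ν_j}(y_j)`. -/
def JacobiParams.J (𝔧 : JacobiParams) (ν : ℕ →₀ ℕ) (y : Cube) : ℝ :=
  ν.prod fun j n => (jacobi (𝔧.a j) (𝔧.b j) n).eval (y j : ℝ)

/-- `θ₀ = max (sup a, sup b, -1/2) + 1/2`. -/
def JacobiParams.θ₀ (𝔧 : JacobiParams) : ℝ :=
  max (max (⨆ j, 𝔧.a j) (⨆ j, 𝔧.b j)) (-(1 / 2)) + 1 / 2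

/-- The finitely supported multi-indices with even entries, ordered componentwise. -/
abbrev EvenIdx : Type := {ν : ℕ →₀ ℕ // ∀ j, Even (ν j)}

/-- The Jacobi coefficients `v_ν = ∫ v J_ν dμ`. -/
def JacobiParams.coeff {X : Type*} [NormedAddCommGroup X] [NormedSpace ℝ X]
    (𝔧 : JacobiParams) (v : Cube → X) (ν : ℕ →₀ ℕ) : X :=
  ∫ y, 𝔧.J ν y • v y ∂𝔧.measure

/-- The weights `p_ν(θ, lam) = ∏_j (1 + lam ν_j)^θ`. -/
def weight (θ lam : ℝ) (ν : ℕ →₀ ℕ) : ℝ := ν.prod fun _ n => (1 + lam * n) ^ θ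

/-- `v ∈ L²(μ; X)` has the even Jacobi expansion `v = ∑_{ν even} v_ν J_ν`, the series converging
in `L²(μ; X)`. -/
structure JacobiParams.HasEvenExpansion {X : Type*} [NormedAddCommGroup X] [NormedSpace ℝ X]
    (𝔧 : JacobiParams) (v : Cube → X) : Prop where
  memLp : MemLp v 2 𝔧.measure
  tendsto : Tendsto
    (fun s : Finset EvenIdx =>
      eLpNorm (fun y => v y - ∑ ν ∈ s, 𝔧.J ν y • 𝔧.coeff v ν) 2 𝔧.measure)
    atTop (𝓝 0)

/-! ### Spatial approximation -/

/-- Stability and consistency, at rate `α`, of linear maps `P_m` from `X₁` into subspaces `V_m` of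
dimension at most `m`, for data in the space `X₂` embedded into `X₁` by `ι`. -/
structure SpatialApprox {𝕜 X₁ X₂ : Type*} [RCLike 𝕜]
    [NormedAddCommGroup X₁] [InnerProductSpace 𝕜 X₁]
    [NormedAddCommGroup X₂] [InnerProductSpace 𝕜 X₂]
    (ι : X₂ →L[𝕜] X₁) (V : ℕ → Submodule 𝕜 X₁) (P : ℕ → X₁ →ₗ[𝕜] X₁) (α : ℝ) : Prop where
  rank_le : ∀ m, Module.rank 𝕜 (V m) ≤ m
  mem : ∀ m w, P m w ∈ V m
  stable : ∃ C₁ > 0, ∀ m, ∀ w : X₂, ‖P m (ι w)‖ ≤ C₁ * ‖ι w‖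
  consistent : ∃ C₂ > 0, ∀ m : ℕ, 1 ≤ m → ∀ w : X₂,
    ‖ι w - P m (ι w)‖ ≤ C₂ * (m : ℝ) ^ (-α) * ‖w‖

/-- The dyadic increments `δ_0 = P_1` and `δ_k = P_{2^k} - P_{2^(k-1)}` for `k ≥ 1`. -/
def spatialIncr {𝕜 X₁ : Type*} [RCLike 𝕜] [NormedAddCommGroup X₁] [InnerProductSpace 𝕜 X₁]
    (P : ℕ → X₁ →ₗ[𝕜] X₁) : ℕ → X₁ →ₗ[𝕜] X₁
  | 0 => P 1
  | k + 1 => P (2 ^ (k + 1)) - P (2 ^ k)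

/-! ### Symmetric sparse-grid interpolation -/

/-- The Chebyshev nodes `-cos ((2k+1)π / (2(m+1)))`, `k = 0, …, m`. -/
def chebNode (m : ℕ) (k : Fin (m + 1)) : II :=
  ⟨-Real.cos ((2 * (k : ℝ) + 1) * Real.pi / (2 * ((m : ℝ) + 1))),
    neg_le_neg (Real.cos_le_one _), neg_le.mpr (Real.neg_one_le_cos _)⟩

/-- The interpolation operator `I_m` at the Chebyshev nodes, acting on the `j`-th variable. -/
def interp {X : Type*} [NormedAddCommGroup X] [NormedSpace ℝ X]
    (m j : ℕ) (v : Cube → X) (y : Cube) : X :=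
  ∑ k : Fin (m + 1),
    (Lagrange.basis Finset.univ (fun i => (chebNode m i : ℝ)) k).eval (y j : ℝ) •
      v (Function.update y j (chebNode m k))

/-- The even increment `I_m - I_{m-2}` (with `I_{-2} = 0`) in the `j`-th variable, for even `m`. -/
def evenIncr {X : Type*} [NormedAddCommGroup X] [NormedSpace ℝ X]
    (m j : ℕ) (v : Cube → X) (y : Cube) : X :=
  interp m j v y - if m = 0 then 0 else interp (m - 2) j v y

/-- The even increments of orders `ν_0, …, ν_(N-1)` applied successively in the variables
`0, …, N-1`. -/
def partialIncr {X : Type*} [NormedAddCommGroup X] [NormedSpace ℝ X]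
    (ν : ℕ →₀ ℕ) (v : Cube → X) : ℕ → Cube → X
  | 0 => v
  | N + 1 => evenIncr (ν N) N (partialIncr ν v N)

/-- The tensorized even increment `⨂_j (I_{ν_j} - I_{ν_j - 2})`. With `N` the least number such that
`ν_j = 0` for all `j ≥ N`, the factors with `j ≥ N` are all equal to `I_0`, that is, they evaluate
the `j`-th variable at the only node of order `0`. -/
def tensorIncr {X : Type*} [NormedAddCommGroup X] [NormedSpace ℝ X]
    (ν : ℕ →₀ ℕ) (v : Cube → X) : Cube → X :=
  partialIncr ν
    (fun y => v fun j => if j < ν.support.sup Nat.succ then y j else chebNode 0 0)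
    (ν.support.sup Nat.succ)

/-- The symmetric sparse tensor product interpolation `∑_{(k,ν) ∈ G} (δ_k ⊗ Δ*_ν) v` over a finite
index set `G`. -/
def symInterp {𝕜 X₁ X₂ : Type*} [RCLike 𝕜]
    [NormedAddCommGroup X₁] [InnerProductSpace 𝕜 X₁]
    [NormedAddCommGroup X₂] [InnerProductSpace 𝕜 X₂] [NormedSpace ℝ X₂]
    (ι : X₂ →L[𝕜] X₁) (P : ℕ → X₁ →ₗ[𝕜] X₁) (G : Set (ℕ × EvenIdx)) (v : Cube → X₂)
    (y : Cube) : X₁ :=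
  ∑ᶠ g ∈ G, spatialIncr P g.1 (ι (tensorIncr (g.2 : ℕ →₀ ℕ) v y))

/-- The approximation space spanned by the functions `J_ν w` with `(k, ν) ∈ G` and
`w ∈ V_{2^k}`. -/
def approxSpace {𝕜 X₁ : Type*} [RCLike 𝕜] [NormedAddCommGroup X₁] [InnerProductSpace 𝕜 X₁]
    [NormedSpace ℝ X₁] (𝔧 : JacobiParams) (V : ℕ → Submodule 𝕜 X₁) (G : Set (ℕ × EvenIdx)) :
    Submodule 𝕜 (Cube → X₁) :=
  Submodule.span 𝕜 {f | ∃ g ∈ G, ∃ w ∈ V (2 ^ g.1), f = fun y => 𝔧.J g.2 y • w}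

/-- The thresholded even index sets. -/
def evenThreshold (α q₁ q₂ : ℝ) (σ₁ σ₂ : EvenIdx → ℝ) (ξ : ℝ) : Set (ℕ × EvenIdx) :=
  let τ : ℝ := 2 * α / (2 - q₂)
  let ϑ : ℝ := 2 / (2 - q₂) * (1 / q₁ - 1 / 2)
  let η : ℝ := (1 / q₁ - 1 / 2)⁻¹
  if α ≤ 1 / q₂ - 1 / 2 then
    {g | (2 : ℝ) ^ g.1 * σ₂ g.2 ^ q₂ ≤ ξ}
  else
    {g | σ₁ g.2 ^ q₁ ≤ ξ * Real.log ξ ^ η ∧ (2 : ℝ) ^ (τ * g.1) * σ₂ g.2 ≤ ξ ^ ϑ}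

/-- The weight conditions on one family `σ`, for the norms `x ν` of the coefficients. -/
structure WeightedSummable (θ lam q : ℝ) (σ : EvenIdx → ℝ) (x : EvenIdx → ℝ) : Prop where
  one_lt : ∀ ν, 1 < σ ν
  mono : Monotone σ
  summable : Summable fun ν => (σ ν * x ν) ^ 2
  memℓq : Summable fun ν : EvenIdx => (weight θ lam (ν : ℕ →₀ ℕ) ^ (2 / q) * (σ ν)⁻¹) ^ q

/-- `β = (1/q₁ - 1/2) α / (α + δ)` with `δ = 1/q₁ - 1/q₂`. -/
def rateβ (α q₁ q₂ : ℝ) : ℝ := (1 / q₁ - 1 / 2) * (α / (α + (1 / q₁ - 1 / q₂)))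

/-- `κ = (α + 1/2 - 1/q₂) / (α + 1/q₁ - 1/q₂)`. -/
def rateκ (α q₁ q₂ : ℝ) : ℝ := (α + 1 / 2 - 1 / q₂) / (α + 1 / q₁ - 1 / q₂)

/-- The convergence rate. -/
def rate (α q₁ q₂ : ℝ) (n : ℕ) : ℝ :=
  if α ≤ 1 / q₂ - 1 / 2 then (n : ℝ) ^ (-α)
  else (n : ℝ) ^ (-rateβ α q₁ q₂) * Real.log n ^ rateκ α q₁ q₂

end JacobiSparse

end

/-!
The proof is pointwise on `[-1, 1]^ℕ`; the `L^p` bounds follow because the measure has mass one.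

*Increments of the basis.* As `J_μ` has degree `μ_j` in the variable `y_j`, `Δ*_ν J_μ = 0` for even
`ν`, `μ` unless `ν ≤ μ`, and the increments with `ν ≤ μ` add up to `J_μ`
(`JacobiParams.incrJ_eq_zero`, `JacobiParams.sum_incrJ`). The Lebesgue constants of the Chebyshev
nodes grow logarithmically (`sum_abs_basis_eval_le_log`); together with the assumed bound on the
univariate Jacobi polynomials this gives `∑_{ν ≤ μ} |Δ*_ν J_μ| ≤ p_μ`, where `p_μ` is the weight of
the theorem (`JacobiParams.sum_abs_incrJ_le`). In particular `|J_μ| ≤ p_μ`, and as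
`∑ p_μ ‖v_μ‖ < ∞` the expansion of `v` converges uniformly
(`JacobiParams.exists_continuous_representative`); the interpolation may be applied to it term by
term.

*The error of one coefficient.* Let `G` be a finite lower set and let `κ` be such that
`(k, μ) ∈ G` for all `k < κ`. For `k < κ` all increments `ν ≤ μ` occur together with `δ_k`, so
`δ_k v_μ` is multiplied with the full `J_μ`; the orders `k ≥ κ` contribute a geometric tail. Hence
the error caused by `v_μ` is `O(2^{-ακ} p_μ ‖v_μ‖₂)`. Alternatively, stability alone bounds it by
`O(K p_μ ‖v_μ‖₁)` if `k < K` on all of `G` (`norm_sub_symInterp_le`).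

*Summation.* As `2ab ≤ a² + b²`, the assumptions yield `∑ σ_μ^{1 - q/2} p_μ ‖v_μ‖ < ∞` for both
weights (`WeightedSummable.summable_rpow_mul`). In the first case the threshold gives
`2^{-ακ} ≤ ξ^{-α} σ_{2;μ}^{1 - q₂/2}` for the first `κ` with `(κ, μ) ∉ G(ξ)`, and the error is
`O(ξ^{-α})`. In the second case the error is `O(ξ^{-ρ})` with `ρ = 1/q₁ - 1/2`: if `σ_{1;μ}` is
below its threshold, the same argument applies, and otherwise stability costs a factor `K ≈ log ξ`,
which the factor `(log ξ)^{1/ρ}` in the threshold compensates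
(`exists_error_threshold₁`, `exists_error_threshold₂`).

*Dimensions.* Summing `2^k` over the index set gives `O(ξ)` in the first case and
`O(ξ^{ϑ/τ} (ξ (log ξ)^{1/ρ})^{1 - 1/(τ q₂)})` in the second (`sum_threshold₁_le`,
`sum_threshold₂_le`). Choosing `ξ_n` so that this is at most `n` turns the error bounds into the
claimed rates (`exists_thresholds₁`, `exists_thresholds₂`). For the finitely many `n` where this
choice is not admissible, an `ξ_n > 1` with empty index set serves.

*Membership.* If `a_j = b_j`, even Jacobi polynomials are even functions, interpolation at symmetric
nodes preserves parity, and therefore `Δ*_ν J_μ` lies in the span of the `J_κ`, `κ ≤ ν` even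
(`JacobiParams.incrJ_mem_span`). This span is finite-dimensional, so its elements are determined
linearly by finitely many values; the same interpolation formula holds for the infinite sum
`Δ*_ν v`, without any closedness of the subspaces `V_m` (`symInterp_mem_approxSpace`).
-/

namespace JacobiSparse

/-! ### The Lebesgue constants of the Chebyshev nodes -/

/-- The angles `(2k+1)π/(2N)`, indexed by all integers: modulo `2π` they are `2N` equidistant
points, and their cosines are the zeros of the Chebyshev polynomial `T_N`. -/
noncomputable def chebAngle (N : ℕ) (k : ℤ) : ℝ := (2 * k + 1) * Real.pi / (2 * N)

theorem chebNode_rev (m : ℕ) (k : Fin (m + 1)) :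
    (chebNode m k.rev : ℝ) = Real.cos (chebAngle (m + 1) (k : ℕ)) := by
  have hk : (((k.rev : Fin (m + 1)) : ℕ) : ℝ) = m - (k : ℕ) := by
    rw [Fin.val_rev, Nat.cast_sub (by omega)]
    push_cast; ring
  simp only [chebNode, chebAngle]
  rw [← Real.cos_pi_sub, hk]
  congr 1
  have : (m : ℝ) + 1 ≠ 0 := by positivity
  push_cast
  field_simp
  ring

theorem cos_mul_chebAngle {N : ℕ} (hN : N ≠ 0) (k : ℤ) : Real.cos (N * chebAngle N k) = 0 := by
  rw [Real.cos_eq_zero_iff]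
  exact ⟨k, by unfold chebAngle; field_simp⟩

theorem abs_sin_mul_chebAngle {N : ℕ} (hN : N ≠ 0) (k : ℤ) :
    |Real.sin (N * chebAngle N k)| = 1 := by
  have h := Real.sin_sq_add_cos_sq (N * chebAngle N k)
  rw [cos_mul_chebAngle hN] at h
  rw [← sq_abs] at h
  nlinarith [abs_nonneg (Real.sin (N * chebAngle N k))]

theorem abs_sin_mul_sub_chebAngle {N : ℕ} (hN : N ≠ 0) (k : ℤ) (θ : ℝ) :
    |Real.sin (N * (θ - chebAngle N k))| = |Real.cos (N * θ)| := by
  rw [mul_sub, Real.sin_sub, cos_mul_chebAngle hN, mul_zero, zero_sub, abs_neg, abs_mul,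
    abs_sin_mul_chebAngle hN, mul_one]

theorem chebNode_injective (m : ℕ) :
    Function.Injective fun i : Fin (m + 1) => (chebNode m i : ℝ) := by
  have hmem : ∀ k : Fin (m + 1), (2 * (k : ℝ) + 1) * Real.pi / (2 * ((m : ℝ) + 1)) ∈
      Set.Icc 0 Real.pi := by
    intro k
    have hk : ((k : ℕ) : ℝ) ≤ m := by exact_mod_cast Nat.lt_succ_iff.mp k.2
    refine ⟨by positivity, ?_⟩
    rw [div_le_iff₀ (by positivity)]
    nlinarith [Real.pi_pos]
  intro i j h
  have h' := Real.injOn_cos (hmem i) (hmem j) (by simpa [chebNode] using h)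
  have hm : (0 : ℝ) < 2 * ((m : ℝ) + 1) := by positivity
  rw [div_left_inj' hm.ne', mul_left_inj' Real.pi_ne_zero] at h'
  exact Fin.ext (by exact_mod_cast (by linarith : ((i : ℕ) : ℝ) = (j : ℕ)))

theorem exists_T_eq_nodal (m : ℕ) : ∃ c : ℝ, c ≠ 0 ∧
    Chebyshev.T ℝ ((m + 1 : ℕ) : ℤ) =
      C c * Lagrange.nodal Finset.univ fun i => (chebNode m i : ℝ) := by
  set T := Chebyshev.T ℝ ((m + 1 : ℕ) : ℤ) with hT
  have hdeg : T.degree = ((m + 1 : ℕ) : WithBot ℕ) := by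
    rw [hT, Chebyshev.degree_T, Int.natAbs_natCast]
  have hT0 : T ≠ 0 := by rintro h; rw [h, degree_zero] at hdeg; exact WithBot.bot_ne_coe hdeg
  have hc : T.leadingCoeff ≠ 0 := leadingCoeff_ne_zero.mpr hT0
  have hcard : (Finset.univ : Finset (Fin (m + 1))).card = m + 1 := by simp
  have hdeg2 : (C T.leadingCoeff * Lagrange.nodal Finset.univ
      fun i => (chebNode m i : ℝ)).degree = ((m + 1 : ℕ) : WithBot ℕ) := by
    rw [degree_C_mul hc, Lagrange.degree_nodal, hcard]
  refine ⟨T.leadingCoeff, hc, ?_⟩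
  refine Polynomial.eq_of_degree_sub_lt_of_eval_index_eq
    (s := Finset.univ) (v := fun i => (chebNode m i : ℝ)) (chebNode_injective m).injOn ?_ ?_
  · rw [hcard]
    refine (degree_sub_lt_left (hdeg.trans hdeg2.symm) hT0 ?_).trans_eq hdeg
    rw [leadingCoeff_mul, leadingCoeff_C, Lagrange.nodal_monic.leadingCoeff, mul_one]
  · intro i _
    rw [eval_mul, Lagrange.eval_nodal_at_node (v := fun i => (chebNode m i : ℝ))
      (Finset.mem_univ i), mul_zero]
    have := chebNode_rev m i.rev
    rw [Fin.rev_rev] at this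
    rw [this, hT, Chebyshev.T_real_cos]
    exact_mod_cast cos_mul_chebAngle (Nat.succ_ne_zero m) _

/-- The Lagrange basis polynomials of the Chebyshev nodes in trigonometric form. -/
theorem abs_basis_eval_cos (m : ℕ) (k : Fin (m + 1)) {θ : ℝ}
    (hθ : Real.cos ((m + 1 : ℕ) * θ) ≠ 0) :
    |(Lagrange.basis Finset.univ (fun i => (chebNode m i : ℝ)) k.rev).eval (Real.cos θ)| =
      |Real.cos ((m + 1 : ℕ) * θ)| * |Real.sin (chebAngle (m + 1) (k : ℕ))| /
        ((m + 1 : ℕ) * |Real.cos θ - Real.cos (chebAngle (m + 1) (k : ℕ))|) := by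
  obtain ⟨c, hc, hT⟩ := exists_T_eq_nodal m
  have hev : ∀ x, (Chebyshev.T ℝ ((m + 1 : ℕ) : ℤ)).eval x =
      c * (Lagrange.nodal Finset.univ fun i => (chebNode m i : ℝ)).eval x := by
    intro x; rw [hT, eval_mul, eval_C]
  have hxne : Real.cos θ ≠ (chebNode m k.rev : ℝ) := by
    intro h
    have h1 := hev (Real.cos θ)
    rw [h, Lagrange.eval_nodal_at_node (v := fun i => (chebNode m i : ℝ)) (Finset.mem_univ k.rev),
      mul_zero, ← h,
      Chebyshev.T_real_cos] at h1
    exact hθ (by exact_mod_cast h1)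
  rw [Lagrange.eval_basis_not_at_node (v := fun i => (chebNode m i : ℝ)) (Finset.mem_univ _) hxne,
    Lagrange.nodalWeight_eq_eval_derivative_nodal (Finset.mem_univ _)]
  set ψ := chebAngle (m + 1) (k : ℕ) with hψ
  have hd : c * (derivative (Lagrange.nodal Finset.univ fun i => (chebNode m i : ℝ))).eval
      (Real.cos ψ) = (m + 1 : ℕ) * (Chebyshev.U ℝ (m : ℤ)).eval (Real.cos ψ) := by
    have := congrArg (fun p => (derivative p).eval (Real.cos ψ)) hT
    simp only [Chebyshev.T_derivative_eq_U, derivative_mul, derivative_C, zero_mul, zero_add,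
      eval_mul, eval_C] at this
    rw [← this]
    simp
  have hU : |(Chebyshev.U ℝ (m : ℤ)).eval (Real.cos ψ)| * |Real.sin ψ| = 1 := by
    rw [← abs_mul, Chebyshev.U_real_cos]
    have := abs_sin_mul_chebAngle (Nat.succ_ne_zero m) (k : ℕ)
    rw [Nat.succ_eq_add_one, ← hψ] at this
    exact_mod_cast this
  have hN := hev (Real.cos θ)
  rw [Chebyshev.T_real_cos] at hN
  rw [chebNode_rev, ← hψ] at hxne ⊢
  have hsin : |Real.sin ψ| ≠ 0 := right_ne_zero_of_mul (by rw [hU]; exact one_ne_zero)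
  have hsub : |Real.cos θ - Real.cos ψ| ≠ 0 := abs_ne_zero.mpr (sub_ne_zero.mpr hxne)
  set n' := (derivative (Lagrange.nodal Finset.univ fun i => (chebNode m i : ℝ))).eval (Real.cos ψ)
  set n0 := (Lagrange.nodal Finset.univ fun i => (chebNode m i : ℝ)).eval (Real.cos θ)
  have hd' : |c| * |n'| * |Real.sin ψ| = (m + 1 : ℕ) := by
    rw [← abs_mul, hd, abs_mul, mul_assoc, hU, mul_one]; exact abs_of_nonneg (by positivity)
  have hcos : |Real.cos ((m + 1 : ℕ) * θ)| = |c| * |n0| := by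
    rw [← abs_mul, ← hN]; push_cast; rfl
  have hm : ((m + 1 : ℕ) : ℝ) ≠ 0 := by positivity
  have hn' : |n'| ≠ 0 := by
    intro h; rw [h, mul_zero, zero_mul] at hd'; exact hm hd'.symm
  rw [abs_mul, abs_mul, abs_inv, abs_inv, hcos, ← hd']
  field_simp

/-- The `2π`-periodic function `|sin (N s) cot (s / 2)|`, which bounds the Lagrange basis
polynomials of the `N` Chebyshev nodes. -/
noncomputable def sinCot (N : ℕ) (s : ℝ) : ℝ :=
  |Real.sin (N * s)| * |Real.cos (s / 2) / Real.sin (s / 2)|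

theorem sinCot_neg (N : ℕ) (s : ℝ) : sinCot N (-s) = sinCot N s := by
  simp [sinCot, neg_div, abs_div]

theorem sinCot_sub_two_pi (N : ℕ) (s : ℝ) : sinCot N (s - 2 * Real.pi) = sinCot N s := by
  have h1 : Real.sin (N * (s - 2 * Real.pi)) = Real.sin (N * s) := by
    rw [mul_sub]; exact Real.sin_sub_nat_mul_two_pi _ N
  have h2 : (s - 2 * Real.pi) / 2 = s / 2 - Real.pi := by ring
  rw [sinCot, sinCot, h1, h2, Real.cos_sub_pi, Real.sin_sub_pi, neg_div_neg_eq]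

theorem sinCot_le {N : ℕ} {s : ℝ} (hs : s ≠ 0) (hs' : |s| ≤ Real.pi) :
    sinCot N s ≤ |Real.sin (N * s)| * (2 / |s|) := by
  rw [sinCot]
  refine mul_le_mul_of_nonneg_left ?_ (abs_nonneg _)
  -- by symmetry the argument may be taken in `(0, π]`
  wlog h : 0 < s generalizing s
  · have := this (s := -s) (neg_ne_zero.mpr hs) (by rwa [abs_neg])
      (by rcases lt_or_gt_of_ne hs with h' | h' <;> [linarith; exact absurd h' h])
    simpa [neg_div, abs_div] using this
  rw [abs_of_pos h] at hs' ⊢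
  have hsin : 0 < Real.sin (s / 2) :=
    Real.sin_pos_of_pos_of_lt_pi (by linarith) (by linarith [Real.pi_pos])
  have hcos : 0 ≤ Real.cos (s / 2) := Real.cos_nonneg_of_mem_Icc ⟨by linarith, by linarith⟩
  rw [abs_of_nonneg (div_nonneg hcos hsin.le), div_le_div_iff₀ hsin h]
  rcases hs'.lt_or_eq with h' | h'
  · have := Real.le_tan (x := s / 2) (by linarith) (by linarith)
    have hc : 0 < Real.cos (s / 2) := Real.cos_pos_of_mem_Ioo ⟨by linarith, by linarith⟩
    rw [Real.tan_eq_sin_div_cos, le_div_iff₀ hc] at this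
    linarith
  · rw [h', Real.cos_pi_div_two, Real.sin_pi_div_two]; norm_num

/-- With `cot` at half the difference and half the sum of the angles, the denominator
`cos θ - cos ψ` splits into two poles. -/
theorem abs_basis_eval_cos_le (m : ℕ) (k : Fin (m + 1)) {θ : ℝ}
    (hθ : Real.cos ((m + 1 : ℕ) * θ) ≠ 0) :
    |(Lagrange.basis Finset.univ (fun i => (chebNode m i : ℝ)) k.rev).eval (Real.cos θ)| ≤
      (sinCot (m + 1) (θ - chebAngle (m + 1) (k : ℕ)) +
        sinCot (m + 1) (θ + chebAngle (m + 1) (k : ℕ))) / (2 * (m + 1 : ℕ)) := by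
  rw [abs_basis_eval_cos m k hθ]
  have hs1 := abs_sin_mul_sub_chebAngle (Nat.succ_ne_zero m) (k : ℕ) θ
  have hs2 : |Real.sin ((m + 1 : ℕ) * (θ + chebAngle (m + 1) (k : ℕ)))| =
      |Real.cos ((m + 1 : ℕ) * θ)| := by
    rw [mul_add, Real.sin_add, cos_mul_chebAngle (Nat.succ_ne_zero m), mul_zero, zero_add, abs_mul,
      abs_sin_mul_chebAngle (Nat.succ_ne_zero m), mul_one]
  set ψ := chebAngle (m + 1) (k : ℕ)
  have hpos : ∀ u : ℝ, |Real.sin ((m + 1 : ℕ) * u)| = |Real.cos ((m + 1 : ℕ) * θ)| →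
      Real.sin (u / 2) ≠ 0 := by
    intro u hu h0
    obtain ⟨n, hn⟩ := Real.sin_eq_zero_iff.mp h0
    have : Real.sin ((m + 1 : ℕ) * u) = 0 := by
      rw [Real.sin_eq_zero_iff]
      exact ⟨2 * (m + 1) * n, by push_cast; linear_combination 2 * ((m : ℝ) + 1) * hn⟩
    rw [this, abs_zero] at hu
    exact hθ (abs_eq_zero.mp hu.symm)
  have h1 := hpos _ hs1
  have h2 := hpos _ hs2
  rw [sinCot, sinCot, hs1, hs2, ← mul_add]
  set u := (θ - ψ) / 2 with hu
  set w := (θ + ψ) / 2 with hw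
  have hθ' : θ = w + u := by rw [hu, hw]; ring
  have hψ' : ψ = w - u := by rw [hu, hw]; ring
  have e1 : Real.cos θ - Real.cos ψ = -2 * Real.sin w * Real.sin u := by
    rw [hθ', hψ', Real.cos_add, Real.cos_sub]; ring
  have e2 : Real.sin ψ = Real.sin w * Real.cos u - Real.cos w * Real.sin u := by
    rw [hψ', Real.sin_sub]
  -- `sin ψ / (cos ψ - cos θ) = (cot u - cot w) / 2`
  have e3 : |Real.sin ψ| / |Real.cos θ - Real.cos ψ| ≤
      (|Real.cos u / Real.sin u| + |Real.cos w / Real.sin w|) / 2 := by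
    have : Real.sin ψ / (Real.cos θ - Real.cos ψ) =
        -((Real.cos u / Real.sin u) - (Real.cos w / Real.sin w)) / 2 := by
      rw [e1, e2]; field_simp
    rw [← abs_div, this, abs_div, abs_neg, abs_two]
    gcongr
    exact abs_sub _ _
  calc _ = |Real.cos ((m + 1 : ℕ) * θ)| * (|Real.sin ψ| / |Real.cos θ - Real.cos ψ|) /
        (m + 1 : ℕ) := by rw [mul_div_assoc, mul_div_assoc, div_div, mul_comm (|_ - _|)]
    _ ≤ |Real.cos ((m + 1 : ℕ) * θ)| *
        ((|Real.cos u / Real.sin u| + |Real.cos w / Real.sin w|) / 2) / (m + 1 : ℕ) := by gcongr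
    _ = _ := by field_simp

theorem sum_range_periodic {M : ℕ} {F : ℤ → ℝ} (hF : ∀ j, F (j + M) = F j) (a b : ℤ) :
    ∑ r ∈ Finset.range M, F (a + r) = ∑ r ∈ Finset.range M, F (b + r) := by
  have step : ∀ a : ℤ, ∑ r ∈ Finset.range M, F (a + 1 + r) = ∑ r ∈ Finset.range M, F (a + r) := by
    intro a
    have h1 := Finset.sum_range_succ (fun r : ℕ => F (a + r)) M
    have h2 := Finset.sum_range_succ' (fun r : ℕ => F (a + r)) M
    rw [h1, hF] at h2
    simp only [Nat.cast_zero, add_zero] at h2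
    refine Eq.trans ?_ (add_right_cancel h2).symm
    refine Finset.sum_congr rfl fun r _ => ?_
    push_cast; congr 1; ring
  have key : ∀ a : ℤ, ∑ r ∈ Finset.range M, F (a + r) = ∑ r ∈ Finset.range M, F (0 + r) := by
    intro a
    induction a using Int.induction_on with
    | zero => rfl
    | succ i ih => rw [step, ih]
    | pred i ih => rw [← ih, ← step (-i - 1)]; simp
  rw [key a, key b]

/-- One side of the pole: the point nearest to it gives the first term, the others a harmonic
sum. -/
theorem sum_sinCot_le {N : ℕ} (hN : N ≠ 0) {s : ℝ} (hs : 0 < s) (hs' : s < Real.pi / N) :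
    ∑ q ∈ Finset.range N, sinCot N (s + q * (Real.pi / N)) ≤
      2 * N * (|Real.sin (N * s)| / (N * s)) + 2 * N / Real.pi * harmonic (N - 1) := by
  have hN' : (0 : ℝ) < N := by positivity
  have hpi := Real.pi_pos
  have hterm : ∀ q : ℕ, q < N → sinCot N (s + q * (Real.pi / N)) ≤
      |Real.sin (N * s)| * (2 / (s + q * (Real.pi / N))) := by
    intro q hq
    have hq' : (q : ℝ) + 1 ≤ N := by exact_mod_cast hq
    have h0 : 0 < s + q * (Real.pi / N) := by positivity
    have h1 : s + q * (Real.pi / N) ≤ Real.pi := by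
      have : ((q : ℝ) + 1) * (Real.pi / N) ≤ N * (Real.pi / N) := by gcongr
      rw [mul_div_cancel₀ _ hN'.ne'] at this
      linarith
    have h2 := sinCot_le (N := N) h0.ne' (by rwa [abs_of_pos h0])
    rw [abs_of_pos h0] at h2
    have h3 : (N : ℝ) * (s + q * (Real.pi / N)) = N * s + q * Real.pi := by field_simp
    rwa [h3, Real.sin_add_nat_mul_pi, abs_mul, abs_pow, abs_neg, abs_one, one_pow, one_mul] at h2
  refine (Finset.sum_le_sum fun q hq => hterm q (Finset.mem_range.mp hq)).trans ?_
  obtain ⟨M, rfl⟩ := Nat.exists_eq_succ_of_ne_zero hN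
  rw [Finset.sum_range_succ', add_comm, Nat.succ_eq_add_one, Nat.add_sub_cancel]
  refine add_le_add ?_ ?_
  · apply le_of_eq
    rw [Nat.succ_eq_add_one] at hN'
    rw [Nat.cast_zero, zero_mul, add_zero]
    field_simp
  · simp only [harmonic, Rat.cast_sum, Finset.mul_sum]
    refine Finset.sum_le_sum fun q _ => ?_
    calc |Real.sin ((M + 1 : ℕ) * s)| * (2 / (s + (q + 1 : ℕ) * (Real.pi / (M + 1 : ℕ))))
        ≤ 1 * (2 / ((q + 1 : ℕ) * (Real.pi / (M + 1 : ℕ)))) := by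
          gcongr
          · exact Real.abs_sin_le_one _
          · linarith
      _ = _ := by
          push_cast
          field_simp

/-- The joint contribution of the two points next to the pole, which lie at distances `x / N` and
`(π - x) / N` from it. -/
theorem abs_sin_div_add_le {x : ℝ} (hx : 0 < x) (hx' : x < Real.pi) :
    |Real.sin x| / x + |Real.sin x| / (Real.pi - x) ≤ 1 + 2 / Real.pi := by
  have hpi := Real.pi_pos
  wlog h : x ≤ Real.pi / 2 generalizing x
  · have := this (x := Real.pi - x) (by linarith) (by linarith) (by linarith)
    rw [Real.sin_pi_sub, sub_sub_cancel] at this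
    linarith
  have h1 : |Real.sin x| / x ≤ 1 := by
    rw [div_le_one hx]; simpa [abs_of_pos hx] using Real.abs_sin_le_abs (x := x)
  have h2 : |Real.sin x| / (Real.pi - x) ≤ 1 / (Real.pi / 2) := by
    gcongr
    · exact Real.abs_sin_le_one x
    · linarith
  rw [one_div_div] at h2
  linarith

/-- A bound for the Lebesgue function of the `m + 1` Chebyshev nodes. In the angular variable the
Lagrange basis polynomials are controlled by values of `|cot|` at `2 (m + 1)` equidistant points;
the two points next to the singularity contribute `1 + 2 / π`, the others two harmonic sums. -/
theorem sum_abs_basis_eval_le (m : ℕ) {x : ℝ} (hx : x ∈ Set.Icc (-1 : ℝ) 1) :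
    ∑ k : Fin (m + 1), |(Lagrange.basis Finset.univ (fun i => (chebNode m i : ℝ)) k).eval x| ≤
      1 + 2 / Real.pi + 2 / Real.pi * harmonic m := by
  classical
  have hharm : (0 : ℝ) ≤ harmonic m := by
    simp only [harmonic, Rat.cast_sum]
    exact Finset.sum_nonneg fun _ _ => by positivity
  have hpi := Real.pi_pos
  set N := m + 1 with hNdef
  have hN : N ≠ 0 := Nat.succ_ne_zero m
  have hN' : (0 : ℝ) < N := by positivity
  set θ := Real.arccos x with hθ
  have hxθ : x = Real.cos θ := (Real.cos_arccos hx.1 hx.2).symm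
  by_cases hcos : Real.cos (N * θ) = 0
  · -- `x` is a node, where the Lebesgue function is `1`
    obtain ⟨c, hc, hT⟩ := exists_T_eq_nodal m
    have h1 := congrArg (fun p => p.eval (Real.cos θ)) hT
    simp only [Chebyshev.T_real_cos, eval_mul, eval_C] at h1
    have h2 : (Lagrange.nodal Finset.univ fun i => (chebNode m i : ℝ)).eval (Real.cos θ) = 0 := by
      have h3 : Real.cos (((m + 1 : ℕ) : ℤ) * θ) = 0 := by exact_mod_cast hcos
      rw [h3] at h1
      exact (mul_eq_zero.mp h1.symm).resolve_left hc
    rw [Lagrange.eval_nodal, Finset.prod_eq_zero_iff] at h2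
    obtain ⟨i, -, hi⟩ := h2
    have hxi : x = (fun i => (chebNode m i : ℝ)) i := by rw [hxθ]; exact sub_eq_zero.mp hi
    rw [Finset.sum_eq_single i]
    · rw [hxi, Lagrange.eval_basis_self (chebNode_injective m).injOn (Finset.mem_univ _), abs_one]
      have : 0 ≤ 2 / Real.pi := by positivity
      nlinarith
    · intro k _ hk
      rw [hxi, Lagrange.eval_basis_of_ne (v := fun i => (chebNode m i : ℝ)) hk (Finset.mem_univ _),
        abs_zero]
    · simp
  -- the nodes `k` and their mirror images `-1 - k` make up all `2N` angles modulo `2π`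
  set F : ℤ → ℝ := fun j => sinCot N (θ - chebAngle N j) with hF
  have hper : ∀ j, F (j + (2 * N : ℕ)) = F j := by
    intro j
    rw [hF]
    have : θ - chebAngle N (j + (2 * N : ℕ)) = θ - chebAngle N j - 2 * Real.pi := by
      unfold chebAngle; push_cast; field_simp; ring
    simp only [this, sinCot_sub_two_pi]
  set d := Real.pi / N with hd
  have hdpos : 0 < d := by positivity
  -- `θ` lies between the angles of index `i` and `i + 1`
  set i : ℤ := ⌊(θ - chebAngle N 0) / d⌋ with hi
  set s := θ - chebAngle N i with hs
  have hang : ∀ j : ℤ, chebAngle N j = chebAngle N 0 + j * d := by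
    intro j; rw [hd]; unfold chebAngle; push_cast; field_simp; ring
  have hs0 : 0 ≤ s := by
    have := Int.floor_le ((θ - chebAngle N 0) / d)
    rw [← hi, le_div_iff₀ hdpos] at this
    rw [hs, hang]; linarith
  have hs1 : s < d := by
    have := Int.lt_floor_add_one ((θ - chebAngle N 0) / d)
    rw [← hi, div_lt_iff₀ hdpos] at this
    rw [hs, hang]; linarith
  have hsin : |Real.sin (N * s)| = |Real.cos (N * θ)| := abs_sin_mul_sub_chebAngle hN i θ
  have hs0' : 0 < s := by
    refine hs0.lt_of_ne' fun h => hcos ?_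
    rw [h] at hsin; simpa using hsin.symm
  have hstep1 : ∑ k : Fin (m + 1),
      |(Lagrange.basis Finset.univ (fun i => (chebNode m i : ℝ)) k).eval x| ≤
      (∑ r ∈ Finset.range (2 * N), F (-N + r)) / (2 * N) := by
    rw [← Equiv.sum_comp Fin.revPerm, two_mul N, Finset.sum_range_add]
    have e1 : ∑ r ∈ Finset.range N, F (-N + r) = ∑ k : Fin (m + 1), F (-1 - (k : ℕ)) := by
      rw [Fin.sum_univ_eq_sum_range (fun k => F (-1 - (k : ℕ))) (m + 1), ← hNdef,
        ← Finset.sum_range_reflect]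
      refine Finset.sum_congr rfl fun r hr => ?_
      have := Finset.mem_range.mp hr
      congr 1; omega
    have e2 : ∑ r ∈ Finset.range N, F (-N + (N + r : ℕ)) = ∑ k : Fin (m + 1), F (k : ℕ) := by
      rw [Fin.sum_univ_eq_sum_range (fun k => F (k : ℕ)) (m + 1)]
      refine Finset.sum_congr rfl fun r _ => ?_
      congr 1; push_cast; ring
    rw [e1, e2, ← Finset.sum_add_distrib, Finset.sum_div]
    refine Finset.sum_le_sum fun k _ => ?_
    have h := abs_basis_eval_cos_le m k hcos
    have h3 : θ + chebAngle (m + 1) (k : ℕ) = θ - chebAngle (m + 1) (-1 - (k : ℕ)) := by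
      unfold chebAngle; push_cast; field_simp; ring
    rw [h3, add_comm (sinCot _ _)] at h
    rw [hxθ]
    exact h
  have hstep2 : ∑ r ∈ Finset.range (2 * N), F (-N + r) =
      ∑ q ∈ Finset.range N, sinCot N (s + q * d) +
        ∑ q ∈ Finset.range N, sinCot N (d - s + q * d) := by
    rw [sum_range_periodic hper (-N) (i - N + 1), two_mul N, Finset.sum_range_add]
    congr 1
    · rw [← Finset.sum_range_reflect]
      refine Finset.sum_congr rfl fun r hr => ?_
      have := Finset.mem_range.mp hr
      have e : i - N + 1 + (N - 1 - r : ℕ) = i - r := by omega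
      rw [e, hF]
      simp only
      congr 1
      rw [hs, hang, hang i]; push_cast; ring
    · refine Finset.sum_congr rfl fun r hr => ?_
      have e : i - N + 1 + (N + r : ℕ) = i + 1 + r := by push_cast; ring
      rw [e, hF, ← sinCot_neg]
      simp only
      congr 1
      rw [hs, hang, hang i]; push_cast; ring
  have hA := sum_sinCot_le hN hs0' hs1
  have hB := sum_sinCot_le hN (s := d - s) (by linarith) (by linarith)
  have hNd : (N : ℝ) * d = Real.pi := by rw [hd]; field_simp
  have hC := abs_sin_div_add_le (x := N * s) (by positivity) (by nlinarith)
  have e : (N : ℝ) * (d - s) = Real.pi - N * s := by rw [mul_sub, hNd]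
  rw [e, Real.sin_pi_sub] at hB
  have hN1 : N - 1 = m := by omega
  rw [hN1] at hA hB
  refine hstep1.trans ?_
  rw [hstep2, div_le_iff₀ (by positivity)]
  have hfin : (1 + 2 / Real.pi + 2 / Real.pi * harmonic m) * (2 * N) =
    2 * N * (1 + 2 / Real.pi) + (2 * N / Real.pi * harmonic m + 2 * N / Real.pi * harmonic m) := by
    field_simp; ring
  rw [hfin]
  have hC' := mul_le_mul_of_nonneg_left hC (by positivity : (0 : ℝ) ≤ 2 * N)
  rw [mul_add] at hC'
  linarith

/-- For even `m ≥ 2` the Lebesgue constant of the `m + 1` Chebyshev nodes is at most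
`(3 / 2) log (2m + 3)`. The factor `3 / 2` is what the bound
`sum_abs_eval_chebIncr_le` can afford. -/
theorem sum_abs_basis_eval_le_log {m : ℕ} (hm : Even m) (hm2 : 2 ≤ m) {x : ℝ}
    (hx : x ∈ Set.Icc (-1 : ℝ) 1) :
    ∑ k : Fin (m + 1), |(Lagrange.basis Finset.univ (fun i => (chebNode m i : ℝ)) k).eval x| ≤
      3 / 2 * Real.log (2 * m + 3) := by
  refine (sum_abs_basis_eval_le m hx).trans ?_
  have hexp9 : Real.exp 9 ≤ 9000 := by
    have h : Real.exp 9 = Real.exp 1 ^ 9 := by rw [← Real.exp_nat_mul]; norm_num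
    rw [h]
    calc Real.exp 1 ^ 9 ≤ 2.7182818286 ^ 9 := by
          gcongr; exact Real.exp_one_lt_d9.le
      _ ≤ 9000 := by norm_num
  have hpi : 2 / Real.pi ≤ 2 / 3 := by
    gcongr; exact Real.pi_gt_three.le
  obtain rfl | hm4 : m = 2 ∨ 4 ≤ m := by
    obtain ⟨r, rfl⟩ := hm; omega
  · have h7 : (9 : ℝ) ≤ 5 * Real.log 7 := by
      have : (5 : ℝ) * Real.log 7 = Real.log (7 ^ 5) := by rw [Real.log_pow]; norm_num
      rw [this, Real.le_log_iff_exp_le (by norm_num)]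
      exact hexp9.trans (by norm_num)
    have hh : ((harmonic 2 : ℚ) : ℝ) = 3 / 2 := by norm_num [harmonic, Finset.sum_range_succ]
    have h3 : (2 : ℝ) * (2 : ℕ) + 3 = 7 := by norm_num
    rw [hh, h3]
    linarith
  · have h11 : (9 : ℝ) ≤ 4 * Real.log 11 := by
      have : (4 : ℝ) * Real.log 11 = Real.log (11 ^ 4) := by rw [Real.log_pow]; norm_num
      rw [this, Real.le_log_iff_exp_le (by norm_num)]
      exact hexp9.trans (by norm_num)
    have hm4' : (4 : ℝ) ≤ m := by exact_mod_cast hm4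
    have hL : Real.log 11 ≤ Real.log (2 * m + 3) := Real.log_le_log (by norm_num) (by linarith)
    have hlogm : Real.log m ≤ Real.log (2 * m + 3) - Real.log 2 := by
      rw [← Real.log_div (by positivity) (by norm_num)]
      exact Real.log_le_log (by linarith) (by linarith)
    have hharm := harmonic_le_one_add_log m
    have hlog2 := Real.log_two_gt_d9
    have hlogm0 : 0 ≤ Real.log m := Real.log_nonneg (by linarith)
    have h1 : 2 / Real.pi * (harmonic m : ℝ) ≤ 2 / 3 * (1 + Real.log m) := by
      have h0 : 0 ≤ 2 / Real.pi := by positivity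
      nlinarith
    linarith

/-! ### Univariate interpolation of polynomials -/

/-- The polynomial of degree at most `m` that interpolates `p` at the `m + 1` Chebyshev nodes. -/
noncomputable def chebInterp (m : ℕ) (p : ℝ[X]) : ℝ[X] :=
  Lagrange.interpolate Finset.univ (fun i : Fin (m + 1) => (chebNode m i : ℝ))
    fun i => p.eval (chebNode m i : ℝ)

/-- The increment `I_m - I_{m-2}` of the univariate interpolation, with `I_{-2} = 0`. -/
noncomputable def chebIncr (m : ℕ) (p : ℝ[X]) : ℝ[X] :=
  chebInterp m p - if m = 0 then 0 else chebInterp (m - 2) p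

theorem eval_chebInterp (m : ℕ) (p : ℝ[X]) (x : ℝ) :
    (chebInterp m p).eval x = ∑ k : Fin (m + 1),
      (Lagrange.basis Finset.univ (fun i => (chebNode m i : ℝ)) k).eval x *
        p.eval (chebNode m k : ℝ) := by
  rw [chebInterp, Lagrange.interpolate_apply, eval_finsetSum]
  exact Finset.sum_congr rfl fun k _ => by rw [eval_mul, eval_C, mul_comm]

theorem natDegree_chebInterp_le (m : ℕ) (p : ℝ[X]) : (chebInterp m p).natDegree ≤ m := by
  have := Lagrange.degree_interpolate_lt (s := Finset.univ)
    (fun i : Fin (m + 1) => p.eval (chebNode m i : ℝ)) (chebNode_injective m).injOn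
  rw [Finset.card_univ, Fintype.card_fin] at this
  refine natDegree_le_iff_coeff_eq_zero.mpr fun N hN => coeff_eq_zero_of_degree_lt ?_
  exact lt_of_lt_of_le this (by exact_mod_cast hN)

theorem chebInterp_eq_self {m : ℕ} {p : ℝ[X]} (hp : p.natDegree ≤ m) : chebInterp m p = p := by
  refine (Lagrange.eq_interpolate (v := fun i : Fin (m + 1) => (chebNode m i : ℝ))
    (chebNode_injective m).injOn ?_).symm
  rw [Finset.card_univ, Fintype.card_fin]
  refine lt_of_le_of_lt degree_le_natDegree ?_
  exact_mod_cast Nat.lt_succ_iff.mpr hp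

theorem chebIncr_eq_zero {m : ℕ} {p : ℝ[X]} (hm : m ≠ 0) (hp : p.natDegree ≤ m - 2) :
    chebIncr m p = 0 := by
  rw [chebIncr, if_neg hm, chebInterp_eq_self hp, chebInterp_eq_self (hp.trans (by omega)),
    sub_self]

theorem chebIncr_zero_one : chebIncr 0 1 = 1 := by
  rw [chebIncr, if_pos rfl, sub_zero, chebInterp_eq_self (by simp)]

theorem sum_chebIncr (k : ℕ) (p : ℝ[X]) :
    ∑ i ∈ Finset.range (k + 1), chebIncr (2 * i) p = chebInterp (2 * k) p := by
  induction k with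
  | zero => simp [chebIncr]
  | succ k ih =>
    rw [Finset.sum_range_succ, ih, chebIncr, if_neg (by omega)]
    have : 2 * (k + 1) - 2 = 2 * k := by omega
    rw [this]; ring

theorem abs_eval_chebInterp_le {m : ℕ} {p : ℝ[X]} {B x : ℝ}
    (hB : ∀ t : II, |p.eval (t : ℝ)| ≤ B) :
    |(chebInterp m p).eval x| ≤ (∑ k : Fin (m + 1),
      |(Lagrange.basis Finset.univ (fun i => (chebNode m i : ℝ)) k).eval x|) * B := by
  rw [eval_chebInterp, Finset.sum_mul]
  refine (Finset.abs_sum_le_sum_abs _ _).trans (Finset.sum_le_sum fun k _ => ?_)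
  rw [abs_mul]
  exact mul_le_mul_of_nonneg_left (hB _) (abs_nonneg _)

theorem abs_eval_chebInterp_le_log {m n : ℕ} (hm : Even m) (hmn : m ≤ n) (hn : 2 ≤ n) {p : ℝ[X]}
    {B x : ℝ} (hx : x ∈ Set.Icc (-1 : ℝ) 1) (hB : ∀ t : II, |p.eval (t : ℝ)| ≤ B) :
    |(chebInterp m p).eval x| ≤ 3 / 2 * Real.log (2 * n + 3) * B := by
  have hB0 : 0 ≤ B := (abs_nonneg _).trans (hB (chebNode 0 0))
  refine (abs_eval_chebInterp_le hB).trans (mul_le_mul_of_nonneg_right ?_ hB0)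
  have hn' : (2 : ℝ) ≤ n := by exact_mod_cast hn
  rcases Nat.eq_zero_or_pos m with rfl | hm0
  · -- a single node: the Lebesgue constant is `1`
    have h1 : Lagrange.basis Finset.univ (fun i => (chebNode 0 i : ℝ)) (0 : Fin 1) = 1 := by
      exact Lagrange.basis_singleton (0 : Fin 1)
    rw [Fin.sum_univ_one, h1, eval_one, abs_one]
    have : 1 ≤ Real.log (2 * n + 3) := by
      rw [Real.le_log_iff_exp_le (by positivity)]
      linarith [Real.exp_one_lt_d9]
    linarith
  · have hm2 : 2 ≤ m := by obtain ⟨r, rfl⟩ := hm; omega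
    refine (sum_abs_basis_eval_le_log hm hm2 hx).trans ?_
    have : (m : ℝ) ≤ n := by exact_mod_cast hmn
    gcongr

/-- All increments of order at most `n` together: the logarithmic growth of the Lebesgue constants
costs the factor `2 (n + 1) log (2n + 3)`. -/
theorem sum_abs_eval_chebIncr_le {n : ℕ} (hn : Even n) (hn2 : 2 ≤ n) {p : ℝ[X]}
    {B x : ℝ} (hx : x ∈ Set.Icc (-1 : ℝ) 1) (hB : ∀ t : II, |p.eval (t : ℝ)| ≤ B) :
    ∑ i ∈ Finset.range (n / 2 + 1), |(chebIncr (2 * i) p).eval x| ≤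
      (n + 1) * (2 * B * Real.log (2 * n + 3)) := by
  have hB0 : 0 ≤ B := (abs_nonneg _).trans (hB (chebNode 0 0))
  have hn' : (2 : ℝ) ≤ n := by exact_mod_cast hn2
  have hlog : 0 ≤ Real.log (2 * n + 3) := Real.log_nonneg (by linarith)
  set L := 3 / 2 * Real.log (2 * n + 3) * B with hL
  have hL0 : 0 ≤ L := by positivity
  have hterm : ∀ i ∈ Finset.range (n / 2 + 1), |(chebIncr (2 * i) p).eval x| ≤ 2 * L := by
    intro i hi
    have hi' := Finset.mem_range.mp hi
    have h1 := abs_eval_chebInterp_le_log (m := 2 * i) (n := n) (by simp) (by omega) hn2 hx hB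
    rw [chebIncr, eval_sub]
    refine (abs_sub _ _).trans ?_
    split_ifs with h
    · simp only [eval_zero, abs_zero]; linarith
    · have h2 := abs_eval_chebInterp_le_log (m := 2 * i - 2) (n := n)
        ⟨i - 1, by omega⟩ (by omega) hn2 hx hB
      linarith
  refine (Finset.sum_le_card_nsmul _ _ _ hterm).trans ?_
  obtain ⟨r, rfl⟩ := hn
  have hr : (r + r) / 2 = r := by omega
  rw [Finset.card_range, nsmul_eq_mul, hr, hL]
  push_cast at hn' ⊢
  have : 0 ≤ Real.log (2 * (r + r) + 3) * B := by
    push_cast at hlog; positivity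
  nlinarith

theorem chebNode_rev_neg (m : ℕ) (k : Fin (m + 1)) :
    (chebNode m k.rev : ℝ) = -(chebNode m k : ℝ) := by
  rw [chebNode_rev, chebNode, neg_neg, chebAngle]
  push_cast; rfl

theorem chebInterp_comp_neg_X (m : ℕ) {p : ℝ[X]} (hp : p.comp (-X) = p) :
    (chebInterp m p).comp (-X) = chebInterp m p := by
  have hpe : ∀ x, p.eval (-x) = p.eval x := fun x => by
    conv_rhs => rw [← hp]
    simp
  refine Lagrange.eq_interpolate_of_eval_eq (v := fun i : Fin (m + 1) => (chebNode m i : ℝ))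
    _ (chebNode_injective m).injOn ?_ ?_
  · rw [Finset.card_univ, Fintype.card_fin, degree_comp_neg_X]
    refine lt_of_le_of_lt degree_le_natDegree ?_
    exact_mod_cast Nat.lt_succ_iff.mpr (natDegree_chebInterp_le m p)
  · intro i _
    have := Lagrange.eval_interpolate_at_node (s := Finset.univ)
      (v := fun i : Fin (m + 1) => (chebNode m i : ℝ))
      (fun i => p.eval (chebNode m i : ℝ)) (chebNode_injective m).injOn (Finset.mem_univ i.rev)
    simp only [chebNode_rev_neg, hpe] at this
    rw [eval_comp, eval_neg, eval_X]
    exact this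

theorem chebIncr_comp_neg_X (m : ℕ) {p : ℝ[X]} (hp : p.comp (-X) = p) :
    (chebIncr m p).comp (-X) = chebIncr m p := by
  rw [chebIncr, sub_comp, chebInterp_comp_neg_X m hp]
  split_ifs
  · simp
  · rw [chebInterp_comp_neg_X _ hp]

theorem natDegree_chebIncr_le (m : ℕ) (p : ℝ[X]) : (chebIncr m p).natDegree ≤ m := by
  refine (natDegree_sub_le _ _).trans (max_le (natDegree_chebInterp_le m p) ?_)
  split_ifs
  · simp
  · exact (natDegree_chebInterp_le _ p).trans (by omega)

/-! ### Jacobi polynomials -/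

theorem monicOrtho_monic_natDegree (μ : Measure II) (n : ℕ) :
    (monicOrtho μ n).Monic ∧ (monicOrtho μ n).natDegree = n := by
  induction n using Nat.strong_induction_on with
  | _ n ih =>
    have hdeg : (∑ i : Fin n,
        C ((∫ t : II, (t : ℝ) ^ n * (monicOrtho μ i).eval (t : ℝ) ∂μ) /
          ∫ t : II, ((monicOrtho μ i).eval (t : ℝ)) ^ 2 ∂μ) * monicOrtho μ i).degree <
        (X ^ n : ℝ[X]).degree := by
      rw [degree_X_pow]
      refine (degree_sum_le _ _).trans_lt ?_
      refine (Finset.sup_lt_iff (WithBot.bot_lt_coe n)).mpr ?_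
      intro i _
      refine degree_le_natDegree.trans_lt ?_
      have h := natDegree_C_mul_le ((∫ t : II, (t : ℝ) ^ n * (monicOrtho μ i).eval (t : ℝ) ∂μ) /
        ∫ t : II, ((monicOrtho μ i).eval (t : ℝ)) ^ 2 ∂μ) (monicOrtho μ i)
      rw [(ih i i.2).2] at h
      exact WithBot.coe_lt_coe.mpr (h.trans_lt i.2)
    rw [monicOrtho]
    rw [degree_X_pow] at hdeg
    refine ⟨monic_X_pow_sub hdeg, natDegree_eq_of_degree_eq_some ?_⟩
    rw [degree_sub_eq_left_of_degree_lt (by rwa [degree_X_pow]), degree_X_pow]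

theorem monicOrtho_zero (μ : Measure II) : monicOrtho μ 0 = 1 := by
  rw [monicOrtho]; simp

theorem jacobi_zero {a b : ℝ} (ha : -1 < a) (hb : -1 < b) : jacobi a b 0 = 1 := by
  have := isProbabilityMeasure_jacobiMeasure ha hb
  simp [jacobi, monicOrtho_zero]

theorem natDegree_jacobi_le (a b : ℝ) (n : ℕ) : (jacobi a b n).natDegree ≤ n := by
  rw [jacobi]
  exact (natDegree_C_mul_le _ _).trans (monicOrtho_monic_natDegree _ n).2.le

theorem integrable_eval_jacobiMeasure {a b : ℝ} (ha : -1 < a) (hb : -1 < b) (p : ℝ[X]) :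
    Integrable (fun t : II => p.eval (t : ℝ)) (jacobiMeasure a b) := by
  have := isProbabilityMeasure_jacobiMeasure ha hb
  have hc : Continuous fun t : II => p.eval (t : ℝ) := by fun_prop
  exact hc.integrable_of_hasCompactSupport (HasCompactSupport.of_compactSpace _)

theorem natDegree_jacobi {a b : ℝ} (ha : -1 < a) (hb : -1 < b) (n : ℕ) :
    (jacobi a b n).natDegree = n := by
  have hprob := isProbabilityMeasure_jacobiMeasure ha hb
  obtain ⟨hmon, hdeg⟩ := monicOrtho_monic_natDegree (jacobiMeasure a b) n
  set p := monicOrtho (jacobiMeasure a b) n with hp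
  -- the measure has no atoms, so the finitely many zeros of `p` form a null set
  have hac : jacobiMeasure a b ≪ Measure.comap (Subtype.val : II → ℝ) volume :=
    withDensity_absolutelyContinuous _ _
  have hnull : jacobiMeasure a b {t : II | p.eval (t : ℝ) = 0} = 0 := by
    apply hac
    rw [comap_subtype_coe_apply measurableSet_Icc]
    refine measure_mono_null ?_ ((p.roots.toFinset.finite_toSet).measure_zero volume)
    rintro _ ⟨t, ht, rfl⟩
    simpa [hmon.ne_zero] using ht
  have hint : Integrable (fun t : II => (p.eval (t : ℝ)) ^ 2) (jacobiMeasure a b) := by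
    have := integrable_eval_jacobiMeasure ha hb (p ^ 2)
    simpa only [eval_pow] using this
  have hpos : 0 < ∫ t : II, (p.eval (t : ℝ)) ^ 2 ∂(jacobiMeasure a b) := by
    rw [integral_pos_iff_support_of_nonneg (fun t => sq_nonneg _) hint]
    have : Function.support (fun t : II => (p.eval (t : ℝ)) ^ 2) =
        {t : II | p.eval (t : ℝ) = 0}ᶜ := by
      ext t; simp
    rw [this]
    have h1 := measure_union_le (μ := jacobiMeasure a b) {t : II | p.eval (t : ℝ) = 0}
      {t : II | p.eval (t : ℝ) = 0}ᶜ
    rw [Set.union_compl_self, measure_univ, hnull, zero_add] at h1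
    exact lt_of_lt_of_le one_pos h1
  rw [jacobi, natDegree_C_mul (inv_ne_zero (Real.sqrt_pos.mpr hpos).ne'), hdeg]

theorem integral_jacobiMeasure (a b : ℝ) (g : ℝ → ℝ) :
    ∫ t : II, g t ∂(jacobiMeasure a b) =
      ∫ x in (-1 : ℝ)..1, (ENNReal.ofReal (jacobiDensity a b x)).toReal * g x := by
  have hmeas : Measurable fun y : II => ENNReal.ofReal (jacobiDensity a b y) := by
    unfold jacobiDensity; fun_prop
  rw [jacobiMeasure, integral_withDensity_eq_integral_toReal_smul hmeas (by simp),
    integral_subtype_comap measurableSet_Icc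
      (fun x : ℝ => (ENNReal.ofReal (jacobiDensity a b x)).toReal • g x),
    integral_Icc_eq_integral_Ioc, intervalIntegral.integral_of_le (by norm_num)]
  rfl

theorem integral_jacobiMeasure_neg (a : ℝ) (g : ℝ → ℝ) :
    ∫ t : II, g (-t) ∂(jacobiMeasure a a) = ∫ t : II, g t ∂(jacobiMeasure a a) := by
  rw [integral_jacobiMeasure a a (fun x => g (-x)), integral_jacobiMeasure a a g]
  have hd : ∀ x, jacobiDensity a a x = jacobiDensity a a (-x) := fun x => by
    rw [jacobiDensity, jacobiDensity, sub_neg_eq_add, ← sub_eq_add_neg]; ring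
  have := intervalIntegral.integral_comp_neg (a := -1) (b := 1)
    (fun x => (ENNReal.ofReal (jacobiDensity a a x)).toReal * g x)
  rw [neg_neg] at this
  rw [← this]
  refine intervalIntegral.integral_congr fun x _ => ?_
  simp only [hd x]

/-- For a symmetric measure the orthogonal polynomials have the parity of their degree. -/
theorem monicOrtho_comp_neg_X {μ : Measure II}
    (hμ : ∀ g : ℝ → ℝ, ∫ t : II, g (-t) ∂μ = ∫ t : II, g t ∂μ) (n : ℕ) :
    (monicOrtho μ n).comp (-X) = (-1) ^ n * monicOrtho μ n := by
  induction n using Nat.strong_induction_on with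
  | _ n ih =>
    rw [monicOrtho, sub_comp, mul_sub, Polynomial.sum_comp, Finset.mul_sum]
    congr 1
    · rw [X_pow_comp, neg_pow]
    refine Finset.sum_congr rfl fun i _ => ?_
    rw [mul_comp, C_comp, ih i i.2]
    rcases neg_one_pow_eq_or ℝ (n + i : ℕ) with h | h
    · -- equal parities
      have hpar : (-1 : ℝ[X]) ^ n = (-1) ^ (i : ℕ) := by
        have h' : Even (n + i : ℕ) := by
          by_contra ho
          rw [Nat.not_even_iff_odd] at ho
          rw [ho.neg_one_pow] at h; norm_num at h
        rcases Nat.even_add.mp h' with h2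
        rcases Nat.even_or_odd n with hn | hn
        · rw [hn.neg_one_pow, (h2.mp hn).neg_one_pow]
        · rw [hn.neg_one_pow, Odd.neg_one_pow]
          rw [← Nat.not_even_iff_odd] at hn ⊢
          exact fun hi => hn (h2.mpr hi)
      rw [hpar]; ring
    · -- opposite parities: the coefficient is the integral of an odd function
      have hint : ∫ t : II, (t : ℝ) ^ n * (monicOrtho μ i).eval (t : ℝ) ∂μ = 0 := by
        have h1 := hμ fun x => x ^ n * (monicOrtho μ i).eval x
        have h2 : ∀ x : ℝ,
            (monicOrtho μ i).eval (-x) = (-1) ^ (i : ℕ) * (monicOrtho μ i).eval x := by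
          intro x
          have := congrArg (fun p => p.eval x) (ih i i.2)
          simpa using this
        have h3 : ∀ x : ℝ, (-x) ^ n * (monicOrtho μ i).eval (-x) =
            -(x ^ n * (monicOrtho μ i).eval x) := by
          intro x
          rw [pow_add] at h
          rw [h2, neg_pow]
          linear_combination x ^ n * (monicOrtho μ i).eval x * h
        simp only [h3] at h1
        rw [integral_neg] at h1
        linarith
      rw [hint]; simp

theorem jacobi_comp_neg_X (a : ℝ) {n : ℕ} (hn : Even n) :
    (jacobi a a n).comp (-X) = jacobi a a n := by
  rw [jacobi, mul_comp, C_comp, monicOrtho_comp_neg_X (integral_jacobiMeasure_neg a),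
    hn.neg_one_pow, one_mul]

/-- In the symmetric case the Jacobi polynomials of even order `≤ 2k` span the even polynomials of
degree at most `2k`. -/
theorem exists_eq_sum_jacobi {a : ℝ} (ha : -1 < a) (k : ℕ) {p : ℝ[X]} (hp : p.natDegree ≤ 2 * k)
    (heven : p.comp (-X) = p) :
    ∃ c : ℕ → ℝ, p = ∑ i ∈ Finset.range (k + 1), C (c (2 * i)) * jacobi a a (2 * i) := by
  induction k generalizing p with
  | zero =>
    refine ⟨fun _ => p.coeff 0, ?_⟩
    rw [eq_C_of_natDegree_le_zero hp]
    simp [jacobi_zero ha ha]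
  | succ k ih =>
    set J := jacobi a a (2 * (k + 1)) with hJ
    have hJdeg : J.natDegree = 2 * (k + 1) := natDegree_jacobi ha ha _
    have hJ0 : J ≠ 0 := by rintro h; rw [h] at hJdeg; simp at hJdeg
    have hlc : J.coeff (2 * (k + 1)) ≠ 0 := by
      rw [← hJdeg]; exact leadingCoeff_ne_zero.mpr hJ0
    set c := p.coeff (2 * (k + 1)) / J.coeff (2 * (k + 1)) with hc
    have heven' : (p - C c * J).comp (-X) = p - C c * J := by
      rw [sub_comp, mul_comp, C_comp, heven, hJ, jacobi_comp_neg_X a (by simp)]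
    have hdeg : (p - C c * J).natDegree ≤ 2 * k := by
      rw [natDegree_le_iff_coeff_eq_zero]
      intro N hN
      rcases lt_trichotomy N (2 * (k + 1)) with h | rfl | h
      · -- the odd coefficients of an even polynomial vanish
        have hNodd : Odd N := ⟨k, by omega⟩
        have h1 := congrArg (fun q => q.coeff N) heven'
        have hX : (-X : ℝ[X]) = C (-1) * X := by simp
        simp only [hX, comp_C_mul_X_coeff, hNodd.neg_one_pow] at h1
        linarith
      · rw [coeff_sub, coeff_C_mul, hc, div_mul_cancel₀ _ hlc, sub_self]
      · rw [coeff_sub, coeff_C_mul, coeff_eq_zero_of_natDegree_lt (by omega),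
          coeff_eq_zero_of_natDegree_lt (by omega), mul_zero, sub_self]
    obtain ⟨d, hd⟩ := ih hdeg heven'
    refine ⟨fun n => if n = 2 * (k + 1) then c else d n, ?_⟩
    simp only
    rw [Finset.sum_range_succ, if_pos rfl, ← sub_eq_iff_eq_add, ← hJ, hd]
    refine Finset.sum_congr rfl fun i hi => ?_
    rw [if_neg]
    have := Finset.mem_range.mp hi
    omega

/-! ### Tensor product increments of Jacobi polynomials -/

theorem JacobiParams.neg_one_lt_a (𝔧 : JacobiParams) (j : ℕ) : -1 < 𝔧.a j := by
  obtain ⟨c, hc, h⟩ := 𝔧.lower_a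
  exact hc.trans_le (h j)

theorem JacobiParams.neg_one_lt_b (𝔧 : JacobiParams) (j : ℕ) : -1 < 𝔧.b j := by
  obtain ⟨c, hc, h⟩ := 𝔧.lower_b
  exact hc.trans_le (h j)

theorem JacobiParams.θ₀_nonneg (𝔧 : JacobiParams) : 0 ≤ 𝔧.θ₀ := by
  have := le_max_right (max (⨆ j, 𝔧.a j) (⨆ j, 𝔧.b j)) (-(1 / 2 : ℝ))
  rw [JacobiParams.θ₀]; linarith

theorem chebIncr_zero (p : ℝ[X]) : chebIncr 0 p = C (p.eval (chebNode 0 0 : ℝ)) := by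
  have h1 : Lagrange.basis Finset.univ (fun i => (chebNode 0 i : ℝ)) (0 : Fin 1) = 1 :=
    Lagrange.basis_singleton (0 : Fin 1)
  rw [chebIncr, if_pos rfl, sub_zero, chebInterp, Lagrange.interpolate_apply, Fin.sum_univ_one, h1,
    mul_one]

section Product

variable {X : Type*} [NormedAddCommGroup X] [NormedSpace ℝ X]

/-- Interpolation in one variable acts on one factor of a product. Here and below the product runs
over a range that contains all variables concerned. -/
theorem interp_prod (m : ℕ) {j M : ℕ} (hj : j < M) (g : ℕ → ℝ[X]) (w : X) (y : Cube) :
    interp m j (fun y => (∏ i ∈ Finset.range M, (g i).eval (y i : ℝ)) • w) y =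
      (∏ i ∈ Finset.range M, (Function.update g j (chebInterp m (g j)) i).eval (y i : ℝ)) • w := by
  have hj' : j ∈ Finset.range M := Finset.mem_range.mpr hj
  have hrest : ∀ i ∈ (Finset.range M).erase j,
      (Function.update g j (chebInterp m (g j)) i).eval (y i : ℝ) = (g i).eval (y i : ℝ) := by
    intro i hi
    rw [Function.update_of_ne (Finset.ne_of_mem_erase hi)]
  rw [interp, ← Finset.mul_prod_erase _ _ hj', Finset.prod_congr rfl hrest, Function.update_self,
    eval_chebInterp, Finset.sum_mul, Finset.sum_smul]
  refine Finset.sum_congr rfl fun k _ => ?_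
  rw [smul_smul, ← Finset.mul_prod_erase _ _ hj', Function.update_self, mul_assoc]
  congr 3
  refine Finset.prod_congr rfl fun i hi => ?_
  rw [Function.update_of_ne (Finset.ne_of_mem_erase hi)]

theorem evenIncr_prod (m : ℕ) {j M : ℕ} (hj : j < M) (g : ℕ → ℝ[X]) (w : X) (y : Cube) :
    evenIncr m j (fun y => (∏ i ∈ Finset.range M, (g i).eval (y i : ℝ)) • w) y =
      (∏ i ∈ Finset.range M, (Function.update g j (chebIncr m (g j)) i).eval (y i : ℝ)) • w := by
  have hj' : j ∈ Finset.range M := Finset.mem_range.mpr hj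
  have hrest : ∀ p : ℝ[X], ∏ i ∈ Finset.range M, (Function.update g j p i).eval (y i : ℝ) =
      p.eval (y j : ℝ) * ∏ i ∈ (Finset.range M).erase j, (g i).eval (y i : ℝ) := by
    intro p
    rw [← Finset.mul_prod_erase _ _ hj', Function.update_self]
    congr 1
    refine Finset.prod_congr rfl fun i hi => ?_
    rw [Function.update_of_ne (Finset.ne_of_mem_erase hi)]
  rw [evenIncr, interp_prod m hj, interp_prod (m - 2) hj, hrest, hrest, hrest, chebIncr]
  split_ifs with h
  · simp
  · rw [eval_sub, sub_mul, sub_smul]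

theorem partialIncr_prod (ν : ℕ →₀ ℕ) {N M : ℕ} (hN : N ≤ M) (g : ℕ → ℝ[X]) (w : X) :
    partialIncr ν (fun y => (∏ i ∈ Finset.range M, (g i).eval (y i : ℝ)) • w) N = fun y =>
      (∏ i ∈ Finset.range M, (if i < N then chebIncr (ν i) (g i) else g i).eval (y i : ℝ)) • w := by
  induction N with
  | zero => simp [partialIncr]
  | succ N ih =>
    rw [partialIncr, ih (by omega)]
    funext y
    rw [evenIncr_prod (ν N) (by omega : N < M)
      (fun i => if i < N then chebIncr (ν i) (g i) else g i)]
    congr 1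
    refine Finset.prod_congr rfl fun i _ => ?_
    rcases lt_trichotomy i N with h | rfl | h
    · rw [Function.update_of_ne h.ne, if_pos h, if_pos (by omega)]
    · rw [Function.update_self, if_neg (lt_irrefl i), if_pos (by omega)]
    · rw [Function.update_of_ne h.ne', if_neg (by omega), if_neg (by omega)]

theorem tensorIncr_prod (ν : ℕ →₀ ℕ) {M : ℕ} (hM : ν.support.sup Nat.succ ≤ M) (g : ℕ → ℝ[X])
    (w : X) (y : Cube) :
    tensorIncr ν (fun y => (∏ i ∈ Finset.range M, (g i).eval (y i : ℝ)) • w) y =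
      (∏ i ∈ Finset.range M, (chebIncr (ν i) (g i)).eval (y i : ℝ)) • w := by
  set N := ν.support.sup Nat.succ with hN
  have hfun : (fun y : Cube => (fun y : Cube => (∏ i ∈ Finset.range M, (g i).eval (y i : ℝ)) • w)
      fun j => if j < N then y j else chebNode 0 0) = fun y =>
      (∏ i ∈ Finset.range M,
        (if i < N then g i else C ((g i).eval (chebNode 0 0 : ℝ))).eval (y i : ℝ)) • w := by
    funext y
    simp only
    congr 1
    refine Finset.prod_congr rfl fun i _ => ?_
    split_ifs <;> simp
  rw [tensorIncr, ← hN, hfun,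
    partialIncr_prod ν hM (fun i => if i < N then g i else C ((g i).eval (chebNode 0 0 : ℝ)))]
  simp only
  congr 1
  refine Finset.prod_congr rfl fun i _ => ?_
  split_ifs with h
  · rfl
  · have : ν i = 0 := by
      by_contra h0
      exact h (Finset.le_sup (f := Nat.succ) (Finsupp.mem_support_iff.mpr h0))
    rw [this, chebIncr_zero]

theorem interp_hasSum {ι : Type*} {f : ι → Cube → X} {v : Cube → X} (m j : ℕ)
    (h : ∀ y, HasSum (fun i => f i y) (v y)) (y : Cube) :
    HasSum (fun i => interp m j (f i) y) (interp m j v y) :=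
  hasSum_sum fun _ _ => (h _).const_smul _

theorem evenIncr_hasSum {ι : Type*} {f : ι → Cube → X} {v : Cube → X} (m j : ℕ)
    (h : ∀ y, HasSum (fun i => f i y) (v y)) (y : Cube) :
    HasSum (fun i => evenIncr m j (f i) y) (evenIncr m j v y) := by
  refine (interp_hasSum m j h y).sub ?_
  split_ifs
  · exact hasSum_zero
  · exact interp_hasSum (m - 2) j h y

/-- Tensor increments use finitely many point values, so they commute with pointwise convergent
series. -/
theorem tensorIncr_hasSum {ι : Type*} {f : ι → Cube → X} {v : Cube → X} (ν : ℕ →₀ ℕ)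
    (h : ∀ y, HasSum (fun i => f i y) (v y)) (y : Cube) :
    HasSum (fun i => tensorIncr ν (f i) y) (tensorIncr ν v y) := by
  have key : ∀ (N : ℕ) {f : ι → Cube → X} {v : Cube → X},
      (∀ y, HasSum (fun i => f i y) (v y)) → ∀ y,
      HasSum (fun i => partialIncr ν (f i) N y) (partialIncr ν v N y) := by
    intro N f v h
    induction N with
    | zero => exact h
    | succ N ih => exact evenIncr_hasSum (ν N) N ih
  exact key _ (fun y => h _) y

end Product

/-- The increment `⨂_j (I_{ν_j} - I_{ν_j - 2})` of the Jacobi polynomial `J_μ`. Outside the supports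
of `μ` and `ν` all factors are `1`. -/
noncomputable def JacobiParams.incrJ (𝔧 : JacobiParams) (ν μ : ℕ →₀ ℕ) (y : Cube) : ℝ :=
  ∏ i ∈ μ.support ∪ ν.support,
    (chebIncr (ν i) (jacobi (𝔧.a i) (𝔧.b i) (μ i))).eval (y i : ℝ)

theorem JacobiParams.incrJ_eq_prod (𝔧 : JacobiParams) {ν μ : ℕ →₀ ℕ} {s : Finset ℕ}
    (hμ : μ.support ⊆ s) (hν : ν.support ⊆ s) (y : Cube) :
    𝔧.incrJ ν μ y =
      ∏ i ∈ s, (chebIncr (ν i) (jacobi (𝔧.a i) (𝔧.b i) (μ i))).eval (y i : ℝ) := by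
  refine Finset.prod_subset (Finset.union_subset hμ hν) fun i _ hi => ?_
  rw [Finset.mem_union, not_or, Finsupp.notMem_support_iff, Finsupp.notMem_support_iff] at hi
  rw [hi.1, hi.2, jacobi_zero (𝔧.neg_one_lt_a i) (𝔧.neg_one_lt_b i), chebIncr_zero_one, eval_one]

theorem JacobiParams.J_eq_prod (𝔧 : JacobiParams) {μ : ℕ →₀ ℕ} {s : Finset ℕ}
    (hμ : μ.support ⊆ s) (y : Cube) :
    𝔧.J μ y = ∏ i ∈ s, (jacobi (𝔧.a i) (𝔧.b i) (μ i)).eval (y i : ℝ) := by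
  refine Finsupp.prod_of_support_subset μ hμ _ fun i _ => ?_
  rw [jacobi_zero (𝔧.neg_one_lt_a i) (𝔧.neg_one_lt_b i), eval_one]

theorem support_subset_range (ν : ℕ →₀ ℕ) : ν.support ⊆ Finset.range (ν.support.sup Nat.succ) :=
  fun _ hi => Finset.mem_range.mpr (Finset.le_sup (f := Nat.succ) hi)

theorem JacobiParams.tensorIncr_J {X : Type*} [NormedAddCommGroup X] [NormedSpace ℝ X]
    (𝔧 : JacobiParams) (ν μ : ℕ →₀ ℕ) (w : X) (y : Cube) :
    tensorIncr ν (fun y => 𝔧.J μ y • w) y = 𝔧.incrJ ν μ y • w := by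
  set M := max (ν.support.sup Nat.succ) (μ.support.sup Nat.succ)
  have hν : ν.support ⊆ Finset.range M :=
    (support_subset_range ν).trans (Finset.range_subset_range.mpr (le_max_left _ _))
  have hμ : μ.support ⊆ Finset.range M :=
    (support_subset_range μ).trans (Finset.range_subset_range.mpr (le_max_right _ _))
  simp only [𝔧.J_eq_prod hμ]
  rw [tensorIncr_prod ν (le_max_left _ _) (fun i => jacobi (𝔧.a i) (𝔧.b i) (μ i)),
    𝔧.incrJ_eq_prod hμ hν]

/-- If `ν_i > μ_i` with both even, then `μ_i ≤ ν_i - 2`, and both `I_{ν_i}` and `I_{ν_i - 2}`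
reproduce the factor of degree `μ_i`. -/
theorem JacobiParams.incrJ_eq_zero (𝔧 : JacobiParams) {ν μ : EvenIdx} (h : ¬ν ≤ μ) (y : Cube) :
    𝔧.incrJ ν μ y = 0 := by
  have h' : ∃ i, ¬(ν : ℕ →₀ ℕ) i ≤ (μ : ℕ →₀ ℕ) i := by
    by_contra hc
    push Not at hc
    exact h hc
  obtain ⟨i, hi⟩ := h'
  have hν : (ν : ℕ →₀ ℕ) i ≠ 0 := by omega
  refine Finset.prod_eq_zero
    (Finset.mem_union_right _ (Finsupp.mem_support_iff.mpr hν)) (i := i) ?_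
  rw [chebIncr_eq_zero hν, eval_zero]
  refine (natDegree_jacobi_le _ _ _).trans ?_
  obtain ⟨r, hr⟩ := ν.2 i
  obtain ⟨s, hs⟩ := μ.2 i
  omega

theorem finite_Iic_evenIdx (μ : EvenIdx) : (Set.Iic μ).Finite :=
  (Set.finite_Iic (μ : ℕ →₀ ℕ)).preimage Subtype.val_injective.injOn

/-- The finite set of even multi-indices below `μ`. -/
noncomputable def evenBelow (μ : EvenIdx) : Finset EvenIdx := (finite_Iic_evenIdx μ).toFinset

theorem mem_evenBelow {μ ν : EvenIdx} : ν ∈ evenBelow μ ↔ ν ≤ μ := by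
  rw [evenBelow, Set.Finite.mem_toFinset, Set.mem_Iic]

theorem EvenIdx.support_subset {μ ν : EvenIdx} (h : ν ≤ μ) :
    (ν : ℕ →₀ ℕ).support ⊆ (μ : ℕ →₀ ℕ).support := by
  intro i hi
  have h1 : (ν : ℕ →₀ ℕ) i ≤ (μ : ℕ →₀ ℕ) i := h i
  rw [Finsupp.mem_support_iff] at hi ⊢
  omega

/-- Distributivity: a product of sums over the even orders `≤ μ_i` is a sum over the even
multi-indices below `μ`. -/
theorem sum_evenBelow_prod (μ : EvenIdx) (F : ℕ → ℕ → ℝ) :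
    ∑ ν ∈ evenBelow μ, ∏ i ∈ (μ : ℕ →₀ ℕ).support, F i ((ν : ℕ →₀ ℕ) i) =
      ∏ i ∈ (μ : ℕ →₀ ℕ).support,
        ∑ m ∈ Finset.range ((μ : ℕ →₀ ℕ) i / 2 + 1), F i (2 * m) := by
  classical
  rw [Finset.prod_sum]
  refine Finset.sum_bij' (fun ν _ => fun i _ => (ν : ℕ →₀ ℕ) i / 2)
    (fun p _ => ⟨Finsupp.onFinset (μ : ℕ →₀ ℕ).support
      (fun i => if h : i ∈ (μ : ℕ →₀ ℕ).support then 2 * p i h else 0)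
      (fun i hi => by by_contra h; exact hi (dif_neg h)), fun i => by
        rw [Finsupp.onFinset_apply]; split_ifs <;> simp⟩) ?_ ?_ ?_ ?_ ?_
  · intro ν hν
    rw [Finset.mem_pi]
    intro i _
    have : (ν : ℕ →₀ ℕ) i ≤ (μ : ℕ →₀ ℕ) i := mem_evenBelow.mp hν i
    rw [Finset.mem_range]; omega
  · intro p hp
    rw [mem_evenBelow]
    intro i
    rw [Finset.mem_pi] at hp
    change (if h : i ∈ (μ : ℕ →₀ ℕ).support then 2 * p i h else 0) ≤ (μ : ℕ →₀ ℕ) i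
    split_ifs with h
    · have := Finset.mem_range.mp (hp i h); omega
    · exact Nat.zero_le _
  · intro ν hν
    apply Subtype.ext
    ext i
    change (if h : i ∈ (μ : ℕ →₀ ℕ).support then 2 * ((ν : ℕ →₀ ℕ) i / 2) else 0) = _
    split_ifs with h
    · obtain ⟨r, hr⟩ := ν.2 i; omega
    · have := Finsupp.notMem_support_iff.mp
        (fun h' => h (EvenIdx.support_subset (mem_evenBelow.mp hν) h'))
      exact this.symm
  · intro p hp
    funext i hi
    change (if h : i ∈ (μ : ℕ →₀ ℕ).support then 2 * p i h else 0) / 2 = _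
    rw [dif_pos hi]; omega
  · intro ν hν
    rw [← Finset.prod_attach]
    refine Finset.prod_congr rfl fun i _ => ?_
    obtain ⟨r, hr⟩ := ν.2 i
    congr 1
    change _ = 2 * ((ν : ℕ →₀ ℕ) i / 2)
    omega

/-- The increments up to `μ` telescope to the interpolation of order `μ`, which reproduces `J_μ`. -/
theorem JacobiParams.sum_incrJ (𝔧 : JacobiParams) (μ : EvenIdx) (y : Cube) :
    ∑ ν ∈ evenBelow μ, 𝔧.incrJ ν μ y = 𝔧.J μ y := by
  rw [Finset.sum_congr rfl fun ν hν =>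
    𝔧.incrJ_eq_prod subset_rfl (EvenIdx.support_subset (mem_evenBelow.mp hν)) y,
    sum_evenBelow_prod μ
      fun i n => (chebIncr n (jacobi (𝔧.a i) (𝔧.b i) ((μ : ℕ →₀ ℕ) i))).eval (y i : ℝ),
    𝔧.J_eq_prod subset_rfl]
  refine Finset.prod_congr rfl fun i _ => ?_
  obtain ⟨r, hr⟩ := μ.2 i
  rw [← eval_finsetSum, sum_chebIncr, chebInterp_eq_self]
  refine (natDegree_jacobi_le _ _ _).trans ?_
  omega

/-- The increments of `J_μ` are bounded, all together, by the weight `p_μ(θ₀ + 1 + ε, Cε + 1)`. -/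
theorem JacobiParams.sum_abs_incrJ_le (𝔧 : JacobiParams) {ε Cε : ℝ} (hε : 0 < ε) (hCε : 0 < Cε)
    (hJ : ∀ j k : ℕ, 1 ≤ k → ∀ t : II,
      2 * |(jacobi (𝔧.a j) (𝔧.b j) k).eval (t : ℝ)| * Real.log (2 * k + 3) ≤
        (Cε * k + 1) ^ (𝔧.θ₀ + ε)) (μ : EvenIdx) (y : Cube) :
    ∑ ν ∈ evenBelow μ, |𝔧.incrJ ν μ y| ≤ weight (𝔧.θ₀ + 1 + ε) (Cε + 1) μ := by
  rw [Finset.sum_congr rfl fun ν hν => (congrArg abs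
    (𝔧.incrJ_eq_prod subset_rfl (EvenIdx.support_subset (mem_evenBelow.mp hν)) y)).trans
      (Finset.abs_prod _ _), sum_evenBelow_prod μ
      fun i n => |(chebIncr n (jacobi (𝔧.a i) (𝔧.b i) ((μ : ℕ →₀ ℕ) i))).eval (y i : ℝ)|]
  refine Finset.prod_le_prod (fun i _ => Finset.sum_nonneg fun _ _ => abs_nonneg _) fun i hi => ?_
  set n := (μ : ℕ →₀ ℕ) i with hn
  have heven : Even n := μ.2 i
  have hn2 : 2 ≤ n := by
    have := Finsupp.mem_support_iff.mp hi
    obtain ⟨r, hr⟩ := heven; omega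
  have hn0 : (0 : ℝ) < n := by exact_mod_cast (by omega : 0 < n)
  have hlog : 0 < Real.log (2 * n + 3) := Real.log_pos (by linarith)
  have h := sum_abs_eval_chebIncr_le heven hn2 (p := jacobi (𝔧.a i) (𝔧.b i) n)
    (B := (Cε * n + 1) ^ (𝔧.θ₀ + ε) / (2 * Real.log (2 * n + 3))) (x := y i) (y i).2
    (fun t => by
      rw [le_div_iff₀ (by positivity)]
      have := hJ i n (by omega) t
      linarith)
  refine h.trans ?_
  have hθ := 𝔧.θ₀_nonneg
  have e : 2 * ((Cε * n + 1) ^ (𝔧.θ₀ + ε) / (2 * Real.log (2 * n + 3))) * Real.log (2 * n + 3) =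
      (Cε * n + 1) ^ (𝔧.θ₀ + ε) := by field_simp
  rw [e]
  have hpos : (0 : ℝ) < 1 + (Cε + 1) * n := by positivity
  calc ((n : ℝ) + 1) * (Cε * n + 1) ^ (𝔧.θ₀ + ε)
      ≤ (1 + (Cε + 1) * n) * (1 + (Cε + 1) * n) ^ (𝔧.θ₀ + ε) := by
        have h1 : 0 < Cε * n := by positivity
        refine mul_le_mul (by linarith) (Real.rpow_le_rpow (by positivity) (by linarith)
          (by linarith)) (by positivity) hpos.le
    _ = (1 + (Cε + 1) * n) ^ (𝔧.θ₀ + 1 + ε) := by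
        rw [show 𝔧.θ₀ + 1 + ε = 1 + (𝔧.θ₀ + ε) by ring, Real.rpow_add hpos 1, Real.rpow_one]

/-! ### The continuous representative -/

theorem JacobiParams.abs_J_le (𝔧 : JacobiParams) {p : EvenIdx → ℝ}
    (hp : ∀ μ y, ∑ ν ∈ evenBelow μ, |𝔧.incrJ ν μ y| ≤ p μ) (μ : EvenIdx) (y : Cube) :
    |𝔧.J μ y| ≤ p μ := by
  rw [← 𝔧.sum_incrJ]
  exact (Finset.abs_sum_le_sum_abs _ _).trans (hp μ y)

theorem JacobiParams.continuous_J (𝔧 : JacobiParams) (μ : ℕ →₀ ℕ) : Continuous (𝔧.J μ) := by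
  unfold JacobiParams.J Finsupp.prod
  refine continuous_finsetProd _ fun i _ => ?_
  exact (Polynomial.continuous _).comp (continuous_subtype_val.comp (continuous_apply i))

/-- If `∑ p_ν ‖v_ν‖ < ∞`, where `p_ν` dominates `|J_ν|`, then the Jacobi expansion of `v` converges
uniformly, and its sum is a continuous representative of `v`. -/
theorem JacobiParams.exists_continuous_representative {X : Type*} [NormedAddCommGroup X]
    [NormedSpace ℝ X] [CompleteSpace X] (𝔧 : JacobiParams) {v : Cube → X}
    (hv : 𝔧.HasEvenExpansion v) {p : EvenIdx → ℝ} (hp : ∀ μ y, |𝔧.J (μ : EvenIdx) y| ≤ p μ)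
    (hsum : Summable fun μ : EvenIdx => p μ * ‖𝔧.coeff v μ‖) :
    ∃ vc : C(Cube, X), vc =ᵐ[𝔧.measure] v ∧
      ∀ y, HasSum (fun μ : EvenIdx => 𝔧.J μ y • 𝔧.coeff v μ) (vc y) := by
  have := 𝔧.isProbabilityMeasure_measure
  have hbd : ∀ (μ : EvenIdx) (y : Cube), ‖𝔧.J μ y • 𝔧.coeff v μ‖ ≤ p μ * ‖𝔧.coeff v μ‖ := by
    intro μ y
    rw [norm_smul, Real.norm_eq_abs]
    exact mul_le_mul_of_nonneg_right (hp μ y) (norm_nonneg _)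
  have hcont : ∀ μ : EvenIdx, Continuous fun y => 𝔧.J μ y • 𝔧.coeff v μ := fun μ =>
    (𝔧.continuous_J μ).smul continuous_const
  let vc : C(Cube, X) := ⟨fun y => ∑' μ : EvenIdx, 𝔧.J μ y • 𝔧.coeff v μ,
    continuous_tsum hcont hsum hbd⟩
  refine ⟨vc, ?_, fun y => (Summable.of_norm_bounded hsum fun μ => hbd μ y).hasSum⟩
  have hvm : AEStronglyMeasurable v 𝔧.measure := hv.memLp.1
  have hvcm : AEStronglyMeasurable vc 𝔧.measure := vc.continuous.aestronglyMeasurable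
  have hS : ∀ s : Finset EvenIdx, AEStronglyMeasurable
      (fun y => ∑ μ ∈ s, 𝔧.J μ y • 𝔧.coeff v μ) 𝔧.measure := fun s =>
    (continuous_finsetSum s fun μ _ => hcont μ).aestronglyMeasurable
  have hunif : TendstoUniformly (fun (s : Finset EvenIdx) y => ∑ μ ∈ s, 𝔧.J μ y • 𝔧.coeff v μ)
      vc atTop := tendstoUniformly_tsum hsum hbd
  have hzero : eLpNorm (v - ⇑vc) 2 𝔧.measure = 0 := by
    refine le_antisymm (ENNReal.le_of_forall_pos_le_add fun δ hδ _ => ?_) zero_le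
    have hδ' : (0 : ℝ) < (δ : ℝ) / 2 := by positivity
    have h1 := Metric.tendstoUniformly_iff.mp hunif ((δ : ℝ) / 2) hδ'
    have h2 : ∀ᶠ s in atTop, eLpNorm
        (fun y => v y - ∑ ν ∈ s, 𝔧.J (ν : EvenIdx) y • 𝔧.coeff v ν) 2 𝔧.measure <
          ENNReal.ofReal ((δ : ℝ) / 2) :=
      hv.tendsto.eventually_lt_const (ENNReal.ofReal_pos.mpr hδ')
    obtain ⟨s, hs1, hs2⟩ := (h1.and h2).exists
    have hsplit : v - ⇑vc = (fun y => v y - ∑ ν ∈ s, 𝔧.J (ν : EvenIdx) y • 𝔧.coeff v ν) +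
        fun y => (∑ ν ∈ s, 𝔧.J (ν : EvenIdx) y • 𝔧.coeff v ν) - vc y := by
      funext y; simp
    rw [hsplit]
    refine (eLpNorm_add_le (hvm.sub (hS s)) ((hS s).sub hvcm) (by norm_num)).trans ?_
    have h3 : eLpNorm (fun y => (∑ ν ∈ s, 𝔧.J (ν : EvenIdx) y • 𝔧.coeff v ν) - vc y) 2 𝔧.measure ≤
        ENNReal.ofReal ((δ : ℝ) / 2) := by
      refine (eLpNorm_le_of_ae_bound (C := (δ : ℝ) / 2) (Eventually.of_forall fun y => ?_)).trans ?_
      · rw [← dist_eq_norm, dist_comm]; exact (hs1 y).le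
      · simp
    refine (add_le_add hs2.le h3).trans ?_
    rw [← ENNReal.ofReal_add hδ'.le hδ'.le, add_halves, zero_add, ENNReal.ofReal_coe_nnreal]
  rw [eLpNorm_eq_zero_iff (hvm.sub hvcm) (by norm_num)] at hzero
  filter_upwards [hzero] with y hy
  exact (sub_eq_zero.mp hy).symm

/-! ### The error of a sparse grid interpolation -/

section Spatial

variable {𝕜 X₁ X₂ : Type*} [RCLike 𝕜]
  [NormedAddCommGroup X₁] [InnerProductSpace 𝕜 X₁]
  [NormedAddCommGroup X₂] [InnerProductSpace 𝕜 X₂]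

theorem sum_spatialIncr (P : ℕ → X₁ →ₗ[𝕜] X₁) (κ : ℕ) (x : X₁) :
    ∑ k ∈ Finset.range (κ + 1), spatialIncr P k x = P (2 ^ κ) x := by
  induction κ with
  | zero => simp [spatialIncr]
  | succ κ ih => rw [Finset.sum_range_succ, ih, spatialIncr, LinearMap.sub_apply, add_sub_cancel]

/-- Stability and decay of the dyadic increments, with one constant, in terms of `r = 2^{-α}`. -/
theorem SpatialApprox.exists_bound {ι : X₂ →L[𝕜] X₁} {V : ℕ → Submodule 𝕜 X₁}
    {P : ℕ → X₁ →ₗ[𝕜] X₁} {α : ℝ} (hP : SpatialApprox ι V P α) :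
    ∃ A > 0, (∀ k w, ‖spatialIncr P k (ι w)‖ ≤ A * ((2 : ℝ) ^ (-α)) ^ k * ‖w‖) ∧
      (∀ k w, ‖spatialIncr P k (ι w)‖ ≤ A * ‖ι w‖) ∧
      ∀ κ w, ‖ι w - ∑ k ∈ Finset.range κ, spatialIncr P k (ι w)‖ ≤
        A * ((2 : ℝ) ^ (-α)) ^ κ * ‖w‖ := by
  obtain ⟨C₁, hC₁, h₁⟩ := hP.stable
  obtain ⟨C₂, hC₂, h₂⟩ := hP.consistent
  set r : ℝ := (2 : ℝ) ^ (-α) with hr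
  have hr0 : 0 < r := by positivity
  have hpow : ∀ k : ℕ, ((2 ^ k : ℕ) : ℝ) ^ (-α) = r ^ k := by
    intro k
    push_cast
    rw [hr, ← Real.rpow_natCast, ← Real.rpow_mul (by norm_num), mul_comm,
      Real.rpow_mul (by norm_num), Real.rpow_natCast]
  have hcons : ∀ (k : ℕ) (w : X₂), ‖ι w - P (2 ^ k) (ι w)‖ ≤ C₂ * r ^ k * ‖w‖ := by
    intro k w
    have := h₂ (2 ^ k) Nat.one_le_two_pow w
    rwa [hpow] at this
  have hι : ∀ w, ‖ι w‖ ≤ ‖ι‖ * ‖w‖ := ι.le_opNorm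
  have hιn := norm_nonneg ι
  have hdiv : 0 < C₂ / r := by positivity
  set A := ‖ι‖ + C₁ * ‖ι‖ + C₂ + C₂ / r + 2 * C₁ with hA
  have hCι : 0 ≤ C₁ * ‖ι‖ := by positivity
  have hA1 : C₁ * ‖ι‖ ≤ A := by linarith
  have hA2 : C₂ + C₂ / r ≤ A := by linarith
  have hA3 : 2 * C₁ ≤ A := by linarith
  have hA4 : C₂ / r ≤ A := by linarith
  have hA5 : ‖ι‖ ≤ A := by linarith
  refine ⟨A, by linarith, ?_, ?_, ?_⟩
  · intro k w
    cases k with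
    | zero =>
      rw [pow_zero, mul_one, spatialIncr]
      calc ‖P 1 (ι w)‖ ≤ C₁ * ‖ι w‖ := h₁ 1 w
        _ ≤ C₁ * (‖ι‖ * ‖w‖) := by gcongr; exact hι w
        _ = C₁ * ‖ι‖ * ‖w‖ := by ring
        _ ≤ A * ‖w‖ := by gcongr
    | succ k =>
      rw [spatialIncr, LinearMap.sub_apply]
      have e : P (2 ^ (k + 1)) (ι w) - P (2 ^ k) (ι w) =
          (ι w - P (2 ^ k) (ι w)) - (ι w - P (2 ^ (k + 1)) (ι w)) := by abel
      rw [e]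
      calc _ ≤ C₂ * r ^ k * ‖w‖ + C₂ * r ^ (k + 1) * ‖w‖ :=
            (norm_sub_le _ _).trans (add_le_add (hcons k w) (hcons (k + 1) w))
        _ = (C₂ + C₂ / r) * r ^ (k + 1) * ‖w‖ := by field_simp; ring
        _ ≤ A * r ^ (k + 1) * ‖w‖ := by gcongr
  · intro k w
    cases k with
    | zero =>
      rw [spatialIncr]
      refine (h₁ 1 w).trans ?_
      gcongr; linarith
    | succ k =>
      rw [spatialIncr, LinearMap.sub_apply]
      calc _ ≤ C₁ * ‖ι w‖ + C₁ * ‖ι w‖ := (norm_sub_le _ _).trans (add_le_add (h₁ _ w) (h₁ _ w))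
        _ = 2 * C₁ * ‖ι w‖ := by ring
        _ ≤ A * ‖ι w‖ := by gcongr
  · intro κ w
    cases κ with
    | zero =>
      rw [Finset.sum_range_zero, sub_zero, pow_zero, mul_one]
      exact (hι w).trans (by gcongr)
    | succ κ =>
      rw [sum_spatialIncr]
      calc _ ≤ C₂ * r ^ κ * ‖w‖ := hcons κ w
        _ = C₂ / r * r ^ (κ + 1) * ‖w‖ := by field_simp; ring
        _ ≤ A * r ^ (κ + 1) * ‖w‖ := by gcongr

/-- The `P_m` need not be continuous on `X₁`, but the increments are continuous on `X₂`. -/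
theorem SpatialApprox.exists_continuousLinearMap {ι : X₂ →L[𝕜] X₁} {V : ℕ → Submodule 𝕜 X₁}
    {P : ℕ → X₁ →ₗ[𝕜] X₁} {α : ℝ} (hP : SpatialApprox ι V P α) (k : ℕ) :
    ∃ L : X₂ →L[𝕜] X₁, ∀ w, L w = spatialIncr P k (ι w) := by
  obtain ⟨A, -, h, -, -⟩ := hP.exists_bound
  exact ⟨((spatialIncr P k).comp (ι : X₂ →ₗ[𝕜] X₁)).mkContinuous _ (h k), fun w => rfl⟩

variable [NormedSpace ℝ X₁]

/-- The part of the error caused by one coefficient `w`. For `k < κ` the increment `δ_k w` is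
multiplied with the full polynomial `J`; the remaining increments are geometrically small. -/
theorem norm_term_le {ι : X₂ →L[𝕜] X₁} {P : ℕ → X₁ →ₗ[𝕜] X₁} {A r : ℝ} (hA : 0 < A) (hr0 : 0 < r)
    (hr1 : r < 1) (hδ : ∀ k w, ‖spatialIncr P k (ι w)‖ ≤ A * r ^ k * ‖w‖)
    (hrem : ∀ κ w, ‖ι w - ∑ k ∈ Finset.range κ, spatialIncr P k (ι w)‖ ≤ A * r ^ κ * ‖w‖)
    {c : ℕ → ℝ} {J p : ℝ} (hJ : |J| ≤ p) (hc : ∀ k, |c k| ≤ p) {κ K : ℕ} (hκK : κ ≤ K)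
    (hcJ : ∀ k < κ, c k = J) (w : X₂) :
    ‖J • ι w - ∑ k ∈ Finset.range K, c k • spatialIncr P k (ι w)‖ ≤
      A * (1 + (1 - r)⁻¹) * r ^ κ * (p * ‖w‖) := by
  have hp0 : 0 ≤ p := (abs_nonneg _).trans hJ
  have e : J • ι w - ∑ k ∈ Finset.range K, c k • spatialIncr P k (ι w) =
      J • (ι w - ∑ k ∈ Finset.range κ, spatialIncr P k (ι w)) -
        ∑ k ∈ Finset.Ico κ K, c k • spatialIncr P k (ι w) := by
    rw [← Finset.sum_range_add_sum_Ico _ hκK, smul_sub, Finset.smul_sum,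
      Finset.sum_congr rfl fun k hk => by rw [hcJ k (Finset.mem_range.mp hk)]]
    abel
  have h1 : ‖J • (ι w - ∑ k ∈ Finset.range κ, spatialIncr P k (ι w))‖ ≤
      p * (A * r ^ κ * ‖w‖) := by
    rw [norm_smul, Real.norm_eq_abs]
    exact mul_le_mul hJ (hrem κ w) (norm_nonneg _) hp0
  have h2 : ‖∑ k ∈ Finset.Ico κ K, c k • spatialIncr P k (ι w)‖ ≤
      p * A * ‖w‖ * (r ^ κ * (1 - r)⁻¹) := by
    calc _ ≤ ∑ k ∈ Finset.Ico κ K, p * A * ‖w‖ * r ^ k := by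
          refine norm_sum_le_of_le _ fun k _ => ?_
          rw [norm_smul, Real.norm_eq_abs]
          refine (mul_le_mul (hc k) (hδ k w) (norm_nonneg _) hp0).trans_eq (by ring)
      _ = p * A * ‖w‖ * ∑ k ∈ Finset.Ico κ K, r ^ k := (Finset.mul_sum _ _ _).symm
      _ ≤ p * A * ‖w‖ * (r ^ κ * (1 - r)⁻¹) := by
          gcongr
          rw [← div_eq_mul_inv]
          exact geom_sum_Ico_le_of_lt_one hr0.le hr1
  rw [e]
  refine (norm_sub_le _ _).trans ((add_le_add h1 h2).trans_eq (by ring))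

/-- The part of the error caused by one coefficient `w`, in terms of the weak norm `‖ι w‖` and
without decay. -/
theorem norm_term_le_of_stable {ι : X₂ →L[𝕜] X₁} {P : ℕ → X₁ →ₗ[𝕜] X₁} {A : ℝ}
    (hδ : ∀ k w, ‖spatialIncr P k (ι w)‖ ≤ A * ‖ι w‖)
    {c : ℕ → ℝ} {J p : ℝ} (hJ : |J| ≤ p) (hc : ∀ k, |c k| ≤ p) (K : ℕ) (w : X₂) :
    ‖J • ι w - ∑ k ∈ Finset.range K, c k • spatialIncr P k (ι w)‖ ≤
      (1 + K * A) * (p * ‖ι w‖) := by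
  have hp0 : 0 ≤ p := (abs_nonneg _).trans hJ
  have h1 : ‖J • ι w‖ ≤ p * ‖ι w‖ := by
    rw [norm_smul, Real.norm_eq_abs]; gcongr
  have h2 : ‖∑ k ∈ Finset.range K, c k • spatialIncr P k (ι w)‖ ≤ K * (p * (A * ‖ι w‖)) := by
    calc _ ≤ ∑ k ∈ Finset.range K, p * (A * ‖ι w‖) := by
          refine norm_sum_le_of_le _ fun k _ => ?_
          rw [norm_smul, Real.norm_eq_abs]
          exact mul_le_mul (hc k) (hδ k w) (norm_nonneg _) hp0
      _ = _ := by rw [Finset.sum_const, Finset.card_range, nsmul_eq_mul]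
  exact (norm_sub_le _ _).trans ((add_le_add h1 h2).trans_eq (by ring))

variable [IsScalarTower ℝ 𝕜 X₁] [NormedSpace ℝ X₂] [IsScalarTower ℝ 𝕜 X₂]

/-- The pointwise error of the interpolation over a finite lower set `G`, given a bound for each
coefficient `x_μ`: either by consistency, in terms of the number of increments `k` with
`(k, μ) ∈ G`, or by stability alone. -/
theorem norm_sub_symInterp_le {ι : X₂ →L[𝕜] X₁} {V : ℕ → Submodule 𝕜 X₁}
    {P : ℕ → X₁ →ₗ[𝕜] X₁} {α : ℝ} (hP : SpatialApprox ι V P α) (𝔧 : JacobiParams)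
    {A r : ℝ} (hA : 0 < A) (hr0 : 0 < r)
    (hr1 : r < 1) (hδ : ∀ k w, ‖spatialIncr P k (ι w)‖ ≤ A * r ^ k * ‖w‖)
    (hδ' : ∀ k w, ‖spatialIncr P k (ι w)‖ ≤ A * ‖ι w‖)
    (hrem : ∀ κ w, ‖ι w - ∑ k ∈ Finset.range κ, spatialIncr P k (ι w)‖ ≤ A * r ^ κ * ‖w‖)
    {p : EvenIdx → ℝ} (hp : ∀ μ y, ∑ ν ∈ evenBelow μ, |𝔧.incrJ ν μ y| ≤ p μ)
    {x : EvenIdx → X₂} {vc : Cube → X₂}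
    (hvc : ∀ y, HasSum (fun μ : EvenIdx => 𝔧.J μ y • x μ) (vc y))
    {G : Set (ℕ × EvenIdx)} (hG : G.Finite) (hlow : IsLowerSet G) {K : ℕ}
    (hK : ∀ g ∈ G, g.1 < K) {E : EvenIdx → ℝ} {S : ℝ} (hE : HasSum E S)
    (hbd : ∀ μ, (∃ κ, (∀ k < κ, (k, μ) ∈ G) ∧
        A * (1 + (1 - r)⁻¹) * r ^ κ * (p μ * ‖x μ‖) ≤ E μ) ∨
      (1 + K * A) * (p μ * ‖ι (x μ)‖) ≤ E μ) (y : Cube) :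
    ‖ι (vc y) - symInterp ι P G vc y‖ ≤ S := by
  classical
  have hιs : ∀ (c : ℝ) (w : X₂), ι (c • w) = c • ι w :=
    fun c w => (ι : X₂ →ₗ[𝕜] X₁).map_smul_of_tower c w
  -- the index set of the increments of order `k` in space
  let Λ : ℕ → Finset EvenIdx := fun k => (hG.toFinset.filter fun g => g.1 = k).image Prod.snd
  have hΛ : ∀ k ν, ν ∈ Λ k ↔ (k, ν) ∈ G := by
    intro k ν
    simp only [Λ, Finset.mem_image, Finset.mem_filter, Set.Finite.mem_toFinset, Prod.exists]
    constructor
    · rintro ⟨k', ν', ⟨h, rfl⟩, rfl⟩; exact h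
    · intro h; exact ⟨k, ν, ⟨h, rfl⟩, rfl⟩
  have hterm : HasSum (fun μ : EvenIdx => 𝔧.J μ y • ι (x μ) -
      ∑ g ∈ hG.toFinset, 𝔧.incrJ g.2 μ y • spatialIncr P g.1 (ι (x μ)))
      (ι (vc y) - symInterp ι P G vc y) := by
    refine HasSum.sub ?_ ?_
    · have := (hvc y).mapL ι
      simp only [hιs] at this
      exact this
    · rw [symInterp, finsum_mem_eq_finite_toFinset_sum _ hG]
      refine hasSum_sum fun g _ => ?_
      obtain ⟨L, hL⟩ := hP.exists_continuousLinearMap g.1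
      have h1 := tensorIncr_hasSum (g.2 : ℕ →₀ ℕ) hvc y
      simp only [𝔧.tensorIncr_J] at h1
      have h2 := h1.mapL L
      simp only [hL, hιs, (spatialIncr P g.1).map_smul_of_tower] at h2
      exact h2
  refine hterm.norm_le_of_bounded hE fun μ => ?_
  have hreorg : ∑ g ∈ hG.toFinset, 𝔧.incrJ g.2 μ y • spatialIncr P g.1 (ι (x μ)) =
      ∑ k ∈ Finset.range K, (∑ ν ∈ Λ k, 𝔧.incrJ ν μ y) • spatialIncr P k (ι (x μ)) := by
    rw [← Finset.sum_fiberwise_of_maps_to (t := Finset.range K) (g := Prod.fst)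
      fun g hg => Finset.mem_range.mpr (hK g (hG.mem_toFinset.mp hg))]
    refine Finset.sum_congr rfl fun k _ => ?_
    rw [Finset.sum_image, Finset.sum_smul]
    · refine Finset.sum_congr rfl fun g hg => ?_
      rw [(Finset.mem_filter.mp hg).2]
    · intro g hg g' hg' h
      rw [Finset.coe_filter] at hg hg'
      exact Prod.ext (hg.2.trans hg'.2.symm) h
  have hc : ∀ k, |∑ ν ∈ Λ k, 𝔧.incrJ ν μ y| ≤ p μ := by
    intro k
    refine (Finset.abs_sum_le_sum_abs _ _).trans (le_trans ?_ (hp μ y))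
    rw [← Finset.sum_filter_add_sum_filter_not (Λ k) (fun ν => ν ≤ μ)]
    have h0 : ∑ ν ∈ (Λ k).filter (fun ν => ¬ν ≤ μ), |𝔧.incrJ ν μ y| = 0 :=
      Finset.sum_eq_zero fun ν hν => by
        rw [𝔧.incrJ_eq_zero (Finset.mem_filter.mp hν).2, abs_zero]
    rw [h0, add_zero]
    exact Finset.sum_le_sum_of_subset_of_nonneg
      (fun ν hν => mem_evenBelow.mpr (Finset.mem_filter.mp hν).2) fun _ _ _ => abs_nonneg _
  have hJp := 𝔧.abs_J_le hp μ y
  rw [hreorg]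
  rcases hbd μ with ⟨κ, hκ, hle⟩ | hle
  · refine (norm_term_le hA hr0 hr1 hδ hrem hJp hc (κ := κ) ?_ ?_ (x μ)).trans hle
    · by_contra hlt
      push Not at hlt
      exact lt_irrefl _ (hK _ (hκ K hlt))
    · intro k hk
      rw [← 𝔧.sum_incrJ]
      refine (Finset.sum_subset (fun ν hν => ?_) fun ν _ hν => ?_).symm
      · rw [hΛ]
        exact hlow (show (k, ν) ≤ (k, μ) from ⟨le_rfl, mem_evenBelow.mp hν⟩) (hκ k hk)
      · exact 𝔧.incrJ_eq_zero (fun h => hν (mem_evenBelow.mpr h)) y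
  · exact (norm_term_le_of_stable hδ' hJp hc K (x μ)).trans hle

end Spatial

/-! ### The approximation spaces -/

/-- A finite-dimensional space of functions has a finite set of points and functions `L_s` of the
space such that `f = ∑ f(z_s) L_s` for all `f` in the space. -/
theorem exists_interpolation_points {Y : Type*} (n : ℕ) : ∀ F : Submodule ℝ (Y → ℝ),
    FiniteDimensional ℝ F → Module.finrank ℝ F ≤ n →
    ∃ (d : ℕ) (z : Fin d → Y) (L : Fin d → Y → ℝ), (∀ s, L s ∈ F) ∧
      ∀ f ∈ F, ∀ y, f y = ∑ s, f (z s) * L s y := by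
  have hbot : ∀ F : Submodule ℝ (Y → ℝ), F = ⊥ →
      ∃ (d : ℕ) (z : Fin d → Y) (L : Fin d → Y → ℝ), (∀ s, L s ∈ F) ∧
      ∀ f ∈ F, ∀ y, f y = ∑ s, f (z s) * L s y := by
    rintro F rfl
    refine ⟨0, Fin.elim0, Fin.elim0, fun s => s.elim0, fun f hf y => ?_⟩
    rw [(Submodule.mem_bot ℝ).mp hf]; simp
  induction n with
  | zero =>
    intro F hF hn
    exact hbot F (Submodule.finrank_eq_zero.mp (Nat.le_zero.mp hn))
  | succ n ih =>
    intro F hF hn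
    by_cases hFb : F = ⊥
    · exact hbot F hFb
    obtain ⟨g, hg, hg0⟩ := Submodule.exists_mem_ne_zero_of_ne_bot hFb
    obtain ⟨z₀, hz₀⟩ := Function.ne_iff.mp hg0
    rw [Pi.zero_apply] at hz₀
    -- the functions of `F` that vanish at `z₀`
    let F' : Submodule ℝ (Y → ℝ) := F ⊓ LinearMap.ker (LinearMap.proj (R := ℝ) (φ := fun _ => ℝ) z₀)
    have hmem : ∀ f, f ∈ F' ↔ f ∈ F ∧ f z₀ = 0 := fun f => Iff.rfl
    have hlt : F' < F := by
      refine lt_of_le_of_ne inf_le_left fun h => hz₀ ?_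
      exact ((hmem g).mp (h ▸ hg)).2
    have : FiniteDimensional ℝ F' := Submodule.finiteDimensional_of_le hlt.le
    have hfin := Submodule.finrank_lt_finrank_of_lt hlt
    obtain ⟨d, z, L, hL, hrep⟩ := ih F' this (by omega)
    set f₀ : Y → ℝ := (g z₀)⁻¹ • g with hf₀
    have hf₀F : f₀ ∈ F := F.smul_mem _ hg
    have hf₀z : f₀ z₀ = 1 := by simp [hf₀, hz₀]
    refine ⟨d + 1, Fin.cons z₀ z, Fin.cons (f₀ - ∑ s, f₀ (z s) • L s) L, ?_, ?_⟩
    · intro s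
      refine Fin.cases ?_ (fun s => ?_) s
      · rw [Fin.cons_zero]
        exact F.sub_mem hf₀F (F.sum_mem fun s _ => F.smul_mem _ ((hmem _).mp (hL s)).1)
      · rw [Fin.cons_succ]
        exact ((hmem _).mp (hL s)).1
    · intro f hf y
      have h := hrep (f - f z₀ • f₀) ((hmem _).mpr ⟨F.sub_mem hf (F.smul_mem _ hf₀F), by
        simp [hf₀z]⟩) y
      rw [Fin.sum_univ_succ]
      simp only [Fin.cons_zero, Fin.cons_succ, Pi.sub_apply, Pi.smul_apply, smul_eq_mul,
        Finset.sum_apply] at h ⊢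
      simp only [sub_mul, Finset.sum_sub_distrib, mul_assoc, ← Finset.mul_sum] at h
      linear_combination h

/-- In the symmetric case the increment of order `ν` of any `J_μ` with even `μ` is a combination of
the polynomials `J_κ`, `κ ≤ ν` even. -/
theorem JacobiParams.incrJ_mem_span (𝔧 : JacobiParams) (hab : ∀ j, 𝔧.a j = 𝔧.b j)
    (ν μ : EvenIdx) :
    𝔧.incrJ ν μ ∈ Submodule.span ℝ ((fun κ : EvenIdx => 𝔧.J κ) '' (evenBelow ν : Set EvenIdx)) := by
  by_cases hνμ : ν ≤ μ
  swap
  · have : 𝔧.incrJ ν μ = 0 := funext fun y => 𝔧.incrJ_eq_zero hνμ y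
    rw [this]; exact Submodule.zero_mem _
  have hsupp := EvenIdx.support_subset hνμ
  have hex : ∀ i, ∃ c : ℕ → ℝ, chebIncr ((ν : ℕ →₀ ℕ) i) (jacobi (𝔧.a i) (𝔧.b i) ((μ : ℕ →₀ ℕ) i)) =
      ∑ m ∈ Finset.range ((ν : ℕ →₀ ℕ) i / 2 + 1),
        C (c (2 * m)) * jacobi (𝔧.a i) (𝔧.b i) (2 * m) := by
    intro i
    rw [← hab i]
    obtain ⟨r, hr⟩ := ν.2 i
    refine exists_eq_sum_jacobi (𝔧.neg_one_lt_a i) _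
      ((natDegree_chebIncr_le _ _).trans (by omega)) ?_
    exact chebIncr_comp_neg_X _ (jacobi_comp_neg_X _ (μ.2 i))
  choose c hc using hex
  have hfun : 𝔧.incrJ ν μ = ∑ κ ∈ evenBelow ν,
      ((∏ i ∈ (μ : ℕ →₀ ℕ).support \ (ν : ℕ →₀ ℕ).support, c i 0) *
        ∏ i ∈ (ν : ℕ →₀ ℕ).support, c i ((κ : ℕ →₀ ℕ) i)) • 𝔧.J κ := by
    funext y
    rw [𝔧.incrJ_eq_prod subset_rfl hsupp, ← Finset.prod_sdiff hsupp, Finset.sum_apply]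
    have h1 : ∀ i ∈ (μ : ℕ →₀ ℕ).support \ (ν : ℕ →₀ ℕ).support,
        (chebIncr ((ν : ℕ →₀ ℕ) i) (jacobi (𝔧.a i) (𝔧.b i) ((μ : ℕ →₀ ℕ) i))).eval (y i : ℝ) =
          c i 0 := by
      intro i hi
      have h0 := Finsupp.notMem_support_iff.mp (Finset.mem_sdiff.mp hi).2
      rw [hc i, h0]
      simp [jacobi_zero (𝔧.neg_one_lt_a i) (𝔧.neg_one_lt_b i)]
    have h2 : ∏ i ∈ (ν : ℕ →₀ ℕ).support,
        (chebIncr ((ν : ℕ →₀ ℕ) i) (jacobi (𝔧.a i) (𝔧.b i) ((μ : ℕ →₀ ℕ) i))).eval (y i : ℝ) =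
        ∑ κ ∈ evenBelow ν, ∏ i ∈ (ν : ℕ →₀ ℕ).support, c i ((κ : ℕ →₀ ℕ) i) *
          (jacobi (𝔧.a i) (𝔧.b i) ((κ : ℕ →₀ ℕ) i)).eval (y i : ℝ) := by
      rw [sum_evenBelow_prod ν fun i n => c i n * (jacobi (𝔧.a i) (𝔧.b i) n).eval (y i : ℝ)]
      refine Finset.prod_congr rfl fun i _ => ?_
      rw [hc i, eval_finsetSum]
      exact Finset.sum_congr rfl fun m _ => by rw [eval_mul, eval_C]
    rw [Finset.prod_congr rfl h1, h2, Finset.mul_sum]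
    refine Finset.sum_congr rfl fun κ hκ => ?_
    rw [Pi.smul_apply, smul_eq_mul, 𝔧.J_eq_prod (EvenIdx.support_subset (mem_evenBelow.mp hκ)),
      Finset.prod_mul_distrib, mul_assoc]
  rw [hfun]
  exact Submodule.sum_mem _ fun κ hκ => Submodule.smul_mem _ _
    (Submodule.subset_span ⟨κ, hκ, rfl⟩)

section Space

variable {𝕜 X₁ X₂ : Type*} [RCLike 𝕜]
  [NormedAddCommGroup X₁] [InnerProductSpace 𝕜 X₁] [NormedSpace ℝ X₁] [IsScalarTower ℝ 𝕜 X₁]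

/-- Lower sets contain `(k, κ)` together with `(k, ν)`, for all `κ ≤ ν`. -/
theorem mem_approxSpace_of_mem_span (𝔧 : JacobiParams) {V : ℕ → Submodule 𝕜 X₁}
    {G : Set (ℕ × EvenIdx)} (hlow : IsLowerSet G) {k : ℕ} {ν : EvenIdx} (hkν : (k, ν) ∈ G)
    {L : Cube → ℝ}
    (hL : L ∈ Submodule.span ℝ ((fun κ : EvenIdx => 𝔧.J κ) '' (evenBelow ν : Set EvenIdx)))
    {u : X₁} (hu : u ∈ V (2 ^ k)) :
    (fun y => L y • u) ∈ approxSpace 𝔧 V G := by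
  induction hL using Submodule.span_induction with
  | mem f hf =>
    obtain ⟨κ, hκ, rfl⟩ := hf
    exact Submodule.subset_span ⟨(k, κ),
      hlow (show (k, κ) ≤ (k, ν) from ⟨le_rfl, mem_evenBelow.mp hκ⟩) hkν, u, hu, rfl⟩
  | zero =>
    have : (fun y => (0 : Cube → ℝ) y • u) = 0 := by funext y; simp
    rw [this]; exact Submodule.zero_mem _
  | add f g _ _ hf hg =>
    have : (fun y => (f + g) y • u) = (fun y => f y • u) + fun y => g y • u := by
      funext y; simp [add_smul]
    rw [this]; exact Submodule.add_mem _ hf hg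
  | smul c f _ hf =>
    have : (fun y => (c • f) y • u) = (algebraMap ℝ 𝕜 c) • fun y => f y • u := by
      funext y; simp [mul_smul]
    rw [this]; exact Submodule.smul_mem _ _ hf

theorem rank_approxSpace_le (𝔧 : JacobiParams) {V : ℕ → Submodule 𝕜 X₁}
    (hV : ∀ m, Module.rank 𝕜 (V m) ≤ m) (G : Finset (ℕ × EvenIdx)) :
    Module.rank 𝕜 (approxSpace 𝔧 V (G : Set (ℕ × EvenIdx))) ≤
      ((∑ g ∈ G, 2 ^ g.1 : ℕ) : Cardinal) := by
  classical
  let T : EvenIdx → X₁ →ₗ[𝕜] (Cube → X₁) := fun ν =>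
    { toFun := fun w y => 𝔧.J ν y • w
      map_add' := fun w w' => by funext y; simp
      map_smul' := fun c w => by funext y; exact smul_comm (𝔧.J ν y) c w }
  induction G using Finset.induction_on with
  | empty =>
    have : approxSpace 𝔧 V ((∅ : Finset (ℕ × EvenIdx)) : Set (ℕ × EvenIdx)) = ⊥ := by
      rw [approxSpace, Submodule.span_eq_bot]
      rintro f ⟨g, hg, -⟩
      simp at hg
    rw [this]; simp
  | insert g s hg ih =>
    have hle : approxSpace 𝔧 V ((insert g s : Finset (ℕ × EvenIdx)) : Set (ℕ × EvenIdx)) ≤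
        (V (2 ^ g.1)).map (T g.2) ⊔ approxSpace 𝔧 V (s : Set (ℕ × EvenIdx)) := by
      refine Submodule.span_le.mpr ?_
      rintro f ⟨g', hg', w, hw, rfl⟩
      rw [Finset.coe_insert, Set.mem_insert_iff] at hg'
      rcases hg' with rfl | hg'
      · exact Submodule.mem_sup_left ⟨w, hw, rfl⟩
      · exact Submodule.mem_sup_right (Submodule.subset_span ⟨g', hg', w, hw, rfl⟩)
    rw [Finset.sum_insert hg, Nat.cast_add]
    refine (Submodule.rank_mono hle).trans ((Submodule.rank_add_le_rank_add_rank _ _).trans ?_)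
    refine add_le_add ?_ ih
    exact (rank_map_le (T g.2) _).trans (hV _)

variable [NormedAddCommGroup X₂] [InnerProductSpace 𝕜 X₂] [NormedSpace ℝ X₂] [IsScalarTower ℝ 𝕜 X₂]

/-- In the symmetric case the interpolation over a lower set belongs to the approximation space. -/
theorem symInterp_mem_approxSpace {ι : X₂ →L[𝕜] X₁} {V : ℕ → Submodule 𝕜 X₁}
    {P : ℕ → X₁ →ₗ[𝕜] X₁} (hP : ∀ m w, P m w ∈ V m) (𝔧 : JacobiParams)
    (hab : ∀ j, 𝔧.a j = 𝔧.b j) {x : EvenIdx → X₂} {vc : Cube → X₂}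
    (hvc : ∀ y, HasSum (fun μ : EvenIdx => 𝔧.J μ y • x μ) (vc y))
    {G : Set (ℕ × EvenIdx)} (hG : G.Finite) (hlow : IsLowerSet G) :
    symInterp ι P G vc ∈ approxSpace 𝔧 V G := by
  have hsum : symInterp ι P G vc = ∑ g ∈ hG.toFinset,
      fun y => spatialIncr P g.1 (ι (tensorIncr (g.2 : ℕ →₀ ℕ) vc y)) := by
    funext y
    rw [symInterp, finsum_mem_eq_finite_toFinset_sum _ hG, Finset.sum_apply]
  rw [hsum]
  refine Submodule.sum_mem _ fun g hg => ?_
  obtain ⟨k, ν⟩ := g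
  have hkν : (k, ν) ∈ G := hG.mem_toFinset.mp hg
  set F := Submodule.span ℝ ((fun κ : EvenIdx => 𝔧.J κ) '' (evenBelow ν : Set EvenIdx)) with hF
  have hfin : FiniteDimensional ℝ F :=
    FiniteDimensional.span_of_finite ℝ ((evenBelow ν).finite_toSet.image _)
  obtain ⟨d, z, L, hL, hrep⟩ := exists_interpolation_points _ F hfin le_rfl
  have htens : ∀ y, tensorIncr (ν : ℕ →₀ ℕ) vc y =
      ∑ s, L s y • tensorIncr (ν : ℕ →₀ ℕ) vc (z s) := by
    intro y
    have h1 : ∀ y, HasSum (fun μ : EvenIdx => 𝔧.incrJ ν μ y • x μ)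
        (tensorIncr (ν : ℕ →₀ ℕ) vc y) := by
      intro y
      have := tensorIncr_hasSum (ν : ℕ →₀ ℕ) hvc y
      simpa only [𝔧.tensorIncr_J] using this
    refine (h1 y).unique ?_
    have h2 := hasSum_sum (s := Finset.univ) fun s _ => (h1 (z s)).const_smul (L s y)
    convert h2 using 1
    funext μ
    rw [hrep _ (𝔧.incrJ_mem_span hab ν μ) y, Finset.sum_smul]
    exact Finset.sum_congr rfl fun s _ => by rw [smul_smul, mul_comm]
  have hfun : (fun y => spatialIncr P k (ι (tensorIncr (ν : ℕ →₀ ℕ) vc y))) =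
      ∑ s, fun y => L s y • spatialIncr P k (ι (tensorIncr (ν : ℕ →₀ ℕ) vc (z s))) := by
    funext y
    have hs : ∀ (c : ℝ) (w : X₂), spatialIncr P k (ι (c • w)) = c • spatialIncr P k (ι w) :=
      fun c w => ((spatialIncr P k).comp (ι : X₂ →ₗ[𝕜] X₁)).map_smul_of_tower c w
    rw [htens y, map_sum, map_sum, Finset.sum_apply]
    exact Finset.sum_congr rfl fun s _ => hs _ _
  change (fun y => spatialIncr P k (ι (tensorIncr (ν : ℕ →₀ ℕ) vc y))) ∈ _
  rw [hfun]
  refine Submodule.sum_mem _ fun s _ => ?_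
  -- `δ_k` takes its values in `V_{2^k} + V_{2^(k-1)}`, and `G` is a lower set in `k`, too
  cases k with
  | zero => exact mem_approxSpace_of_mem_span 𝔧 hlow hkν (hL s) (hP 1 _)
  | succ k =>
    have hk' : (k, ν) ∈ G := hlow (show (k, ν) ≤ (k + 1, ν) from ⟨Nat.le_succ k, le_rfl⟩) hkν
    simp only [spatialIncr, LinearMap.sub_apply, smul_sub]
    exact Submodule.sub_mem _ (mem_approxSpace_of_mem_span 𝔧 hlow hkν (hL s) (hP _ _))
      (mem_approxSpace_of_mem_span 𝔧 hlow hk' (hL s) (hP _ _))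

end Space

/-! ### Weighted summability -/

theorem one_le_weight {θ lam : ℝ} (hθ : 0 ≤ θ) (hlam : 0 ≤ lam) (ν : ℕ →₀ ℕ) :
    1 ≤ weight θ lam ν := by
  have h := Finset.prod_le_prod (s := ν.support) (f := fun _ => (1 : ℝ))
    (g := fun i => (1 + lam * (ν i : ℝ)) ^ θ) (fun _ _ => zero_le_one) fun i _ => by
      have : 0 ≤ lam * (ν i : ℝ) := by positivity
      exact Real.one_le_rpow (by linarith) hθ
  rwa [Finset.prod_const_one] at h

section Weighted

variable {θ lam q : ℝ} {σ x : EvenIdx → ℝ}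

theorem WeightedSummable.pos (h : WeightedSummable θ lam q σ x) (ν : EvenIdx) : 0 < σ ν :=
  one_pos.trans (h.one_lt ν)

theorem WeightedSummable.summable_sq_mul_rpow (h : WeightedSummable θ lam q σ x) (hθ : 0 ≤ θ)
    (hlam : 0 ≤ lam) (hq : 0 < q) :
    Summable fun ν : EvenIdx => weight θ lam ν ^ 2 * σ ν ^ (-q) := by
  refine h.memℓq.congr fun ν => ?_
  have hw : 0 < weight θ lam (ν : ℕ →₀ ℕ) := one_pos.trans_le (one_le_weight hθ hlam _)
  rw [Real.mul_rpow (by positivity) (inv_nonneg.mpr (h.pos ν).le), ← Real.rpow_mul hw.le,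
    div_mul_cancel₀ _ hq.ne', Real.inv_rpow (h.pos ν).le, ← Real.rpow_neg (h.pos ν).le]
  norm_cast

theorem WeightedSummable.summable_rpow (h : WeightedSummable θ lam q σ x) (hθ : 0 ≤ θ)
    (hlam : 0 ≤ lam) (hq : 0 < q) : Summable fun ν : EvenIdx => σ ν ^ (-q) := by
  refine (h.summable_sq_mul_rpow hθ hlam hq).of_nonneg_of_le
    (fun ν => Real.rpow_nonneg (h.pos ν).le _) fun ν => ?_
  refine le_mul_of_one_le_left (Real.rpow_nonneg (h.pos ν).le _) ?_
  exact one_le_pow₀ (one_le_weight hθ hlam _)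

/-- The sum behind all error bounds: by `2ab ≤ a² + b²` it is controlled by the two conditions of
`WeightedSummable`. -/
theorem WeightedSummable.summable_rpow_mul (h : WeightedSummable θ lam q σ x) (hθ : 0 ≤ θ)
    (hlam : 0 ≤ lam) (hq : 0 < q) (hx : ∀ ν, 0 ≤ x ν) :
    Summable fun ν : EvenIdx => σ ν ^ (1 - q / 2) * (weight θ lam ν * x ν) := by
  have hw : ∀ ν : EvenIdx, 0 < weight θ lam (ν : ℕ →₀ ℕ) :=
    fun ν => one_pos.trans_le (one_le_weight hθ hlam _)
  refine (h.summable.add (h.summable_sq_mul_rpow hθ hlam hq)).of_nonneg_of_le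
    (fun ν => mul_nonneg (Real.rpow_nonneg (h.pos ν).le _) (mul_nonneg (hw ν).le (hx ν)))
    fun ν => ?_
  have hσ := h.pos ν
  have e1 : σ ν ^ (1 - q / 2) = σ ν * σ ν ^ (-(q / 2)) := by
    rw [sub_eq_add_neg, Real.rpow_add hσ, Real.rpow_one]
  have e2 : σ ν ^ (-q) = (σ ν ^ (-(q / 2))) ^ 2 := by
    rw [← Real.rpow_natCast, ← Real.rpow_mul hσ.le]; congr 1; push_cast; ring
  rw [e1, e2]
  nlinarith [sq_nonneg (σ ν * x ν - weight θ lam ν * σ ν ^ (-(q / 2))),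
    sq_nonneg (σ ν * x ν), sq_nonneg (weight θ lam ν * σ ν ^ (-(q / 2)))]

theorem WeightedSummable.summable_mul (h : WeightedSummable θ lam q σ x) (hθ : 0 ≤ θ)
    (hlam : 0 ≤ lam) (hq : 0 < q) (hq2 : q < 2) (hx : ∀ ν, 0 ≤ x ν) :
    Summable fun ν : EvenIdx => weight θ lam ν * x ν := by
  have hw : ∀ ν : EvenIdx, 0 < weight θ lam (ν : ℕ →₀ ℕ) :=
    fun ν => one_pos.trans_le (one_le_weight hθ hlam _)
  refine (h.summable_rpow_mul hθ hlam hq hx).of_nonneg_of_le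
    (fun ν => mul_nonneg (hw ν).le (hx ν)) fun ν => ?_
  exact le_mul_of_one_le_left (mul_nonneg (hw ν).le (hx ν))
    (Real.one_le_rpow (h.one_lt ν).le (by linarith))

end Weighted

theorem finite_rpow_le {σ : EvenIdx → ℝ} {q : ℝ} (hσ : ∀ ν, 0 < σ ν)
    (hs : Summable fun ν => σ ν ^ (-q)) (T : ℝ) : {ν | σ ν ^ q ≤ T}.Finite := by
  rcases le_or_gt T 0 with hT | hT
  · refine Set.Finite.subset Set.finite_empty fun ν hν => ?_
    have : 0 < σ ν ^ q := Real.rpow_pos_of_pos (hσ ν) _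
    exact absurd (hν.trans hT) (not_le.mpr this)
  · have h := hs.tendsto_cofinite_zero.eventually_lt_const (inv_pos.mpr hT)
    refine Set.Finite.subset (Filter.eventually_cofinite.mp h) fun ν hν => ?_
    have hpos : 0 < σ ν ^ q := Real.rpow_pos_of_pos (hσ ν) _
    change ¬(σ ν ^ (-q) < T⁻¹)
    rw [not_lt, Real.rpow_neg (hσ ν).le]
    exact inv_anti₀ hpos hν

/-! ### Sums of the dimensions -/

theorem sum_two_pow_le (F : Finset ℕ) {Z : ℝ} (hZ : 0 ≤ Z) (h : ∀ k ∈ F, (2 : ℝ) ^ k ≤ Z) :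
    ∑ k ∈ F, (2 : ℝ) ^ k ≤ 2 * Z := by
  rcases F.eq_empty_or_nonempty with rfl | hF
  · simpa using hZ
  · have hsub : F ⊆ Finset.range (F.max' hF + 1) := fun k hk =>
      Finset.mem_range.mpr (Nat.lt_succ_of_le (F.le_max' k hk))
    calc ∑ k ∈ F, (2 : ℝ) ^ k ≤ ∑ k ∈ Finset.range (F.max' hF + 1), (2 : ℝ) ^ k :=
          Finset.sum_le_sum_of_subset_of_nonneg hsub fun _ _ _ => by positivity
      _ = 2 ^ (F.max' hF + 1) - 1 := by rw [geom_sum_eq (by norm_num)]; norm_num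
      _ ≤ 2 * 2 ^ F.max' hF := by rw [pow_succ]; linarith
      _ ≤ 2 * Z := by gcongr; exact h _ (F.max'_mem hF)

open Classical in
theorem sum_two_pow_fst_le (G : Finset (ℕ × EvenIdx)) {Z : EvenIdx → ℝ} (hZ : ∀ ν, 0 ≤ Z ν)
    (h : ∀ g ∈ G, (2 : ℝ) ^ g.1 ≤ Z g.2) :
    ∑ g ∈ G, (2 : ℝ) ^ g.1 ≤ 2 * ∑ ν ∈ G.image Prod.snd, Z ν := by
  rw [← Finset.sum_fiberwise_of_maps_to (t := G.image Prod.snd) (g := Prod.snd)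
    fun g hg => Finset.mem_image_of_mem _ hg, Finset.mul_sum]
  refine Finset.sum_le_sum fun ν _ => ?_
  have hinj : Set.InjOn Prod.fst ((G.filter fun g => g.2 = ν : Finset _) : Set (ℕ × EvenIdx)) := by
    intro g hg g' hg' hh
    rw [Finset.coe_filter] at hg hg'
    exact Prod.ext hh (hg.2.trans hg'.2.symm)
  rw [← Finset.sum_image (f := fun k => (2 : ℝ) ^ k) hinj]
  refine sum_two_pow_le _ (hZ ν) fun k hk => ?_
  obtain ⟨g, hg, rfl⟩ := Finset.mem_image.mp hk
  obtain ⟨hg1, rfl⟩ := Finset.mem_filter.mp hg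
  exact h g hg1

/-! ### Thresholding by one weight -/

section OneWeight

variable {q ξ : ℝ} {σ : EvenIdx → ℝ}

theorem finite_threshold₁ (hσ : ∀ ν, 1 < σ ν) (hq : 0 < q) (hs : Summable fun ν => σ ν ^ (-q))
    (ξ : ℝ) : {g : ℕ × EvenIdx | (2 : ℝ) ^ g.1 * σ g.2 ^ q ≤ ξ}.Finite := by
  refine ((Set.finite_Iic ⌊ξ⌋₊).prod
    (finite_rpow_le (fun ν => one_pos.trans (hσ ν)) hs ξ)).subset ?_
  rintro ⟨k, ν⟩ h
  change (2 : ℝ) ^ k * σ ν ^ q ≤ ξ at h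
  have h1 : 1 ≤ σ ν ^ q := Real.one_le_rpow (hσ ν).le hq.le
  have h2 : (1 : ℝ) ≤ 2 ^ k := one_le_pow₀ (by norm_num)
  have h3 : (k : ℝ) ≤ 2 ^ k := by exact_mod_cast Nat.lt_two_pow_self.le
  refine ⟨Set.mem_Iic.mpr (Nat.le_floor ?_), ?_⟩
  · nlinarith
  · change σ ν ^ q ≤ ξ
    nlinarith

theorem isLowerSet_threshold₁ (hσ : ∀ ν, 1 < σ ν) (hmono : Monotone σ) (hq : 0 < q) (ξ : ℝ) :
    IsLowerSet {g : ℕ × EvenIdx | (2 : ℝ) ^ g.1 * σ g.2 ^ q ≤ ξ} := by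
  rintro ⟨k, ν⟩ ⟨k', ν'⟩ ⟨hk, hν⟩ h
  change (2 : ℝ) ^ k * σ ν ^ q ≤ ξ at h
  change (2 : ℝ) ^ k' * σ ν' ^ q ≤ ξ
  refine le_trans ?_ h
  have := one_pos.trans (hσ ν')
  have := hmono hν
  have hk' : k' ≤ k := hk
  dsimp only at *
  gcongr
  norm_num

/-- In direction `ν` the threshold allows `2^k ≤ ξ σ_ν^(-q)`. -/
theorem sum_threshold₁_le (hσ : ∀ ν, 1 < σ ν) (hs : Summable fun ν => σ ν ^ (-q))
    (hξ : 0 ≤ ξ) (G : Finset (ℕ × EvenIdx)) (hG : ∀ g ∈ G, (2 : ℝ) ^ g.1 * σ g.2 ^ q ≤ ξ) :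
    ∑ g ∈ G, (2 : ℝ) ^ g.1 ≤ 2 * (∑' ν, σ ν ^ (-q)) * ξ := by
  classical
  have hpos : ∀ ν, 0 < σ ν := fun ν => one_pos.trans (hσ ν)
  have hnn : ∀ ν, 0 ≤ σ ν ^ (-q) := fun ν => Real.rpow_nonneg (hpos ν).le _
  refine (sum_two_pow_fst_le G (Z := fun ν => ξ * σ ν ^ (-q))
    (fun ν => mul_nonneg hξ (hnn ν)) fun g hg => ?_).trans ?_
  · rw [Real.rpow_neg (hpos _).le, ← div_eq_mul_inv, le_div_iff₀ (Real.rpow_pos_of_pos (hpos _) _)]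
    exact hG g hg
  · rw [← Finset.mul_sum]
    have := hs.sum_le_tsum (G.image Prod.snd) fun ν _ => hnn ν
    nlinarith

/-- If `(κ, ν)` violates the one-weight threshold, then `2^(-ακ)` is small compared with a power of
`s = σ_ν`; the exponent `q α ≤ 1 - q / 2` is where `α ≤ 1 / q - 1 / 2` is needed. -/
theorem pow_le_of_threshold₁ {α : ℝ} (hα : 0 < α) (hq : 0 < q) (hαq : α ≤ 1 / q - 1 / 2)
    (hξ : 0 < ξ) {s : ℝ} (hs : 1 < s) {κ : ℕ} (h : ξ < (2 : ℝ) ^ κ * s ^ q) :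
    ((2 : ℝ) ^ (-α)) ^ κ ≤ ξ ^ (-α) * s ^ (1 - q / 2) := by
  have hs0 : 0 < s := one_pos.trans hs
  have hsq : 0 < s ^ q := Real.rpow_pos_of_pos hs0 _
  have e : ((2 : ℝ) ^ (-α)) ^ κ = ((2 : ℝ) ^ κ) ^ (-α) := by
    rw [← Real.rpow_natCast, ← Real.rpow_natCast, ← Real.rpow_mul (by norm_num),
      ← Real.rpow_mul (by norm_num), mul_comm]
  have h1 : ξ / s ^ q ≤ (2 : ℝ) ^ κ := by rw [div_le_iff₀ hsq]; exact h.le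
  have hexp : q * α ≤ 1 - q / 2 := by
    have := mul_le_mul_of_nonneg_left hαq hq.le
    rw [mul_sub, mul_one_div_cancel hq.ne'] at this
    linarith
  calc ((2 : ℝ) ^ (-α)) ^ κ = ((2 : ℝ) ^ κ) ^ (-α) := e
    _ ≤ (ξ / s ^ q) ^ (-α) := Real.rpow_le_rpow_of_nonpos (by positivity) h1 (by linarith)
    _ = ξ ^ (-α) * s ^ (q * α) := by
        rw [Real.div_rpow hξ.le hsq.le, ← Real.rpow_mul hs0.le, div_eq_mul_inv,
          ← Real.rpow_neg hs0.le]
        congr 2; ring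
    _ ≤ ξ ^ (-α) * s ^ (1 - q / 2) := by
        gcongr
        exact hs.le

end OneWeight

/-! ### Thresholding by two weights -/

section TwoWeights

variable {q₁ q₂ τ T Z : ℝ} {σ₁ σ₂ : EvenIdx → ℝ}

theorem fst_le_of_threshold₂ (hσ₂ : ∀ ν, 1 < σ₂ ν) (hτ : 0 < τ) {k : ℕ} {ν : EvenIdx}
    (h : (2 : ℝ) ^ (τ * k) * σ₂ ν ≤ Z) : (k : ℝ) ≤ Real.log Z / (τ * Real.log 2) := by
  have h2 : (0 : ℝ) < 2 ^ (τ * (k : ℝ)) := by positivity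
  have h1 : (2 : ℝ) ^ (τ * k) ≤ Z := le_trans (le_mul_of_one_le_right h2.le (hσ₂ ν).le) h
  have h3 := Real.log_le_log h2 h1
  rw [Real.log_rpow (by norm_num)] at h3
  have hl : 0 < Real.log 2 := Real.log_pos (by norm_num)
  rw [le_div_iff₀ (by positivity)]
  linarith

theorem finite_threshold₂ (hσ₁ : ∀ ν, 1 < σ₁ ν) (hσ₂ : ∀ ν, 1 < σ₂ ν) (hτ : 0 < τ)
    (hs : Summable fun ν => σ₁ ν ^ (-q₁)) (T Z : ℝ) :
    {g : ℕ × EvenIdx | σ₁ g.2 ^ q₁ ≤ T ∧ (2 : ℝ) ^ (τ * g.1) * σ₂ g.2 ≤ Z}.Finite := by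
  refine ((Set.finite_Iic ⌊Real.log Z / (τ * Real.log 2)⌋₊).prod
    (finite_rpow_le (fun ν => one_pos.trans (hσ₁ ν)) hs T)).subset ?_
  rintro ⟨k, ν⟩ ⟨h1, h2⟩
  exact ⟨Set.mem_Iic.mpr (Nat.le_floor (fst_le_of_threshold₂ hσ₂ hτ h2)), h1⟩

theorem isLowerSet_threshold₂ (hσ₁ : ∀ ν, 1 < σ₁ ν) (hσ₂ : ∀ ν, 1 < σ₂ ν)
    (hm₁ : Monotone σ₁) (hm₂ : Monotone σ₂) (hq₁ : 0 < q₁) (hτ : 0 < τ) (T Z : ℝ) :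
    IsLowerSet {g : ℕ × EvenIdx | σ₁ g.2 ^ q₁ ≤ T ∧ (2 : ℝ) ^ (τ * g.1) * σ₂ g.2 ≤ Z} := by
  rintro ⟨k, ν⟩ ⟨k', ν'⟩ ⟨hk, hν⟩ ⟨h1, h2⟩
  have := one_pos.trans (hσ₁ ν')
  have := one_pos.trans (hσ₂ ν')
  have hA := hm₁ hν
  have hB := hm₂ hν
  have hk' : (k' : ℝ) ≤ k := by exact_mod_cast hk
  dsimp only at *
  refine ⟨le_trans ?_ h1, le_trans ?_ h2⟩
  · dsimp only; gcongr
  · dsimp only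
    gcongr
    norm_num

/-- The sum of the dimensions for the two-weight threshold. It interpolates between the number of
indices with `σ₁ ^ q₁ ≤ T`, which is `O(T)`, and the finite sum of `σ₂ ^ (-q₂)`. -/
theorem sum_threshold₂_le (hσ₁ : ∀ ν, 1 < σ₁ ν) (hσ₂ : ∀ ν, 1 < σ₂ ν) (hτ : 0 < τ)
    (hq₂ : 0 < q₂) (hτq : 1 ≤ τ * q₂)
    (hs₁ : Summable fun ν => σ₁ ν ^ (-q₁)) (hs₂ : Summable fun ν => σ₂ ν ^ (-q₂))
    (hT : 0 < T) (hZ : 0 < Z) (G : Finset (ℕ × EvenIdx))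
    (hG : ∀ g ∈ G, σ₁ g.2 ^ q₁ ≤ T ∧ (2 : ℝ) ^ (τ * g.1) * σ₂ g.2 ≤ Z) :
    ∑ g ∈ G, (2 : ℝ) ^ g.1 ≤
      2 * (∑' ν, σ₁ ν ^ (-q₁) + ∑' ν, σ₂ ν ^ (-q₂)) *
        (Z ^ (1 / τ) * T ^ (1 - 1 / (τ * q₂))) := by
  classical
  have hpos₁ : ∀ ν, 0 < σ₁ ν := fun ν => one_pos.trans (hσ₁ ν)
  have hpos₂ : ∀ ν, 0 < σ₂ ν := fun ν => one_pos.trans (hσ₂ ν)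
  have hnn₁ : ∀ ν, 0 ≤ σ₁ ν ^ (-q₁) := fun ν => Real.rpow_nonneg (hpos₁ ν).le _
  have hnn₂ : ∀ ν, 0 ≤ σ₂ ν ^ (-q₂) := fun ν => Real.rpow_nonneg (hpos₂ ν).le _
  set s := 1 / (τ * q₂) with hs
  have hs0 : 0 ≤ s := by positivity
  have hs1 : s ≤ 1 := by rw [hs]; exact (div_le_one (by positivity)).mpr hτq
  refine (sum_two_pow_fst_le G (Z := fun ν => Z ^ (1 / τ) * σ₂ ν ^ (-(1 / τ)))
    (fun ν => mul_nonneg (Real.rpow_nonneg hZ.le _) (Real.rpow_nonneg (hpos₂ ν).le _))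
    fun g hg => ?_).trans ?_
  · have h2 := (hG g hg).2
    have h3 : (2 : ℝ) ^ (τ * g.1) ≤ Z / σ₂ g.2 := (le_div_iff₀ (hpos₂ _)).mpr h2
    have h4 := Real.rpow_le_rpow (by positivity) h3 (by positivity : 0 ≤ 1 / τ)
    rw [← Real.rpow_mul (by norm_num), Real.div_rpow hZ.le (hpos₂ _).le] at h4
    have e : τ * (g.1 : ℝ) * (1 / τ) = g.1 := by field_simp
    rw [e, Real.rpow_natCast] at h4
    rw [Real.rpow_neg (hpos₂ _).le, ← div_eq_mul_inv]
    exact h4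
  · have hterm : ∀ ν ∈ G.image Prod.snd, σ₂ ν ^ (-(1 / τ)) ≤
        T ^ (1 - s) * (σ₁ ν ^ (-q₁) + σ₂ ν ^ (-q₂)) := by
      intro ν hν
      obtain ⟨g, hg, rfl⟩ := Finset.mem_image.mp hν
      have h1 := (hG g hg).1
      set u := σ₂ g.2 ^ (-q₂) with hu
      have hu0 : 0 < u := Real.rpow_pos_of_pos (hpos₂ _) _
      have e1 : σ₂ g.2 ^ (-(1 / τ)) = u ^ s := by
        rw [hu, ← Real.rpow_mul (hpos₂ _).le, hs]
        congr 1; field_simp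
      -- `(uT)^s ≤ 1 + uT`, as `0 ≤ s ≤ 1`
      have e2 : (u * T) ^ s ≤ 1 + u * T := by
        have huT : 0 < u * T := by positivity
        rcases le_total (u * T) 1 with h | h
        · linarith [Real.rpow_le_one huT.le h hs0]
        · linarith [Real.rpow_le_self_of_one_le h hs1]
      have e3 : 1 ≤ T * σ₁ g.2 ^ (-q₁) := by
        rw [Real.rpow_neg (hpos₁ _).le, ← div_eq_mul_inv,
          one_le_div (Real.rpow_pos_of_pos (hpos₁ _) _)]
        exact h1
      rw [Real.mul_rpow hu0.le hT.le] at e2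
      have hTs : 0 < T ^ s := Real.rpow_pos_of_pos hT _
      rw [e1, Real.rpow_sub hT, Real.rpow_one, div_mul_eq_mul_div, le_div_iff₀ hTs]
      linarith
    have hsum := Finset.sum_le_sum hterm
    rw [← Finset.mul_sum, Finset.sum_add_distrib] at hsum
    have h1 := hs₁.sum_le_tsum (G.image Prod.snd) fun ν _ => hnn₁ ν
    have h2 := hs₂.sum_le_tsum (G.image Prod.snd) fun ν _ => hnn₂ ν
    have hTs : 0 ≤ T ^ (1 - s) := Real.rpow_nonneg hT.le _
    have hZs : 0 ≤ Z ^ (1 / τ) := Real.rpow_nonneg hZ.le _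
    rw [← Finset.mul_sum]
    calc _ ≤ 2 * (Z ^ (1 / τ) * (T ^ (1 - s) * (∑' ν, σ₁ ν ^ (-q₁) + ∑' ν, σ₂ ν ^ (-q₂)))) := by
          gcongr
          exact hsum.trans (by gcongr)
      _ = _ := by ring

/-- If `(κ, ν)` violates the second condition of the two-weight threshold, then `2^(-ακ)` is small
compared with a power of `s = σ₂_ν`. -/
theorem pow_le_of_threshold₂ {α : ℝ} (hα : 0 < α) (hτ : 0 < τ) (hZ : 0 < Z) {s : ℝ} (hs : 0 < s)
    {κ : ℕ} (h : Z < (2 : ℝ) ^ (τ * κ) * s) :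
    ((2 : ℝ) ^ (-α)) ^ κ ≤ Z ^ (-(α / τ)) * s ^ (α / τ) := by
  have e : ((2 : ℝ) ^ (-α)) ^ κ = ((2 : ℝ) ^ (τ * κ)) ^ (-(α / τ)) := by
    rw [← Real.rpow_natCast, ← Real.rpow_mul (by norm_num), ← Real.rpow_mul (by norm_num)]
    congr 1; field_simp
  have h1 : Z / s ≤ (2 : ℝ) ^ (τ * κ) := by rw [div_le_iff₀ hs]; exact h.le
  calc ((2 : ℝ) ^ (-α)) ^ κ = ((2 : ℝ) ^ (τ * κ)) ^ (-(α / τ)) := e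
    _ ≤ (Z / s) ^ (-(α / τ)) := by
        have : 0 < α / τ := by positivity
        exact Real.rpow_le_rpow_of_nonpos (by positivity) h1 (by linarith)
    _ = Z ^ (-(α / τ)) * s ^ (α / τ) := by
        rw [Real.div_rpow hZ.le hs.le, div_eq_mul_inv, ← Real.rpow_neg hs.le, neg_neg]

end TwoWeights

/-! ### Error bounds for the thresholded index sets -/

section Error

variable {𝕜 X₁ X₂ : Type*} [RCLike 𝕜]
  [NormedAddCommGroup X₁] [InnerProductSpace 𝕜 X₁] [NormedSpace ℝ X₁] [IsScalarTower ℝ 𝕜 X₁]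
  [NormedAddCommGroup X₂] [InnerProductSpace 𝕜 X₂] [NormedSpace ℝ X₂] [IsScalarTower ℝ 𝕜 X₂]
  {ι : X₂ →L[𝕜] X₁} {V : ℕ → Submodule 𝕜 X₁} {P : ℕ → X₁ →ₗ[𝕜] X₁} {α : ℝ}
  {x : EvenIdx → X₂} {vc : Cube → X₂} {θ lam : ℝ}

theorem two_rpow_neg_lt_one (hα : 0 < α) : (2 : ℝ) ^ (-α) < 1 :=
  Real.rpow_lt_one_of_one_lt_of_neg (by norm_num) (by linarith)

theorem exists_first_missing_level {G : Set (ℕ × EvenIdx)} {K : ℕ} (hK : ∀ g ∈ G, g.1 < K)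
    (μ : EvenIdx) :
    ∃ κ : ℕ, (∀ k < κ, (k, μ) ∈ G) ∧ (κ, μ) ∉ G := by
  classical
  have hex : ∃ k, (k, μ) ∉ G := ⟨K, fun h => lt_irrefl _ (hK _ h)⟩
  exact ⟨Nat.find hex, fun k hk => not_not.mp (Nat.find_min hex hk), Nat.find_spec hex⟩

/-- The size of `v` itself, as the error over the empty index set. -/
theorem norm_sub_symInterp_empty_le (hP : SpatialApprox ι V P α) (hα : 0 < α) (𝔧 : JacobiParams)
    (hp : ∀ μ y, ∑ ν ∈ evenBelow μ, |𝔧.incrJ ν μ y| ≤ weight θ lam μ)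
    (hvc : ∀ y, HasSum (fun μ : EvenIdx => 𝔧.J μ y • x μ) (vc y))
    (hsum : Summable fun μ : EvenIdx => weight θ lam μ * ‖ι (x μ)‖) {G : Set (ℕ × EvenIdx)}
    (hG : G = ∅) (y : Cube) :
    ‖ι (vc y) - symInterp ι P G vc y‖ ≤ ∑' μ : EvenIdx, weight θ lam μ * ‖ι (x μ)‖ := by
  subst hG
  obtain ⟨A, hA, h1, h2, h3⟩ := hP.exists_bound
  exact norm_sub_symInterp_le hP 𝔧 hA (by positivity) (two_rpow_neg_lt_one hα) h1 h2 h3 hp hvc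
    Set.finite_empty isLowerSet_empty (K := 0) (by simp) hsum.hasSum (fun μ => Or.inr (by simp)) y

/-- The error of the one-weight threshold. In each direction `μ`, consistency is used up to the
first level outside the index set. -/
theorem exists_error_threshold₁ (hP : SpatialApprox ι V P α) (hα : 0 < α) (𝔧 : JacobiParams)
    (hp : ∀ μ y, ∑ ν ∈ evenBelow μ, |𝔧.incrJ ν μ y| ≤ weight θ lam μ)
    (hvc : ∀ y, HasSum (fun μ : EvenIdx => 𝔧.J μ y • x μ) (vc y))
    (hθ : 0 ≤ θ) (hlam : 0 ≤ lam) {q : ℝ} (hq : 0 < q) (hαq : α ≤ 1 / q - 1 / 2)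
    {σ : EvenIdx → ℝ} (hσ : WeightedSummable θ lam q σ fun ν => ‖x ν‖) :
    ∃ B, 0 ≤ B ∧ ∀ ξ, 0 < ξ → ∀ y,
      ‖ι (vc y) - symInterp ι P {g | (2 : ℝ) ^ g.1 * σ g.2 ^ q ≤ ξ} vc y‖ ≤ B * ξ ^ (-α) := by
  obtain ⟨A, hA, h1, h2, h3⟩ := hP.exists_bound
  set r : ℝ := (2 : ℝ) ^ (-α) with hr
  have hr0 : 0 < r := by positivity
  have hr1 : r < 1 := two_rpow_neg_lt_one hα
  have hr1' : 0 < 1 - r := by linarith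
  have hs := hσ.summable_rpow_mul hθ hlam hq fun ν => norm_nonneg (x ν)
  set A' := A * (1 + (1 - r)⁻¹) with hA'
  have hA'0 : 0 ≤ A' := by positivity
  have hw : ∀ ν : EvenIdx, 0 < weight θ lam (ν : ℕ →₀ ℕ) :=
    fun ν => one_pos.trans_le (one_le_weight hθ hlam _)
  refine ⟨A' * ∑' ν : EvenIdx, σ ν ^ (1 - q / 2) * (weight θ lam ν * ‖x ν‖),
    mul_nonneg hA'0 (tsum_nonneg fun ν => mul_nonneg (Real.rpow_nonneg (hσ.pos ν).le _)
      (mul_nonneg (hw ν).le (norm_nonneg _))), fun ξ hξ y => ?_⟩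
  have hfin := finite_threshold₁ hσ.one_lt hq (hσ.summable_rpow hθ hlam hq) ξ
  obtain ⟨K, hK⟩ : ∃ K : ℕ, ∀ g ∈ {g : ℕ × EvenIdx | (2 : ℝ) ^ g.1 * σ g.2 ^ q ≤ ξ}, g.1 < K := by
    obtain ⟨K, hK⟩ := (hfin.image Prod.fst).bddAbove
    exact ⟨K + 1, fun g hg => Nat.lt_succ_of_le (hK ⟨g, hg, rfl⟩)⟩
  refine (norm_sub_symInterp_le hP 𝔧 hA hr0 hr1 h1 h2 h3 hp hvc hfin
    (isLowerSet_threshold₁ hσ.one_lt hσ.mono hq ξ) hK (hs.hasSum.mul_left (A' * ξ ^ (-α)))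
    (fun μ => Or.inl ?_) y).trans_eq (by ring)
  obtain ⟨κ, hκ, hκ'⟩ := exists_first_missing_level hK μ
  refine ⟨κ, hκ, ?_⟩
  have hdecay := pow_le_of_threshold₁ hα hq hαq hξ (hσ.one_lt μ) (not_le.mp hκ')
  rw [← hr] at hdecay
  have hnn : 0 ≤ weight θ lam μ * ‖x μ‖ := mul_nonneg (hw μ).le (norm_nonneg _)
  calc A' * r ^ κ * (weight θ lam μ * ‖x μ‖)
      ≤ A' * (ξ ^ (-α) * σ μ ^ (1 - q / 2)) * (weight θ lam μ * ‖x μ‖) := by gcongr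
    _ = _ := by ring

/-- The error of the two-weight threshold with bounds `ξ (log ξ)^(1/ρ)` and `ξ^ϑ`. Indices with
large `σ₁` only allow stability, which costs a factor `log ξ`, the number of increments in space;
the factor `(log ξ)^(1/ρ)` in the first bound compensates for it. -/
theorem exists_error_threshold₂ (hP : SpatialApprox ι V P α) (hα : 0 < α) (𝔧 : JacobiParams)
    (hp : ∀ μ y, ∑ ν ∈ evenBelow μ, |𝔧.incrJ ν μ y| ≤ weight θ lam μ)
    (hvc : ∀ y, HasSum (fun μ : EvenIdx => 𝔧.J μ y • x μ) (vc y))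
    (hθ : 0 ≤ θ) (hlam : 0 ≤ lam) {q₁ q₂ τ ϑ ρ : ℝ} (hq₁ : 0 < q₁) (hq₂ : 0 < q₂) (hτ : 0 < τ)
    (hϑ : 0 < ϑ) (hρ : 0 < ρ) (hρq : q₁ * ρ = 1 - q₁ / 2) (hατ : α / τ = 1 - q₂ / 2)
    (hϑρ : ϑ * (α / τ) = ρ) {σ₁ σ₂ : EvenIdx → ℝ}
    (hσ₁ : WeightedSummable θ lam q₁ σ₁ fun ν => ‖ι (x ν)‖)
    (hσ₂ : WeightedSummable θ lam q₂ σ₂ fun ν => ‖x ν‖) :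
    ∃ B, 0 ≤ B ∧ ∀ ξ, Real.exp 1 ≤ ξ → ∀ y,
      ‖ι (vc y) - symInterp ι P {g | σ₁ g.2 ^ q₁ ≤ ξ * Real.log ξ ^ ρ⁻¹ ∧
        (2 : ℝ) ^ (τ * g.1) * σ₂ g.2 ≤ ξ ^ ϑ} vc y‖ ≤ B * ξ ^ (-ρ) := by
  obtain ⟨A, hA, h1, h2, h3⟩ := hP.exists_bound
  set r : ℝ := (2 : ℝ) ^ (-α) with hr
  have hr0 : 0 < r := by positivity
  have hr1 : r < 1 := two_rpow_neg_lt_one hα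
  have hr1' : 0 < 1 - r := by linarith
  have hs₁ := hσ₁.summable_rpow_mul hθ hlam hq₁ fun ν => norm_nonneg (ι (x ν))
  have hs₂ := hσ₂.summable_rpow_mul hθ hlam hq₂ fun ν => norm_nonneg (x ν)
  set A' := A * (1 + (1 - r)⁻¹) with hA'
  have hA'0 : 0 ≤ A' := by positivity
  have hw : ∀ ν : EvenIdx, 0 < weight θ lam (ν : ℕ →₀ ℕ) :=
    fun ν => one_pos.trans_le (one_le_weight hθ hlam _)
  have hl2 : 0 < Real.log 2 := Real.log_pos (by norm_num)
  -- `c log ξ` bounds the cost of stability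
  set c := 1 + A * (ϑ / (τ * Real.log 2) + 1) with hc
  have hc0 : 0 ≤ c := by positivity
  have hnn₁ : ∀ ν : EvenIdx, 0 ≤ σ₁ ν ^ (1 - q₁ / 2) * (weight θ lam ν * ‖ι (x ν)‖) := fun ν =>
    mul_nonneg (Real.rpow_nonneg (hσ₁.pos ν).le _) (mul_nonneg (hw ν).le (norm_nonneg _))
  have hnn₂ : ∀ ν : EvenIdx, 0 ≤ σ₂ ν ^ (1 - q₂ / 2) * (weight θ lam ν * ‖x ν‖) := fun ν =>
    mul_nonneg (Real.rpow_nonneg (hσ₂.pos ν).le _) (mul_nonneg (hw ν).le (norm_nonneg _))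
  refine ⟨A' * (∑' ν : EvenIdx, σ₂ ν ^ (1 - q₂ / 2) * (weight θ lam ν * ‖x ν‖)) +
    c * ∑' ν : EvenIdx, σ₁ ν ^ (1 - q₁ / 2) * (weight θ lam ν * ‖ι (x ν)‖),
    add_nonneg (mul_nonneg hA'0 (tsum_nonneg hnn₂)) (mul_nonneg hc0 (tsum_nonneg hnn₁)),
    fun ξ hξ y => ?_⟩
  have hξ0 : 0 < ξ := (Real.exp_pos 1).trans_le hξ
  have hlog : 1 ≤ Real.log ξ := (Real.le_log_iff_exp_le hξ0).mpr hξ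
  have hlog0 : 0 < Real.log ξ := by linarith
  have hZ : 0 < ξ ^ ϑ := Real.rpow_pos_of_pos hξ0 _
  have hξρ : 0 < ξ ^ (-ρ) := Real.rpow_pos_of_pos hξ0 _
  set T := ξ * Real.log ξ ^ ρ⁻¹ with hT
  have hT0 : 0 < T := by positivity
  have hfin := finite_threshold₂ (q₁ := q₁) hσ₁.one_lt hσ₂.one_lt hτ
    (hσ₁.summable_rpow hθ hlam hq₁) T (ξ ^ ϑ)
  set K : ℕ := ⌊ϑ * Real.log ξ / (τ * Real.log 2)⌋₊ + 1 with hKdef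
  have hK : ∀ g ∈ {g : ℕ × EvenIdx | σ₁ g.2 ^ q₁ ≤ T ∧ (2 : ℝ) ^ (τ * g.1) * σ₂ g.2 ≤ ξ ^ ϑ},
      g.1 < K := by
    intro g hg
    have := fst_le_of_threshold₂ hσ₂.one_lt hτ hg.2
    rw [Real.log_rpow hξ0] at this
    exact Nat.lt_succ_of_le (Nat.le_floor this)
  have hKc : 1 + K * A ≤ c * Real.log ξ := by
    have h4 : (K : ℝ) ≤ (ϑ / (τ * Real.log 2) + 1) * Real.log ξ := by
      have := Nat.floor_le (by positivity : 0 ≤ ϑ * Real.log ξ / (τ * Real.log 2))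
      rw [hKdef]; push_cast
      rw [add_mul, div_mul_eq_mul_div, one_mul]
      linarith
    have h5 := mul_le_mul_of_nonneg_right h4 hA.le
    rw [hc]; nlinarith
  refine (norm_sub_symInterp_le hP 𝔧 hA hr0 hr1 h1 h2 h3 hp hvc hfin
    (isLowerSet_threshold₂ hσ₁.one_lt hσ₂.one_lt hσ₁.mono hσ₂.mono hq₁ hτ _ _) hK
    ((hs₂.hasSum.mul_left (A' * ξ ^ (-ρ))).add (hs₁.hasSum.mul_left (c * ξ ^ (-ρ))))
    (fun μ => ?_) y).trans_eq (by ring)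
  have hx₁ : 0 ≤ weight θ lam μ * ‖ι (x μ)‖ := mul_nonneg (hw μ).le (norm_nonneg _)
  have hx₂ : 0 ≤ weight θ lam μ * ‖x μ‖ := mul_nonneg (hw μ).le (norm_nonneg _)
  by_cases hμ : σ₁ μ ^ q₁ ≤ T
  · left
    obtain ⟨κ, hκ, hκ'⟩ := exists_first_missing_level hK μ
    refine ⟨κ, hκ, ?_⟩
    have hκ'' : ξ ^ ϑ < (2 : ℝ) ^ (τ * κ) * σ₂ μ := by
      by_contra h
      exact hκ' ⟨hμ, not_lt.mp h⟩
    have hdecay := pow_le_of_threshold₂ hα hτ hZ (hσ₂.pos μ) hκ''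
    rw [← hr, ← Real.rpow_mul hξ0.le, mul_neg, hϑρ, hατ] at hdecay
    have hrest : 0 ≤ c * ξ ^ (-ρ) * (σ₁ μ ^ (1 - q₁ / 2) * (weight θ lam μ * ‖ι (x μ)‖)) :=
      mul_nonneg (by positivity) (hnn₁ μ)
    calc A' * r ^ κ * (weight θ lam μ * ‖x μ‖)
        ≤ A' * (ξ ^ (-ρ) * σ₂ μ ^ (1 - q₂ / 2)) * (weight θ lam μ * ‖x μ‖) := by gcongr
      _ = A' * ξ ^ (-ρ) * (σ₂ μ ^ (1 - q₂ / 2) * (weight θ lam μ * ‖x μ‖)) := by ring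
      _ ≤ _ := le_add_of_nonneg_right hrest
  · right
    have hTρ : ξ ^ ρ * Real.log ξ ≤ σ₁ μ ^ (1 - q₁ / 2) := by
      have := Real.rpow_le_rpow hT0.le (not_le.mp hμ).le hρ.le
      rw [hT, Real.mul_rpow hξ0.le (by positivity), ← Real.rpow_mul hlog0.le,
        inv_mul_cancel₀ hρ.ne', Real.rpow_one, ← Real.rpow_mul (hσ₁.pos μ).le, hρq] at this
      exact this
    have hlogle : Real.log ξ ≤ ξ ^ (-ρ) * σ₁ μ ^ (1 - q₁ / 2) := by
      have e : ξ ^ (-ρ) * (ξ ^ ρ * Real.log ξ) = Real.log ξ := by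
        rw [← mul_assoc, ← Real.rpow_add hξ0, neg_add_cancel, Real.rpow_zero, one_mul]
      rw [← e]
      gcongr
    have hrest : 0 ≤ A' * ξ ^ (-ρ) * (σ₂ μ ^ (1 - q₂ / 2) * (weight θ lam μ * ‖x μ‖)) :=
      mul_nonneg (by positivity) (hnn₂ μ)
    calc (1 + K * A) * (weight θ lam μ * ‖ι (x μ)‖)
        ≤ c * Real.log ξ * (weight θ lam μ * ‖ι (x μ)‖) := by gcongr
      _ ≤ c * (ξ ^ (-ρ) * σ₁ μ ^ (1 - q₁ / 2)) * (weight θ lam μ * ‖ι (x μ)‖) := by gcongr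
      _ = c * ξ ^ (-ρ) * (σ₁ μ ^ (1 - q₁ / 2) * (weight θ lam μ * ‖ι (x μ)‖)) := by ring
      _ ≤ _ := le_add_of_nonneg_left hrest

/-! ### The choice of the threshold -/

/-- The thresholds `ξ_n = n / D`, where `D ξ` bounds the sum of the dimensions. If `n ≤ D`, this is
not above `1`; then every threshold between `1` and `σ_0^q` serves, as the index set is empty and
such `n` are bounded. -/
theorem exists_thresholds₁ (hP : SpatialApprox ι V P α) (hα : 0 < α) (𝔧 : JacobiParams)
    (hp : ∀ μ y, ∑ ν ∈ evenBelow μ, |𝔧.incrJ ν μ y| ≤ weight θ lam μ)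
    (hvc : ∀ y, HasSum (fun μ : EvenIdx => 𝔧.J μ y • x μ) (vc y))
    (hθ : 0 ≤ θ) (hlam : 0 ≤ lam) {q : ℝ} (hq : 0 < q) (hαq : α ≤ 1 / q - 1 / 2)
    {σ : EvenIdx → ℝ} (hσ : WeightedSummable θ lam q σ fun ν => ‖x ν‖) :
    ∃ ξ : ℕ → ℝ, (∀ n : ℕ, 1 ≤ n → 1 < ξ n ∧ ∀ s : Finset (ℕ × EvenIdx),
        (∀ g ∈ s, (2 : ℝ) ^ g.1 * σ g.2 ^ q ≤ ξ n) → ∑ g ∈ s, (2 : ℝ) ^ g.1 ≤ n) ∧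
      ∃ C, 0 < C ∧ ∀ n : ℕ, 1 ≤ n → ∀ y,
        ‖ι (vc y) - symInterp ι P {g | (2 : ℝ) ^ g.1 * σ g.2 ^ q ≤ ξ n} vc y‖ ≤
          C * (n : ℝ) ^ (-α) := by
  obtain ⟨B, hB0, hB⟩ := exists_error_threshold₁ hP hα 𝔧 hp hvc hθ hlam hq hαq hσ
  have hs := hσ.summable_rpow hθ hlam hq
  set D := max 1 (2 * ∑' ν, σ ν ^ (-q)) with hD
  have hD1 : 1 ≤ D := le_max_left _ _
  have hD0 : 0 < D := by linarith
  let o : EvenIdx := ⟨0, fun j => by simp⟩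
  have ho : 1 < σ o ^ q := Real.one_lt_rpow (hσ.one_lt o) hq
  -- with the threshold `ξ₀` the index set is empty
  set ξ₀ := (1 + σ o ^ q) / 2 with hξ₀
  have hξ₀1 : 1 < ξ₀ := by rw [hξ₀]; linarith
  refine ⟨fun n => if D < n then n / D else ξ₀, fun n hn => ?_, (B + 1) * D ^ α,
    by positivity, fun n hn y => ?_⟩
  · have hn0 : (0 : ℝ) < n := by exact_mod_cast hn
    dsimp only
    split_ifs with h
    · refine ⟨(one_lt_div hD0).mpr h, fun s hs' => ?_⟩
      refine (sum_threshold₁_le hσ.one_lt hs (by positivity) s hs').trans ?_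
      calc 2 * (∑' ν, σ ν ^ (-q)) * (n / D) ≤ D * (n / D) := by gcongr; exact le_max_right _ _
        _ = n := by field_simp
    · refine ⟨hξ₀1, fun s hs' => ?_⟩
      have : s = ∅ := by
        rw [Finset.eq_empty_iff_forall_notMem]
        intro g hg
        have h1 := hs' g hg
        have h2 : σ o ^ q ≤ σ g.2 ^ q :=
          Real.rpow_le_rpow (hσ.pos o).le (hσ.mono fun j => Nat.zero_le _) hq.le
        have h3 : (1 : ℝ) ≤ 2 ^ g.1 := one_le_pow₀ (by norm_num)
        have h4 : ξ₀ < σ o ^ q := by rw [hξ₀]; linarith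
        nlinarith
      rw [this]; simp
  · have hn0 : (0 : ℝ) < n := by exact_mod_cast hn
    have hnα : 0 < (n : ℝ) ^ (-α) := Real.rpow_pos_of_pos hn0 _
    have hkey : ∀ ξ : ℝ, (n : ℝ) / D ≤ ξ → B * ξ ^ (-α) ≤ (B + 1) * D ^ α * (n : ℝ) ^ (-α) := by
      intro ξ hξ
      have h1 : ξ ^ (-α) ≤ ((n : ℝ) / D) ^ (-α) :=
        Real.rpow_le_rpow_of_nonpos (by positivity) hξ (by linarith)
      rw [Real.div_rpow hn0.le hD0.le, Real.rpow_neg hD0.le, div_inv_eq_mul] at h1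
      calc B * ξ ^ (-α) ≤ B * ((n : ℝ) ^ (-α) * D ^ α) := by gcongr
        _ ≤ (B + 1) * ((n : ℝ) ^ (-α) * D ^ α) := by gcongr; linarith
        _ = _ := by ring
    dsimp only
    split_ifs with h
    · exact (hB _ (by positivity) y).trans (hkey _ le_rfl)
    · refine (hB _ (by linarith) y).trans (hkey _ ?_)
      exact ((div_le_one hD0).mpr (not_lt.mp h)).trans hξ₀1.le

set_option maxHeartbeats 800000 in
/-- The thresholds `ξ_n = z_n`, where `D z_n^a (log n)^b = n` and `D ξ^a (log ξ)^b` bounds the sum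
of the dimensions. This requires `z_n ≥ e` for the error bound and `log n ≥ 1` to pass from
`log z_n` to `log n`; for the other `n` the error over the empty index set is compared with the
rate, using that `z_n` is bounded there. -/
theorem exists_thresholds₂ (hP : SpatialApprox ι V P α) (hα : 0 < α) (𝔧 : JacobiParams)
    (hp : ∀ μ y, ∑ ν ∈ evenBelow μ, |𝔧.incrJ ν μ y| ≤ weight θ lam μ)
    (hvc : ∀ y, HasSum (fun μ : EvenIdx => 𝔧.J μ y • x μ) (vc y))
    (hθ : 0 ≤ θ) (hlam : 0 ≤ lam) {q₁ q₂ : ℝ} (hq₁ : 0 < q₁) (hq₁₂ : q₁ ≤ q₂) (hq₂2 : q₂ < 2)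
    (hαq : 1 / q₂ - 1 / 2 < α) {σ₁ σ₂ : EvenIdx → ℝ}
    (hσ₁ : WeightedSummable θ lam q₁ σ₁ fun ν => ‖ι (x ν)‖)
    (hσ₂ : WeightedSummable θ lam q₂ σ₂ fun ν => ‖x ν‖) {τ ϑ ρ : ℝ} (hτ : τ = 2 * α / (2 - q₂))
    (hρ : ρ = 1 / q₁ - 1 / 2) (hϑ : ϑ = 2 / (2 - q₂) * ρ) :
    ∃ ξ : ℕ → ℝ, (∀ n : ℕ, 1 ≤ n → 1 < ξ n ∧ ∀ s : Finset (ℕ × EvenIdx),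
        (∀ g ∈ s, σ₁ g.2 ^ q₁ ≤ ξ n * Real.log (ξ n) ^ ρ⁻¹ ∧
          (2 : ℝ) ^ (τ * g.1) * σ₂ g.2 ≤ ξ n ^ ϑ) → ∑ g ∈ s, (2 : ℝ) ^ g.1 ≤ n) ∧
      ∃ C, 0 < C ∧ ∀ n : ℕ, 2 ≤ n → ∀ y,
        ‖ι (vc y) - symInterp ι P {g | σ₁ g.2 ^ q₁ ≤ ξ n * Real.log (ξ n) ^ ρ⁻¹ ∧
          (2 : ℝ) ^ (τ * g.1) * σ₂ g.2 ≤ ξ n ^ ϑ} vc y‖ ≤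
          C * ((n : ℝ) ^ (-rateβ α q₁ q₂) * Real.log n ^ rateκ α q₁ q₂) := by
  have hq₂ : 0 < q₂ := hq₁.trans_le hq₁₂
  have hq₁2 : q₁ < 2 := hq₁₂.trans_lt hq₂2
  have h2q : 0 < 2 - q₂ := by linarith
  have hτ0 : 0 < τ := by rw [hτ]; positivity
  have hρ0 : 0 < ρ := by
    rw [hρ, sub_pos]; exact one_div_lt_one_div_of_lt hq₁ hq₁2
  have hϑ0 : 0 < ϑ := by rw [hϑ]; positivity
  have hατ : α / τ = 1 - q₂ / 2 := by rw [hτ]; field_simp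
  have hϑρ : ϑ * (α / τ) = ρ := by rw [hατ, hϑ]; field_simp
  have hρq : q₁ * ρ = 1 - q₁ / 2 := by rw [hρ]; field_simp
  obtain ⟨B, hB0, hB⟩ := exists_error_threshold₂ hP hα 𝔧 hp hvc hθ hlam hq₁ hq₂ hτ0 hϑ0 hρ0 hρq hατ
    hϑρ hσ₁ hσ₂
  have hsum := hσ₁.summable_mul hθ hlam hq₁ hq₁2 fun ν => norm_nonneg (ι (x ν))
  have hs₁ := hσ₁.summable_rpow hθ hlam hq₁
  have hs₂ := hσ₂.summable_rpow hθ hlam hq₂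
  set S := ∑' μ : EvenIdx, weight θ lam μ * ‖ι (x μ)‖ with hS
  have hw : ∀ ν : EvenIdx, 0 < weight θ lam (ν : ℕ →₀ ℕ) :=
    fun ν => one_pos.trans_le (one_le_weight hθ hlam _)
  have hS0 : 0 ≤ S := tsum_nonneg fun ν => mul_nonneg (hw ν).le (norm_nonneg _)
  -- the sum of the dimensions is at most `D ξ^a (log ξ)^b`
  set s := 1 / (τ * q₂) with hs
  have hτq : 1 < τ * q₂ := by
    rw [hτ, div_mul_eq_mul_div, one_lt_div h2q]
    rw [div_sub_div _ _ hq₂.ne' two_ne_zero, div_lt_iff₀ (by positivity)] at hαq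
    linarith
  have hs1 : s < 1 := by rw [hs]; exact (div_lt_one (by positivity)).mpr hτq
  set a := ϑ / τ + (1 - s) with ha
  set b := ρ⁻¹ * (1 - s) with hb
  have hδ : 0 ≤ 1 / q₁ - 1 / q₂ := sub_nonneg.mpr (one_div_le_one_div_of_le hq₁ hq₁₂)
  have hαδ : 0 < α + (1 / q₁ - 1 / q₂) := by linarith
  have ha' : a = (α + (1 / q₁ - 1 / q₂)) / α := by
    rw [ha, hs, hϑ, hτ, hρ]; field_simp; ring
  have ha1 : 1 ≤ a := by rw [ha', one_le_div hα]; linarith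
  have ha0 : 0 < a := by linarith
  have hb0 : 0 < b := mul_pos (inv_pos.mpr hρ0) (by linarith)
  have hβ : rateβ α q₁ q₂ = ρ / a := by
    rw [rateβ, ha', hρ, div_div_eq_mul_div, mul_div_assoc]
  have hκ : rateκ α q₁ q₂ = b * (ρ / a) := by
    have e : b * (ρ / a) = (1 - s) / a := by rw [hb]; field_simp
    have e2 : 1 - s = (α + 1 / 2 - 1 / q₂) / α := by rw [hs, hτ]; field_simp; ring
    rw [e, e2, ha', rateκ, div_div_div_cancel_right₀ hα.ne']
    congr 1; ring
  set D := max 1 (2 * (∑' ν, σ₁ ν ^ (-q₁) + ∑' ν, σ₂ ν ^ (-q₂))) with hD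
  have hD1 : 1 ≤ D := le_max_left _ _
  have hD0 : 0 < D := by linarith
  -- `z n` solves `D z^a (log n)^b = n`
  set z : ℕ → ℝ := fun n => ((n : ℝ) / (D * Real.log n ^ b)) ^ (1 / a) with hz
  have hlogn : ∀ n : ℕ, 2 ≤ n → 0 < Real.log n := fun n hn =>
    Real.log_pos (by exact_mod_cast hn)
  have hbase : ∀ n : ℕ, 2 ≤ n → 0 < (n : ℝ) / (D * Real.log n ^ b) := by
    intro n hn
    have := Real.rpow_pos_of_pos (hlogn n hn) b
    have : (0 : ℝ) < n := by exact_mod_cast (by omega : 0 < n)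
    positivity
  have hz0 : ∀ n : ℕ, 2 ≤ n → 0 < z n := fun n hn => Real.rpow_pos_of_pos (hbase n hn) _
  have hzrate : ∀ n : ℕ, 2 ≤ n → z n ^ (-ρ) =
      D ^ (ρ / a) * ((n : ℝ) ^ (-rateβ α q₁ q₂) * Real.log n ^ rateκ α q₁ q₂) := by
    intro n hn
    have hL := hlogn n hn
    have hn0 : (0 : ℝ) < n := by exact_mod_cast (by omega : 0 < n)
    have e : 1 / a * -ρ = -(ρ / a) := by ring
    rw [hz]
    dsimp only
    rw [← Real.rpow_mul (hbase n hn).le, e, hβ, hκ, Real.div_rpow hn0.le (by positivity),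
      Real.mul_rpow hD0.le (by positivity), Real.rpow_neg hD0.le, Real.rpow_neg (x := _ ^ b)
      (by positivity), ← Real.rpow_mul hL.le]
    field_simp
  -- with the threshold `ξ₀` the index set is empty
  set ξ₀ := Real.exp (Real.exp (-ρ)) with hξ₀
  have hξ₀1 : 1 < ξ₀ := Real.one_lt_exp_iff.mpr (Real.exp_pos _)
  have hξ₀T : ξ₀ * Real.log ξ₀ ^ ρ⁻¹ ≤ 1 := by
    rw [hξ₀, Real.log_exp, ← Real.exp_mul, neg_mul, mul_inv_cancel₀ hρ0.ne', ← Real.exp_add,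
      Real.exp_le_one_iff]
    have : Real.exp (-ρ) ≤ 1 := Real.exp_le_one_iff.mpr (by linarith)
    linarith
  have hempty : ∀ g : ℕ × EvenIdx, ¬(σ₁ g.2 ^ q₁ ≤ ξ₀ * Real.log ξ₀ ^ ρ⁻¹) := fun g hg =>
    absurd (hg.trans hξ₀T) (not_le.mpr (Real.one_lt_rpow (hσ₁.one_lt g.2) hq₁))
  set M := max (Real.exp 1) (z 2) with hM
  have hM0 : 0 < M := (Real.exp_pos 1).trans_le (le_max_left _ _)
  have hMρ : 0 < M ^ ρ := Real.rpow_pos_of_pos hM0 _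
  have hDρ : 0 < D ^ (ρ / a) := Real.rpow_pos_of_pos hD0 _
  refine ⟨fun n => if 3 ≤ n ∧ Real.exp 1 ≤ z n then z n else ξ₀, fun n hn => ?_,
    (B + S * M ^ ρ + 1) * D ^ (ρ / a), by positivity, fun n hn y => ?_⟩
  · have hn0 : (0 : ℝ) < n := by exact_mod_cast hn
    dsimp only
    split_ifs with h
    · obtain ⟨hn3, hze⟩ := h
      have he1 : 1 < Real.exp 1 := Real.one_lt_exp_iff.mpr one_pos
      have hz1 : 1 < z n := he1.trans_le hze
      have hzn := hz0 n (by omega)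
      have hlz : 0 < Real.log (z n) := Real.log_pos hz1
      refine ⟨hz1, fun t ht => ?_⟩
      have hT0 : 0 < z n * Real.log (z n) ^ ρ⁻¹ := by positivity
      refine (sum_threshold₂_le hσ₁.one_lt hσ₂.one_lt hτ0 hq₂ hτq.le hs₁ hs₂ hT0
        (Real.rpow_pos_of_pos hzn _) t ht).trans ?_
      rw [← hs]
      have e1 : (z n ^ ϑ) ^ (1 / τ) * (z n * Real.log (z n) ^ ρ⁻¹) ^ (1 - s) =
          z n ^ a * Real.log (z n) ^ b := by
        rw [Real.mul_rpow hzn.le (by positivity), ← Real.rpow_mul hzn.le,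
          ← Real.rpow_mul hlz.le, ← mul_assoc, ← Real.rpow_add hzn, ha, hb, mul_one_div]
      have e2 : z n ^ a = (n : ℝ) / (D * Real.log n ^ b) := by
        rw [hz]; dsimp only
        rw [← Real.rpow_mul (hbase n (by omega)).le, one_div_mul_cancel ha0.ne', Real.rpow_one]
      have hlogn1 : 1 ≤ Real.log n := by
        rw [Real.le_log_iff_exp_le hn0]
        have : (3 : ℝ) ≤ n := by exact_mod_cast hn3
        linarith [Real.exp_one_lt_d9]
      have hLb : 1 ≤ Real.log n ^ b := Real.one_le_rpow hlogn1 hb0.le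
      -- `z n ≤ n`, whence `log (z n) ≤ log n`
      have hzle : z n ≤ n := by
        have h1 : z n ^ a ≤ (n : ℝ) ^ a := by
          rw [e2]
          have h2 : (n : ℝ) / (D * Real.log n ^ b) ≤ n := by
            refine div_le_self hn0.le ?_
            nlinarith
          refine h2.trans (Real.self_le_rpow_of_one_le ?_ ha1)
          exact_mod_cast hn
        exact (Real.rpow_le_rpow_iff hzn.le hn0.le ha0).mp h1
      have hll : Real.log (z n) ^ b ≤ Real.log n ^ b :=
        Real.rpow_le_rpow hlz.le (Real.log_le_log hzn hzle) hb0.le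
      rw [e1]
      calc _ ≤ D * (z n ^ a * Real.log n ^ b) := by
            gcongr
            exact le_max_right _ _
        _ = n := by rw [e2]; field_simp
    · refine ⟨hξ₀1, fun t ht => ?_⟩
      have : t = ∅ := by
        rw [Finset.eq_empty_iff_forall_notMem]
        exact fun g hg => hempty g (ht g hg).1
      rw [this]; simp
  · have hzn := hz0 n hn
    have hzρ : 0 < z n ^ (-ρ) := Real.rpow_pos_of_pos hzn _
    have hgoal : (B + S * M ^ ρ) * z n ^ (-ρ) ≤ (B + S * M ^ ρ + 1) * D ^ (ρ / a) *
          ((n : ℝ) ^ (-rateβ α q₁ q₂) * Real.log n ^ rateκ α q₁ q₂) := by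
      have e := hzrate n hn
      calc (B + S * M ^ ρ) * z n ^ (-ρ) ≤ (B + S * M ^ ρ + 1) * z n ^ (-ρ) :=
            mul_le_mul_of_nonneg_right (le_add_of_nonneg_right zero_le_one) hzρ.le
        _ = _ := by rw [e, mul_assoc]
    refine le_trans ?_ hgoal
    dsimp only
    split_ifs with h
    · refine (hB _ h.2 y).trans ?_
      have : 0 ≤ S * M ^ ρ := by positivity
      gcongr
      linarith
    · have hset : {g : ℕ × EvenIdx | σ₁ g.2 ^ q₁ ≤ ξ₀ * Real.log ξ₀ ^ ρ⁻¹ ∧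
          (2 : ℝ) ^ (τ * g.1) * σ₂ g.2 ≤ ξ₀ ^ ϑ} = ∅ :=
        Set.eq_empty_of_forall_notMem fun g hg => hempty g hg.1
      refine (norm_sub_symInterp_empty_le hP hα 𝔧 hp hvc hsum hset y).trans ?_
      rw [← hS]
      have hzM : z n ≤ M := by
        by_contra hlt
        push Not at hlt
        have h1 := (le_max_left _ _).trans_lt hlt
        rcases Nat.lt_or_ge n 3 with h3 | h3
        · have : n = 2 := by omega
          subst this
          exact absurd hlt (not_lt.mpr (le_max_right _ _))
        · exact h ⟨h3, h1.le⟩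
      have h2 : 1 ≤ M ^ ρ * z n ^ (-ρ) := by
        rw [Real.rpow_neg hzn.le, ← div_eq_mul_inv, one_le_div (Real.rpow_pos_of_pos hzn _)]
        exact Real.rpow_le_rpow hzn.le hzM hρ0.le
      calc S ≤ S * (M ^ ρ * z n ^ (-ρ)) := le_mul_of_one_le_right hS0 h2
        _ = S * M ^ ρ * z n ^ (-ρ) := (mul_assoc _ _ _).symm
        _ ≤ (B + S * M ^ ρ) * z n ^ (-ρ) :=
            mul_le_mul_of_nonneg_right (le_add_of_nonneg_left hB0) hzρ.le

end Error

end JacobiSparse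

theorem mainTheorem3 {𝕜 X₁ X₂ : Type*} [RCLike 𝕜]
    [NormedAddCommGroup X₁] [InnerProductSpace 𝕜 X₁] [CompleteSpace X₁]
    [NormedSpace ℝ X₁] [IsScalarTower ℝ 𝕜 X₁]
    [NormedAddCommGroup X₂] [InnerProductSpace 𝕜 X₂] [CompleteSpace X₂]
    [NormedSpace ℝ X₂] [IsScalarTower ℝ 𝕜 X₂]
    (ι : X₂ →L[𝕜] X₁) (hι : Function.Injective ι)
    (𝔧 : JacobiSparse.JacobiParams)
    (ε Cε : ℝ) (hε : 0 < ε) (hCε : 0 < Cε)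
    (hJ : ∀ j k : ℕ, 1 ≤ k → ∀ t : JacobiSparse.II,
      2 * |(JacobiSparse.jacobi (𝔧.a j) (𝔧.b j) k).eval (t : ℝ)| * Real.log (2 * k + 3) ≤
        (Cε * k + 1) ^ (𝔧.θ₀ + ε))
    (α q₁ q₂ : ℝ) (hα : 0 < α) (hq₁ : 0 < q₁) (hq₁₂ : q₁ ≤ q₂) (hq₂ : q₂ < 2)
    (V : ℕ → Submodule 𝕜 X₁) (P : ℕ → X₁ →ₗ[𝕜] X₁)
    (hP : JacobiSparse.SpatialApprox ι V P α)
    (v : JacobiSparse.Cube → X₂) (hv : 𝔧.HasEvenExpansion v)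
    (σ₁ σ₂ : JacobiSparse.EvenIdx → ℝ)
    (hσ₁ : JacobiSparse.WeightedSummable (𝔧.θ₀ + 1 + ε) (Cε + 1) q₁ σ₁
      fun ν => ‖ι (𝔧.coeff v ν)‖)
    (hσ₂ : JacobiSparse.WeightedSummable (𝔧.θ₀ + 1 + ε) (Cε + 1) q₂ σ₂
      fun ν => ‖𝔧.coeff v ν‖) :
    ∃ vc : C(JacobiSparse.Cube, X₂), vc =ᵐ[𝔧.measure] v ∧
      ∃ ξ : ℕ → ℝ,
        (∀ n : ℕ, 1 ≤ n →
          1 < ξ n ∧ (JacobiSparse.evenThreshold α q₁ q₂ σ₁ σ₂ (ξ n)).Finite ∧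
          Module.rank 𝕜 (JacobiSparse.approxSpace 𝔧 V
            (JacobiSparse.evenThreshold α q₁ q₂ σ₁ σ₂ (ξ n))) ≤ n ∧
          ((∀ j, 𝔧.a j = 𝔧.b j) →
            JacobiSparse.symInterp ι P (JacobiSparse.evenThreshold α q₁ q₂ σ₁ σ₂ (ξ n)) vc ∈
              JacobiSparse.approxSpace 𝔧 V
                (JacobiSparse.evenThreshold α q₁ q₂ σ₁ σ₂ (ξ n)))) ∧
        (1 / q₂ - 1 / 2 < α →
          0 < JacobiSparse.rateκ α q₁ q₂ ∧ JacobiSparse.rateκ α q₁ q₂ < 1) ∧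
        ∃ C : ℝ, 0 < C ∧ ∀ n : ℕ, 1 ≤ n → (1 / q₂ - 1 / 2 < α → 2 ≤ n) →
          ∀ p : ENNReal, 0 < p → p ≤ 2 →
            MeasureTheory.eLpNorm
              (fun y => ι (vc y) - JacobiSparse.symInterp ι P
                (JacobiSparse.evenThreshold α q₁ q₂ σ₁ σ₂ (ξ n)) vc y) p 𝔧.measure ≤
              ENNReal.ofReal (C * JacobiSparse.rate α q₁ q₂ n) := by
  have hθ : 0 ≤ 𝔧.θ₀ + 1 + ε := by linarith [𝔧.θ₀_nonneg]
  have hlam : 0 ≤ Cε + 1 := by linarith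
  have hq₁2 : q₁ < 2 := hq₁₂.trans_lt hq₂
  have hq₂0 : 0 < q₂ := hq₁.trans_le hq₁₂
  have hp := 𝔧.sum_abs_incrJ_le hε hCε hJ
  obtain ⟨vc, hvcv, hvc⟩ := 𝔧.exists_continuous_representative hv
    (JacobiSparse.JacobiParams.abs_J_le 𝔧 hp)
    (hσ₂.summable_mul hθ hlam hq₂0 hq₂ fun ν => norm_nonneg _)
  have hs₁ := hσ₁.summable_rpow hθ hlam hq₁
  have hs₂ := hσ₂.summable_rpow hθ hlam hq₂0
  have hprob := 𝔧.isProbabilityMeasure_measure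
  -- everything but the bound on `κ` follows from a bound on the dimensions and a uniform error
  -- bound
  suffices H : (∀ ξ, (JacobiSparse.evenThreshold α q₁ q₂ σ₁ σ₂ ξ).Finite ∧
      IsLowerSet (JacobiSparse.evenThreshold α q₁ q₂ σ₁ σ₂ ξ)) ∧
      ∃ ξ : ℕ → ℝ, (∀ n : ℕ, 1 ≤ n → 1 < ξ n ∧ ∀ s : Finset (ℕ × JacobiSparse.EvenIdx),
        (∀ g ∈ s, g ∈ JacobiSparse.evenThreshold α q₁ q₂ σ₁ σ₂ (ξ n)) →
          ∑ g ∈ s, (2 : ℝ) ^ g.1 ≤ n) ∧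
      ∃ C, 0 < C ∧ ∀ n : ℕ, 1 ≤ n → (1 / q₂ - 1 / 2 < α → 2 ≤ n) → ∀ y,
        ‖ι (vc y) - JacobiSparse.symInterp ι P
          (JacobiSparse.evenThreshold α q₁ q₂ σ₁ σ₂ (ξ n)) vc y‖ ≤
          C * JacobiSparse.rate α q₁ q₂ n by
    obtain ⟨hG, ξ, hξ, C, hC, herr⟩ := H
    refine ⟨vc, hvcv, ξ, fun n hn => ⟨(hξ n hn).1, (hG _).1, ?_, fun hab => ?_⟩, fun hαq => ?_,
      C, hC, fun n hn hn2 p _ _ => ?_⟩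
    · have hrank := JacobiSparse.rank_approxSpace_le 𝔧 hP.rank_le (hG (ξ n)).1.toFinset
      rw [(hG (ξ n)).1.coe_toFinset] at hrank
      refine hrank.trans ?_
      have := (hξ n hn).2 (hG (ξ n)).1.toFinset fun g hg => (hG (ξ n)).1.mem_toFinset.mp hg
      exact_mod_cast this
    · exact JacobiSparse.symInterp_mem_approxSpace hP.mem 𝔧 hab hvc (hG _).1 (hG _).2
    · have h1 : 1 / q₂ ≤ 1 / q₁ := one_div_le_one_div_of_le hq₁ hq₁₂
      have h2 : 1 / 2 < 1 / q₁ := one_div_lt_one_div_of_lt hq₁ hq₁2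
      have h3 : 0 < α + 1 / q₁ - 1 / q₂ := by linarith
      exact ⟨div_pos (by linarith) h3, (div_lt_one h3).mpr (by linarith)⟩
    · refine (MeasureTheory.eLpNorm_le_of_ae_bound
        (Filter.Eventually.of_forall (herr n hn hn2))).trans_eq ?_
      rw [MeasureTheory.measure_univ, ENNReal.one_rpow, one_mul]
  by_cases hαq : α ≤ 1 / q₂ - 1 / 2
  · have hE : ∀ ξ, JacobiSparse.evenThreshold α q₁ q₂ σ₁ σ₂ ξ =
        {g | (2 : ℝ) ^ g.1 * σ₂ g.2 ^ q₂ ≤ ξ} := fun ξ => if_pos hαq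
    have hR : ∀ n, JacobiSparse.rate α q₁ q₂ n = (n : ℝ) ^ (-α) := fun n => if_pos hαq
    obtain ⟨ξ, hξ, C, hC, herr⟩ :=
      JacobiSparse.exists_thresholds₁ hP hα 𝔧 hp hvc hθ hlam hq₂0 hαq hσ₂
    simp only [hE, hR]
    exact ⟨fun ξ => ⟨JacobiSparse.finite_threshold₁ hσ₂.one_lt hq₂0 hs₂ ξ,
      JacobiSparse.isLowerSet_threshold₁ hσ₂.one_lt hσ₂.mono hq₂0 ξ⟩, ξ, hξ, C, hC,
      fun n hn _ => herr n hn⟩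
  · have hτ : 0 < 2 * α / (2 - q₂) := div_pos (by linarith) (by linarith)
    have hE : ∀ ξ, JacobiSparse.evenThreshold α q₁ q₂ σ₁ σ₂ ξ =
        {g | σ₁ g.2 ^ q₁ ≤ ξ * Real.log ξ ^ (1 / q₁ - 1 / 2)⁻¹ ∧
          (2 : ℝ) ^ (2 * α / (2 - q₂) * g.1) * σ₂ g.2 ≤
            ξ ^ (2 / (2 - q₂) * (1 / q₁ - 1 / 2))} := fun ξ => if_neg hαq
    have hR : ∀ n, JacobiSparse.rate α q₁ q₂ n =
        (n : ℝ) ^ (-JacobiSparse.rateβ α q₁ q₂) * Real.log n ^ JacobiSparse.rateκ α q₁ q₂ :=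
      fun n => if_neg hαq
    obtain ⟨ξ, hξ, C, hC, herr⟩ := JacobiSparse.exists_thresholds₂ hP hα 𝔧 hp hvc hθ hlam hq₁
      hq₁₂ hq₂ (not_le.mp hαq) hσ₁ hσ₂ rfl rfl rfl
    simp only [hE, hR]
    exact ⟨fun ξ => ⟨JacobiSparse.finite_threshold₂ hσ₁.one_lt hσ₂.one_lt hτ hs₁ _ _,
      JacobiSparse.isLowerSet_threshold₂ hσ₁.one_lt hσ₂.one_lt hσ₁.mono hσ₂.mono hq₁ hτ _ _⟩,
      ξ, hξ, C, hC, fun n _ hn2 => herr n (hn2 (not_le.mp hαq))⟩
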